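/- **Setting.** Let $\mathcal A$ be a small abelian category and $\mathcal B\subset\mathcal A$ a strictly full abelian subcategory (in particular closed under finite direct sums) that is closed under subobjects and quotients, such that every object of $\mathcal A$ is an extension of two objects of $\mathcal B$. Let $i:\mathcal B\to\mathcal A$ be the inclusion, extended to $i:\operatorname{Pro}(\mathcal B)\to\operatorname{Pro}(\mathcal A)$. * $\mathcal E_{\mathcal A,\mathcal B}$ is the category of pairs $(X,Y)$ with $X\in\mathcal A$, $Y\subset X$ a subobject, $Y\in\mathcal B$ and $X/Y\in\mathcal B$; a morphism $(X,Y)\to(X',Y')$ is a morphism $f:X\to X'$ with $f(Y)\subset Y'$. * For a quasi-abelian category $\mathcal E$ (additive, with kernels and cokernels, strict monomorphisms stable under pushouts, strict epimorphisms stable under pullbacks), the admissible short exact sequences are the sequences $X\xrightarrow{f}Y\xrightarrow{g}Z$ with $f=\ker g$, $g=\operatorname{coker} f$; $D^b(\mathcal E)$ is the localization of the bounded homotopy category at the morphisms with acyclic cone (acyclic: spliced from admissible short exact sequences). The (right) abelian envelope $\mathcal{LH}(\mathcal E)$ is the heart of the t-structure on $D^b(\mathcal E)$ whose connective part consists of the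 objects isomorphic to complexes in nonnegative homological degrees, i.e. the full subcategory of those connective $K$ with $\operatorname{Hom}(L,K)=0$ for every $L$ isomorphic to a complex in homological degrees $\ge 1$. * $j:\mathcal A\to\operatorname{Pro}(\mathcal B)$ is the functor $j(X)=\varprojlim Y$ (formal limit) over the codirected set of subobjects $Y\subset X$ with $Y\in\mathcal B$, $X/Y\in\mathcal B$. $\widetilde j\to j$ is the universal right exact functor over $j$; explicitly, for $Y\in\mathcal B$ the presheaf $\operatorname{Hom}(\widetilde j(-),Y)$ is the sheafification of $\operatorname{Hom}(j(-),Y)$ for the topology on $\mathcal A$ whose covering sieves are the sieves containing an epimorphism. * $\mathcal C_{\mathcal A,\mathcal B}$ is the category of quadruples $(X,Y,u,v)$ with $X\in\mathcal A$, $Y\in\mathcal B$, $u:i(Y)\to X$, $v:\widetilde j(X)\to Y$ such that (i) the composition $\widetilde j(i(Y))\xrightarrow{\widetilde j(u)}\widetilde j(X)\xrightarrow{v}Y$ is zero, and (ii) $u\circ i(v): i(\widetilde j(X))\to X$ equals the composition of the canonical maps $i(\widetilde j(X))\to i(j(X))\to X$. A morphism $(X,Y,u,v)\to(X',Y',u',v')$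 is a pair of morphisms $X\to X'$, $Y\to Y'$ compatible with $u,u'$ and $v,v'$. * $\alpha:\mathcal E_{\mathcal A,\mathcal B}\to\mathcal C_{\mathcal A,\mathcal B}$ sends $(X,Y)$ to $(X,Y,u,v)$, where $u:Y\hookrightarrow X$ is the inclusion and $v$ is the composition $\widetilde j(X)\to j(X)\to Y$ of canonical maps. **Proposition.** The functor $\widetilde j$ so constructed is right exact, and every natural transformation $F\to j$ from a right exact functor $F:\mathcal A\to\operatorname{Pro}(\mathcal B)$ factors uniquely through $\widetilde j\to j$. The category $\mathcal E_{\mathcal A,\mathcal B}$ is quasi-abelian, $\mathcal C_{\mathcal A,\mathcal B}$ is abelian, and $\alpha$ is additive, exact (it takes admissible short exact sequences to short exact sequences) and fully faithful. Every object of $\mathcal E_{\mathcal A,\mathcal B}$, placed in degree $0$, lies in $\mathcal{LH}(\mathcal E_{\mathcal A,\mathcal B})$, and $\alpha$ induces an equivalence $$\mathcal{LH}(\mathcal E_{\mathcal A,\mathcal B})\xrightarrow{\ \sim\ }\mathcal C_{\mathcal A,\mathcal B},$$ that is, there is an equivalence whose restriction along $\mathcal E_{\mathcal A,\mathcal B}\to\mathcal{LH}(\mathcal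 E_{\mathcal A,\mathcal B})$ is isomorphic to $\alpha$. -/

import Mathlib

open CategoryTheory CategoryTheory.Limits Opposite

universe v u

set_option linter.unusedSectionVars false

noncomputable section

/-! ## Quasi-abelian categories and the (right) abelian envelope -/

namespace QuasiAb

section Admissible

variable {E : Type u} [Category.{v} E] [HasZeroMorphisms E]

/-- `0 ⟶ X₁ ⟶ X₂ ⟶ X₃ ⟶ 0` is an admissible short exact sequence: `f` is a kernel of `g` and
`g` is a cokernel of `f`. -/
def IsAdmissible (S : ShortComplex E) : Prop :=
  Nonempty (IsLimit (KernelFork.ofι S.f S.zero)) ∧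
    Nonempty (IsColimit (CokernelCofork.ofπ S.g S.zero))

variable (E) in
/-- Strict monomorphisms: `f` is the kernel of its cokernel. -/
def strictMono : MorphismProperty E := fun _ Y f =>
  ∃ (Z : E) (g : Y ⟶ Z) (w : f ≫ g = 0),
    Nonempty (IsColimit (CokernelCofork.ofπ g w)) ∧ Nonempty (IsLimit (KernelFork.ofι f w))

variable (E) in
/-- Strict epimorphisms: `g` is the cokernel of its kernel. -/
def strictEpi : MorphismProperty E := fun Y _ g =>
  ∃ (X : E) (f : X ⟶ Y) (w : f ≫ g = 0),
    Nonempty (IsLimit (KernelFork.ofι f w)) ∧ Nonempty (IsColimit (CokernelCofork.ofπ g w))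

end Admissible

/-- An additive category is quasi-abelian if it has kernels and cokernels, strict monomorphisms
are stable under pushouts and strict epimorphisms are stable under pullbacks. -/
structure IsQuasiAbelian (E : Type u) [Category.{v} E] [Preadditive E] : Prop where
  hasFiniteBiproducts : HasFiniteBiproducts E
  hasKernels : HasKernels E
  hasCokernels : HasCokernels E
  strictMono_pushout : (strictMono E).IsStableUnderCobaseChange
  strictEpi_pullback : (strictEpi E).IsStableUnderBaseChange

section Derived

variable (E : Type u) [Category.{v} E] [Preadditive E]

/-- A complex is (strictly) acyclic if it is spliced from admissible short exact sequences
`Zⁿ ⟶ Kⁿ ⟶ Zⁿ⁺¹`. -/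
def StrictlyAcyclic {E : Type u} [Category.{v} E] [Preadditive E] (K : CochainComplex E ℤ) : Prop :=
  ∃ (Z : ℤ → E) (i : ∀ n, Z n ⟶ K.X n) (p : ∀ n, K.X n ⟶ Z (n + 1)),
    (∀ n, p n ≫ i (n + 1) = K.d n (n + 1)) ∧
      ∀ n, ∃ w : i n ≫ p n = 0, IsAdmissible (ShortComplex.mk (i n) (p n) w)

/-- The acyclic complexes, as objects of the homotopy category. -/
def acyclic : ObjectProperty (HomotopyCategory E (ComplexShape.up ℤ)) :=
  fun K => StrictlyAcyclic K.as

variable [HasZeroObject E]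

/-- The bounded complexes, as objects of the homotopy category. -/
def bounded : ObjectProperty (HomotopyCategory E (ComplexShape.up ℤ)) :=
  fun K => ∃ a b : ℤ, CochainComplex.IsStrictlyGE K.as a ∧ CochainComplex.IsStrictlyLE K.as b

/-- The bounded homotopy category `K^b(E)`. -/
abbrev Kb := (bounded E).FullSubcategory

/-- The functor `E ⥤ K^b(E)` sending `X` to `X` placed in degree `0`. -/
def toKb : E ⥤ Kb E :=
  (bounded E).lift (HomologicalComplex.single E (ComplexShape.up ℤ) 0 ⋙
    HomotopyCategory.quotient E (ComplexShape.up ℤ)) fun X =>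
      ⟨0, 0, inferInstanceAs (CochainComplex.IsStrictlyGE
          ((HomologicalComplex.single E (ComplexShape.up ℤ) 0).obj X) 0),
        inferInstanceAs (CochainComplex.IsStrictlyLE
          ((HomologicalComplex.single E (ComplexShape.up ℤ) 0).obj X) 0)⟩

variable [HasBinaryBiproducts E]

/-- Morphisms of `K^b(E)` whose cone is acyclic. -/
def quasiIso : MorphismProperty (Kb E) := (acyclic E).trW.inverseImage (bounded E).ι

/-- The bounded derived category `D^b(E)` of `E` with its class of admissible short exact
sequences: the localization of `K^b(E)` at the morphisms with acyclic cone. -/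
abbrev Db := (quasiIso E).Localization

/-- The functor `E ⥤ D^b(E)` sending `X` to `X` placed in degree `0`. -/
def toDb : E ⥤ Db E := toKb E ⋙ (quasiIso E).Q

/-- The objects of `D^b(E)` isomorphic to a bounded complex living in cohomological degrees `≤ n`,
that is in homological degrees `≥ -n`. -/
def connective (n : ℤ) : ObjectProperty (Db E) := fun K =>
  ∃ L : Kb E, CochainComplex.IsStrictlyLE L.obj.as n ∧ Nonempty (K ≅ (quasiIso E).Q.obj L)

/-- The heart of the t-structure on `D^b(E)` whose connective part consists of the complexes in
nonnegative homological degrees: the connective objects `K` with `Hom(L, K) = 0` for all complexes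
`L` in homological degrees `≥ 1` (a t-structure is determined by its connective part in this way). -/
def heart : ObjectProperty (Db E) := fun K =>
  connective E 0 K ∧ ∀ L : Db E, connective E (-1) L → Subsingleton (L ⟶ K)

/-- The (right) abelian envelope `LH(E)`: the heart of the above t-structure on `D^b(E)`. -/
abbrev LH := (heart E).FullSubcategory

end Derived
end QuasiAb

/-! ## Pro-objects -/

namespace ProObj

/-- Pro-objects: `Pro(C) = Ind(Cᵒᵖ)ᵒᵖ`. -/
abbrev Pro (C : Type v) [SmallCategory C] : Type (v + 1) := (Ind Cᵒᵖ)ᵒᵖ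

/-- The functor `C ⥤ Pro(C)`, constant pro-objects. -/
def const (C : Type v) [SmallCategory C] : C ⥤ Pro C := (Ind.yoneda (C := Cᵒᵖ)).rightOp

instance (C : Type v) [SmallCategory C] : (const C).Full :=
  inferInstanceAs (Ind.yoneda (C := Cᵒᵖ)).rightOp.Full

instance (C : Type v) [SmallCategory C] : (const C).Faithful :=
  inferInstanceAs (Ind.yoneda (C := Cᵒᵖ)).rightOp.Faithful

section
variable {C D : Type v} [SmallCategory C] [SmallCategory D] [HasFiniteLimits D] (F : C ⥤ D)

/-- The extension `Pro(C) ⥤ Pro(D)` of a functor `F : C ⥤ D`: in terms of ind-objects, it is the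
left Kan extension of `F` along the embedding of constant objects. -/
def map : Pro C ⥤ Pro D :=
  ((Ind.yoneda (C := Cᵒᵖ)).leftKanExtension (F.op ⋙ Ind.yoneda (C := Dᵒᵖ))).op

instance : IsIso ((Ind.yoneda (C := Cᵒᵖ)).leftKanExtensionUnit
    (F.op ⋙ Ind.yoneda (C := Dᵒᵖ))) :=
  have (X : Cᵒᵖ) : IsIso (((Ind.yoneda (C := Cᵒᵖ)).leftKanExtensionUnit
      (F.op ⋙ Ind.yoneda (C := Dᵒᵖ))).app X) :=
    inferInstanceAs (IsIso (((Ind.yoneda (C := Cᵒᵖ)).lanUnit.app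
      (F.op ⋙ Ind.yoneda (C := Dᵒᵖ))).app X))
  NatIso.isIso_of_isIso_app _

/-- `map F` extends `F`. -/
def mapConstIso : const C ⋙ map F ≅ F ⋙ const D :=
  NatIso.ofComponents (fun X => (asIso (((Ind.yoneda (C := Cᵒᵖ)).leftKanExtensionUnit
    (F.op ⋙ Ind.yoneda (C := Dᵒᵖ))).app (op X))).op) (fun {X Y} f => by
      have := ((Ind.yoneda (C := Cᵒᵖ)).leftKanExtensionUnit
        (F.op ⋙ Ind.yoneda (C := Dᵒᵖ))).naturality f.op
      exact Quiver.Hom.unop_inj this.symm)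

end
end ProObj

/-! ## The construction -/

namespace Devissage

open ProObj

/-- `B` is a strictly full abelian subcategory of the abelian category `A`, closed under subobjects
and quotients, and each object of `A` is an extension of two objects of `B`.
(Being strictly full follows from closure under subobjects; being an abelian full subcategory then
amounts to closure under finite direct sums.) -/
class IsTwoStep {A : Type u} [Category.{v} A] [Abelian A] (B : ObjectProperty A) : Prop extends
    B.IsClosedUnderSubobjects, B.IsClosedUnderQuotients, B.IsClosedUnderFiniteProducts where
  exists_extension (X : A) : ∃ (Y Z : A) (f : Y ⟶ X) (g : X ⟶ Z) (w : f ≫ g = 0),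
    (ShortComplex.mk f g w).ShortExact ∧ B Y ∧ B Z

variable {A : Type v} [SmallCategory A] [Abelian A] (B : ObjectProperty A)

/-- The subobjects `Y ⊆ X` with `Y ∈ B` and `X/Y ∈ B`, ordered by inclusion. -/
abbrev Good (X : A) : Type v :=
  { Y : Subobject X // B (Y : A) ∧ B (cokernel Y.arrow) }

variable {B}

/-- The object of `B` underlying an element of `Good B X`. -/
abbrev Good.toB {X : A} (Z : Good B X) : B.FullSubcategory := ⟨(Z.1 : A), Z.2.1⟩

/-- The morphism `Z ⟶ W` in `B` induced by a morphism `f : X ⟶ X'` with `f(Z) ⊆ W`. -/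
def Good.restrict {X X' : A} (Z : Good B X) (W : Good B X') (f : X ⟶ X')
    (h : W.1.Factors (Z.1.arrow ≫ f)) : Z.toB ⟶ W.toB :=
  B.homMk (W.1.factorThru (Z.1.arrow ≫ f) h)

lemma Good.restrict_hom_arrow {X X' : A} (Z : Good B X) (W : Good B X') (f : X ⟶ X')
    (h : W.1.Factors (Z.1.arrow ≫ f)) :
    (Z.restrict W f h).hom ≫ W.1.arrow = Z.1.arrow ≫ f :=
  Subobject.factorThru_arrow _ _ h

lemma Good.hom_ext {X : A} {T : B.FullSubcategory} {W : Good B X} {a b : T ⟶ W.toB}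
    (h : a.hom ≫ W.1.arrow = b.hom ≫ W.1.arrow) : a = b :=
  B.hom_ext ((cancel_mono W.1.arrow).1 h)

variable (B) in
/-- The inverse system of the `Z ∈ Good B X`, as a functor to `B`. -/
def goodDiagram (X : A) : Good B X ⥤ B.FullSubcategory where
  obj Z := Z.toB
  map {Z W} f := B.homMk (Subobject.ofLE Z.1 W.1 (leOfHom f))
  map_id Z := Good.hom_ext (by simp [Good.toB])
  map_comp f g := Good.hom_ext (by
    simp [ObjectProperty.homMk])

variable [IsTwoStep B]

instance : B.ContainsZero where
  exists_zero := by
    obtain ⟨O, hO⟩ := HasZeroObject.zero (C := A)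
    obtain ⟨Y, Z, f, g, w, hS, h, _⟩ := IsTwoStep.exists_extension (B := B) O
    have := hO.mono (hO.to_ Y)
    exact ⟨O, hO, B.prop_of_mono (hO.to_ Y) h⟩

lemma prop_cokernel_of_kernel {X W : A} (g : X ⟶ W) (hW : B W) (Z : Subobject X)
    (h : Z.Factors (kernel.ι g)) : B (cokernel Z.arrow) := by
  have w : kernel.ι g ≫ cokernel.π Z.arrow = 0 := by
    rw [← Z.factorThru_arrow _ h, Category.assoc, cokernel.condition, comp_zero]
  have hI : B (Abelian.coimage g) := B.prop_of_mono (Abelian.factorThruCoimage g) hW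
  have : Epi (cokernel.desc (kernel.ι g) (cokernel.π Z.arrow) w) :=
    epi_of_epi_fac (cokernel.π_desc _ _ w)
  exact B.prop_of_epi (cokernel.desc (kernel.ι g) (cokernel.π Z.arrow) w) hI

lemma factors_of_comp_π {X T : A} (Z : Subobject X) (k : T ⟶ X)
    (h : k ≫ cokernel.π Z.arrow = 0) : Z.Factors k := by
  have := Subobject.factors_comp_arrow (P := Z) (Abelian.monoLift Z.arrow k h)
  rwa [Abelian.monoLift_comp] at this

/-- Given `f : X ⟶ X'`, good subobjects of `X` mapping into a given good subobject of `X'` are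
coinitial. For `f = 𝟙 X`, this says that `Good B X` is codirected. -/
lemma exists_good_le {X X' : A} (Z₀ : Good B X) (f : X ⟶ X') (W : Good B X') :
    ∃ Z : Good B X, Z ≤ Z₀ ∧ W.1.Factors (Z.1.arrow ≫ f) := by
  let g := biprod.lift (cokernel.π Z₀.1.arrow) (f ≫ cokernel.π W.1.arrow)
  have w : (kernelSubobject g).arrow ≫ g = 0 := kernelSubobject_arrow_comp g
  have h₁ : (kernelSubobject g).arrow ≫ cokernel.π Z₀.1.arrow = 0 := by
    have := w =≫ biprod.fst
    rwa [Category.assoc, biprod.lift_fst, zero_comp] at this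
  have h₂ : (kernelSubobject g).arrow ≫ f ≫ cokernel.π W.1.arrow = 0 := by
    have := w =≫ biprod.snd
    rwa [Category.assoc, biprod.lift_snd, zero_comp] at this
  have hle : kernelSubobject g ≤ Z₀.1 := Subobject.le_of_factors (factors_of_comp_π _ _ h₁)
  refine ⟨⟨kernelSubobject g, B.prop_of_mono (Subobject.ofLE _ _ hle) Z₀.2.1,
    prop_cokernel_of_kernel g ?_ _ ?_⟩, hle, factors_of_comp_π _ _ (by simpa using h₂)⟩
  · exact B.prop_of_iso (biprod.isoProd _ _).symm (B.prop_prod _ _ Z₀.2.2 W.2.2)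
  · exact (kernelSubobject_factors_iff _ _).2 (kernel.condition g)

instance (X : A) : Nonempty (Good B X) := by
  obtain ⟨Y, Z, f, g, w, hS, h₁, h₃⟩ := IsTwoStep.exists_extension (B := B) X
  have := hS.mono_f
  exact ⟨Subobject.mk f, B.prop_of_iso (Subobject.underlyingIso f).symm h₁,
    prop_cokernel_of_kernel g h₃ _ ((Subobject.mk_factors_iff f _).2
      ⟨hS.fIsKernel.lift (KernelFork.ofι _ (kernel.condition g)),
        hS.fIsKernel.fac (KernelFork.ofι _ (kernel.condition g)) WalkingParallelPair.zero⟩)⟩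

/-! ### The functor `j` -/

variable (B) in
/-- The pro-object `j(X)`: the formal inverse limit of the `Z ⊆ X` with `Z ∈ B` and `X/Z ∈ B`,
i.e. the limit of this codirected system in `Pro(B)`. -/
def jObj (X : A) : Pro B.FullSubcategory := limit (goodDiagram B X ⋙ const B.FullSubcategory)

/-- The projection `j(X) ⟶ Z`. -/
def jπ {X : A} (Z : Good B X) : jObj B X ⟶ (const B.FullSubcategory).obj Z.toB :=
  limit.π (goodDiagram B X ⋙ const B.FullSubcategory) Z

lemma jπ_w {X : A} {Z W : Good B X} (h : Z ≤ W) :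
    jπ Z ≫ (const _).map (B.homMk (Subobject.ofLE Z.1 W.1 h) : Z.toB ⟶ W.toB) = jπ W :=
  limit.w (goodDiagram B X ⋙ const B.FullSubcategory) (homOfLE h)

lemma jObj_hom_ext {X : A} {T : Pro B.FullSubcategory} {a b : T ⟶ jObj B X}
    (h : ∀ Z : Good B X, a ≫ jπ Z = b ≫ jπ Z) : a = b :=
  limit.hom_ext h

lemma jπ_restrict {X X' : A} (f : X ⟶ X') (W : Good B X') (Z₁ Z₂ : Good B X)
    (h₁ : W.1.Factors (Z₁.1.arrow ≫ f)) (h₂ : W.1.Factors (Z₂.1.arrow ≫ f)) :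
    jπ Z₁ ≫ (const _).map (Z₁.restrict W f h₁) = jπ Z₂ ≫ (const _).map (Z₂.restrict W f h₂) := by
  obtain ⟨Z, hZ₁, hZ₂⟩ := exists_good_le Z₁ (𝟙 X) Z₂
  have hZ₂' : Z ≤ Z₂ := Subobject.le_of_factors (by simpa using hZ₂)
  rw [← jπ_w hZ₁, ← jπ_w hZ₂', Category.assoc, Category.assoc, ← Functor.map_comp,
    ← Functor.map_comp]
  congr 2
  refine Good.hom_ext ?_
  simp only [ObjectProperty.FullSubcategory.comp_hom, ObjectProperty.homMk, Category.assoc,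
    Good.restrict_hom_arrow]
  rw [← Category.assoc, ← Category.assoc, Subobject.ofLE_arrow, Subobject.ofLE_arrow]

lemma exists_good_map {X X' : A} (f : X ⟶ X') (W : Good B X') :
    ∃ Z : Good B X, W.1.Factors (Z.1.arrow ≫ f) :=
  let ⟨Z, _, h⟩ := exists_good_le (Classical.arbitrary (Good B X)) f W
  ⟨Z, h⟩

/-- The action of `j` on a morphism `f : X ⟶ X'`; it is determined by `jMap_π` below. -/
def jMap {X X' : A} (f : X ⟶ X') : jObj B X ⟶ jObj B X' :=
  limit.lift (goodDiagram B X' ⋙ const B.FullSubcategory)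
    { pt := jObj B X
      π :=
        { app W := jπ (exists_good_map f W).choose ≫
            (const _).map (Good.restrict _ W f (exists_good_map f W).choose_spec)
          naturality W W' g := by
            have hg : W ≤ W' := leOfHom g
            have h := (exists_good_map f W).choose_spec
            have h' : W'.1.Factors ((exists_good_map f W).choose.1.arrow ≫ f) :=
              Subobject.factors_of_le _ hg h
            refine (Category.id_comp _).trans ?_
            refine (jπ_restrict f W' _ _ (exists_good_map f W').choose_spec h').trans ?_
            refine Eq.trans ?_ (Category.assoc _ _ _).symm
            refine congrArg (jπ _ ≫ ·) (Eq.trans ?_ ((const _).map_comp _ _))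
            refine congrArg (const _).map (Good.hom_ext ?_)
            have e := Good.restrict_hom_arrow _ W f h
            have e' := Good.restrict_hom_arrow _ W' f h'
            refine e'.trans (e.symm.trans ?_)
            simp [goodDiagram, ObjectProperty.homMk] } }

lemma jMap_π {X X' : A} (f : X ⟶ X') (Z : Good B X) (W : Good B X')
    (h : W.1.Factors (Z.1.arrow ≫ f)) :
    jMap f ≫ jπ W = jπ Z ≫ (const _).map (Z.restrict W f h) :=
  (limit.lift_π _ _).trans (jπ_restrict f W _ _ _ _)

variable (B) in
/-- The functor `j : A ⥤ Pro(B)`. -/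
def j : A ⥤ Pro B.FullSubcategory where
  obj := jObj B
  map := jMap
  map_id X := jObj_hom_ext fun Z => by
    rw [jMap_π (𝟙 X) Z Z (by simpa using Z.1.factors_self), Category.id_comp]
    have : Z.restrict Z (𝟙 X) (by simpa using Z.1.factors_self) = 𝟙 _ :=
      Good.hom_ext (by simp [Good.restrict_hom_arrow])
    rw [this, CategoryTheory.Functor.map_id, Category.comp_id]
  map_comp {X X' X''} f g := jObj_hom_ext fun W => by
    obtain ⟨W', -, h'⟩ := exists_good_le (Classical.arbitrary (Good B X')) g W
    obtain ⟨Z, -, h⟩ := exists_good_le (Classical.arbitrary (Good B X)) f W'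
    have e : Z.1.arrow ≫ f ≫ g = W'.1.factorThru _ h ≫ W'.1.arrow ≫ g := by
      rw [← Category.assoc, ← Category.assoc, Subobject.factorThru_arrow]
    have h'' : W.1.Factors (Z.1.arrow ≫ f ≫ g) := by
      rw [e]; exact Subobject.factors_of_factors_right _ h'
    rw [jMap_π (f ≫ g) Z W h'', Category.assoc, jMap_π g W' W h', ← Category.assoc,
      jMap_π f Z W' h, Category.assoc, ← Functor.map_comp]
    congr 2
    refine Good.hom_ext ?_
    have := Good.restrict_hom_arrow Z W' f h
    simp [Good.restrict_hom_arrow, reassoc_of% this]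

/-- The projection `j(X) ⟶ Y` for `Y ⊆ X` with `Y ∈ B` and `X/Y ∈ B`. -/
def jProj {X : A} (Z : Good B X) : (j B).obj X ⟶ (const B.FullSubcategory).obj Z.toB := jπ Z

lemma j_map_jProj {X X' : A} (f : X ⟶ X') (Z : Good B X) (W : Good B X')
    (h : W.1.Factors (Z.1.arrow ≫ f)) :
    (j B).map f ≫ jProj W = jProj Z ≫ (const _).map (Z.restrict W f h) :=
  jMap_π f Z W h

lemma jProj_w {X : A} {Z W : Good B X} (h : Z ≤ W) :
    jProj Z ≫ (const _).map (B.homMk (Subobject.ofLE Z.1 W.1 h) : Z.toB ⟶ W.toB) = jProj W :=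
  jπ_w h

/-! ### The functor `j̃` -/

variable (A) in
/-- The single epi topology: a sieve is covering if it contains an epimorphism. -/
def singleEpiTopology : GrothendieckTopology A where
  sieves X := { S | ∃ (Y : A) (f : Y ⟶ X), Epi f ∧ S f }
  top_mem' X := ⟨X, 𝟙 X, inferInstance, trivial⟩
  pullback_stable' X Y S g := by
    rintro ⟨Z, f, hf, h⟩
    refine ⟨pullback f g, pullback.snd f g, inferInstance, ?_⟩
    change S (pullback.snd f g ≫ g)
    rw [← pullback.condition]
    exact S.downward_closed h _
  transitive' := by
    rintro X S ⟨Y, f, hf, h⟩ R hR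
    obtain ⟨Z, g, hg, h'⟩ := hR h
    exact ⟨Z, g ≫ f, epi_comp _ _, h'⟩

variable (B) in
/-- The presheaves `X ↦ Hom(j(X), Y)` on `A`, functorially in `Y ∈ B`. (The value of an ind-object
`P` of `Bᵒᵖ` at `Y` is the set of morphisms in `Ind(Bᵒᵖ)` from `Y` to `P`, i.e. the set of morphisms
in `Pro(B)` from `P` to `Y`.) -/
def jHom : (B.FullSubcategoryᵒᵖ)ᵒᵖ ⥤ Aᵒᵖ ⥤ Type v :=
  ((j B).leftOp ⋙ Ind.inclusion _).flip

variable (B) in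
/-- The sheafifications of the presheaves `X ↦ Hom(j(X), Y)` for the single epi topology. -/
def jTildeHom : (B.FullSubcategoryᵒᵖ)ᵒᵖ ⥤ Aᵒᵖ ⥤ Type v :=
  jHom B ⋙ presheafToSheaf (singleEpiTopology A) (Type v) ⋙
    sheafToPresheaf (singleEpiTopology A) (Type v)

variable (B) in
/-- The sheafification maps. -/
def jHomToJTildeHom : jHom B ⟶ jTildeHom B :=
  Functor.whiskerLeft (jHom B) (sheafificationAdjunction (singleEpiTopology A) (Type v)).unit

lemma preservesFiniteLimits_jHom : PreservesFiniteLimits (jHom B) where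
  preservesFiniteLimits K _ _ :=
    preservesLimitsOfShape_of_evaluation _ _ fun X =>
      have := (isIndObject_iff_preservesFiniteLimits _).1
        (((j B).leftOp.obj X).isIndObject_inclusion_obj)
      inferInstanceAs (PreservesLimitsOfShape K
        ((Ind.inclusion _).obj ((j B).leftOp.obj X)))

lemma isIndObject_jTildeHom (X : Aᵒᵖ) : IsIndObject ((jTildeHom B).flip.obj X) := by
  rw [isIndObject_iff_preservesFiniteLimits]
  have := preservesFiniteLimits_jHom (B := B)
  have : PreservesFiniteLimits (sheafToPresheaf (singleEpiTopology A) (Type v)) := inferInstance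
  exact inferInstanceAs (PreservesFiniteLimits (jHom B ⋙
    presheafToSheaf (singleEpiTopology A) (Type v) ⋙
    sheafToPresheaf (singleEpiTopology A) (Type v) ⋙ (evaluation _ _).obj X))

variable (B) in
/-- The functor `j̃ : A ⥤ Pro(B)`, where `j̃(X)` is the pro-object such that `Hom(j̃(-), Y)` is the
sheafification of `Hom(j(-), Y)` for the single epi topology, functorially in `Y ∈ B`. -/
def jTilde : A ⥤ Pro B.FullSubcategory :=
  (ObjectProperty.lift _ (jTildeHom B).flip isIndObject_jTildeHom ⋙
    (Ind.equivalence _).inverse).rightOp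

variable (B) in
/-- By construction, `Hom(j̃(X), Y)` is the value at `X` of the sheafification. -/
def jTildeInclusionIso : (jTilde B).leftOp ⋙ Ind.inclusion _ ≅ (jTildeHom B).flip :=
  Functor.isoWhiskerLeft (ObjectProperty.lift _ (jTildeHom B).flip isIndObject_jTildeHom)
    (Functor.isoWhiskerRight (Ind.equivalence _).counitIso (ObjectProperty.ι _))

variable (B) in
/-- The canonical morphism `j̃ ⟶ j`, given by the sheafification maps. -/
def jTildeToJ : jTilde B ⟶ j B :=
  NatTrans.removeLeftOp (((Ind.inclusion.fullyFaithful (C := B.FullSubcategoryᵒᵖ)).whiskeringRight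
    Aᵒᵖ).preimage ((flipFunctor _ _ _).map (jHomToJTildeHom B) ≫ (jTildeInclusionIso B).inv))

/-! ### The canonical map `i(j(X)) ⟶ X` -/

variable (B) in
/-- The extension `i : Pro(B) ⥤ Pro(A)` of the inclusion of `B` in `A`. -/
abbrev proι : Pro B.FullSubcategory ⥤ Pro A := ProObj.map B.ι

/-- The morphism `i(P) ⟶ X` of pro-objects of `A` given by a morphism `P ⟶ Z` in `Pro(B)` and a
morphism `i(Z) ⟶ X` in `A`. -/
def proExtend {P : Pro B.FullSubcategory} {Z : B.FullSubcategory} {X : A}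
    (p : P ⟶ (const B.FullSubcategory).obj Z) (u : Z.obj ⟶ X) :
    (proι B).obj P ⟶ (const A).obj X :=
  (proι B).map p ≫ (mapConstIso B.ι).hom.app Z ≫ (const A).map u

lemma proExtend_map {P : Pro B.FullSubcategory} {Z Z' : B.FullSubcategory} {X : A}
    (p : P ⟶ (const B.FullSubcategory).obj Z) (g : Z ⟶ Z') (u : Z'.obj ⟶ X) :
    proExtend (p ≫ (const _).map g) u = proExtend p (g.hom ≫ u) := by
  have := (mapConstIso B.ι).hom.naturality g
  simp only [Functor.comp_map] at this
  simp [proExtend, reassoc_of% this]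

lemma map_proExtend {Q P : Pro B.FullSubcategory} {Z : B.FullSubcategory} {X : A} (q : Q ⟶ P)
    (p : P ⟶ (const B.FullSubcategory).obj Z) (u : Z.obj ⟶ X) :
    (proι B).map q ≫ proExtend p u = proExtend (q ≫ p) u := by
  simp [proExtend]

variable (B) in
/-- The canonical morphism `i(j(X)) ⟶ X`: the composition `i(j(X)) ⟶ i(Z) ⟶ X` for any `Z ⊆ X`
with `Z ∈ B` and `X/Z ∈ B`. It does not depend on `Z`, see `jToSelf_eq`. -/
def jToSelf (X : A) : (proι B).obj ((j B).obj X) ⟶ (const A).obj X :=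
  proExtend (jProj (Classical.arbitrary (Good B X))) (Classical.arbitrary (Good B X)).1.arrow

lemma proExtend_jProj {X : A} {W Z : Good B X} (h : W ≤ Z) :
    proExtend (jProj Z) Z.1.arrow = proExtend (jProj W) W.1.arrow := by
  rw [← jProj_w h, proExtend_map]
  simp [ObjectProperty.homMk]

lemma jToSelf_eq {X : A} (Z : Good B X) : jToSelf B X = proExtend (jProj Z) Z.1.arrow := by
  obtain ⟨W, hW, hW'⟩ := exists_good_le (Classical.arbitrary (Good B X)) (𝟙 X) Z
  have hWZ : W ≤ Z := Subobject.le_of_factors (by simpa using hW')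
  exact (proExtend_jProj hW).trans (proExtend_jProj hWZ).symm

/-! ### The category `C_{A,B}` -/

variable (B) in
/-- The objects `(X, Y, u, v)` of the category `C_{A,B}`. -/
structure CAB where
  X : A
  Y : B.FullSubcategory
  u : Y.obj ⟶ X
  v : (jTilde B).obj X ⟶ (const B.FullSubcategory).obj Y
  /-- The composition `j̃(i(Y)) ⟶ j̃(X) ⟶ Y` is zero. -/
  zero : (jTilde B).map u ≫ v = 0
  /-- The compositions `i(j̃(X)) ⟶ i(Y) ⟶ X` and `i(j̃(X)) ⟶ i(j(X)) ⟶ X` are equal. -/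
  comm : proExtend v u = (proι B).map ((jTildeToJ B).app X) ≫ jToSelf B X

namespace CAB

/-- A morphism `(X, Y, u, v) ⟶ (X', Y', u', v')` in `C_{A,B}` is a pair of morphisms `X ⟶ X'` and
`Y ⟶ Y'` compatible with `u, u'` and `v, v'`. -/
@[ext]
structure Hom (K L : CAB B) where
  f : K.X ⟶ L.X
  g : K.Y ⟶ L.Y
  comm_u : g.hom ≫ L.u = K.u ≫ f
  comm_v : K.v ≫ (const _).map g = (jTilde B).map f ≫ L.v

instance : Category (CAB B) where
  Hom := Hom
  id K := { f := 𝟙 _, g := 𝟙 _, comm_u := by simp, comm_v := by simp }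
  comp a b :=
    { f := a.f ≫ b.f
      g := a.g ≫ b.g
      comm_u := by
        simp only [ObjectProperty.FullSubcategory.comp_hom, Category.assoc]
        rw [b.comm_u, ← Category.assoc, a.comm_u, Category.assoc]
      comm_v := by
        rw [Functor.map_comp, Functor.map_comp, Category.assoc, ← b.comm_v, ← Category.assoc,
          a.comm_v, Category.assoc] }
  id_comp a := Hom.ext (Category.id_comp _) (Category.id_comp _)
  comp_id a := Hom.ext (Category.comp_id _) (Category.comp_id _)
  assoc a b c := Hom.ext (Category.assoc _ _ _) (Category.assoc _ _ _)

end CAB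

/-! ### The category `E_{A,B}` -/

variable (B) in
/-- The objects of `E_{A,B}`: pairs `(X, Y)` with `X ∈ A` and `Y ⊆ X` such that `Y ∈ B` and
`X/Y ∈ B`. -/
structure EAB where
  X : A
  Y : Good B X

namespace EAB

/-- A morphism `(X, Y) ⟶ (X', Y')` is a morphism `f : X ⟶ X'` with `f(Y) ⊆ Y'`. -/
@[ext]
structure Hom (K L : EAB B) where
  f : K.X ⟶ L.X
  factors : L.Y.1.Factors (K.Y.1.arrow ≫ f)

/-- The induced morphism `Y ⟶ Y'`. -/
abbrev Hom.g {K L : EAB B} (a : Hom K L) : K.Y.toB ⟶ L.Y.toB := K.Y.restrict L.Y a.f a.factors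

instance : Category (EAB B) where
  Hom := Hom
  id K := ⟨𝟙 _, by simpa using K.Y.1.factors_self⟩
  comp {K L M} a b := ⟨a.f ≫ b.f, by
    have := Subobject.factors_of_factors_right a.g.hom b.factors
    rwa [← Category.assoc, Good.restrict_hom_arrow, Category.assoc] at this⟩
  id_comp a := Hom.ext (Category.id_comp _)
  comp_id a := Hom.ext (Category.comp_id _)
  assoc a b c := Hom.ext (Category.assoc _ _ _)

@[ext]
lemma hom_ext {K L : EAB B} {a b : K ⟶ L} (h : a.f = b.f) : a = b := Hom.ext h

@[simp] lemma id_f (K : EAB B) : Hom.f (𝟙 K) = 𝟙 K.X := rfl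
@[simp] lemma comp_f {K L M : EAB B} (a : K ⟶ L) (b : L ⟶ M) : (a ≫ b).f = a.f ≫ b.f := rfl

lemma factors_neg {X T : A} {P : Subobject X} {k : T ⟶ X} (h : P.Factors k) : P.Factors (-k) := by
  rw [← P.factorThru_arrow k h, ← Preadditive.neg_comp]
  exact Subobject.factors_comp_arrow _

instance (K L : EAB B) : Zero (K ⟶ L) := ⟨⟨0, by simpa using Subobject.factors_zero⟩⟩
instance (K L : EAB B) : Add (K ⟶ L) := ⟨fun a b => ⟨a.f + b.f, by
  rw [Preadditive.comp_add]; exact Subobject.factors_add _ _ a.factors b.factors⟩⟩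
instance (K L : EAB B) : Neg (K ⟶ L) := ⟨fun a => ⟨-a.f, by
  rw [Preadditive.comp_neg]; exact factors_neg a.factors⟩⟩

@[simp] lemma zero_f (K L : EAB B) : Hom.f (0 : K ⟶ L) = 0 := rfl
@[simp] lemma add_f {K L : EAB B} (a b : K ⟶ L) : (a + b).f = a.f + b.f := rfl
@[simp] lemma neg_f {K L : EAB B} (a : K ⟶ L) : (-a).f = -a.f := rfl

instance : Preadditive (EAB B) where
  homGroup K L :=
    { add_assoc a b c := hom_ext (add_assoc _ _ _)
      zero_add a := hom_ext (zero_add _)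
      add_zero a := hom_ext (add_zero _)
      add_comm a b := hom_ext (add_comm _ _)
      neg_add_cancel a := hom_ext (neg_add_cancel _)
      nsmul := nsmulRec
      zsmul := zsmulRec }
  add_comp _ _ _ a b c := hom_ext (Preadditive.add_comp _ _ _ _ _ _)
  comp_add _ _ _ a b c := hom_ext (Preadditive.comp_add _ _ _ _ _ _)

instance : HasZeroObject (EAB B) := by
  obtain ⟨O, hO⟩ := HasZeroObject.zero (C := A)
  refine ⟨⟨O, Classical.arbitrary _⟩, ?_⟩
  rw [IsZero.iff_id_eq_zero]
  exact hom_ext (hO.eq_of_src _ _)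

/-- The subobject `Y ⊕ Y' ⊆ X ⊕ X'`. -/
def biprodGood {X X' : A} (Z : Good B X) (Z' : Good B X') : Good B (X ⊞ X') :=
  ⟨Subobject.mk (biprod.map Z.1.arrow Z'.1.arrow),
    B.prop_of_iso ((biprod.isoProd _ _).symm ≪≫ (Subobject.underlyingIso _).symm)
      (B.prop_prod _ _ Z.2.1 Z'.2.1),
    prop_cokernel_of_kernel
      (biprod.map (cokernel.π Z.1.arrow) (cokernel.π Z'.1.arrow))
      (B.prop_of_iso (biprod.isoProd _ _).symm (B.prop_prod _ _ Z.2.2 Z'.2.2)) _ (by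
        have h := kernel.condition (biprod.map (cokernel.π Z.1.arrow) (cokernel.π Z'.1.arrow))
        have h₁ := h =≫ biprod.fst
        have h₂ := h =≫ biprod.snd
        rw [Category.assoc, biprod.map_fst, zero_comp, ← Category.assoc] at h₁
        rw [Category.assoc, biprod.map_snd, zero_comp, ← Category.assoc] at h₂
        have k₁ := factors_of_comp_π _ _ h₁
        have k₂ := factors_of_comp_π _ _ h₂
        refine (Subobject.mk_factors_iff _ _).2
          ⟨biprod.lift (Z.1.factorThru _ k₁) (Z'.1.factorThru _ k₂), ?_⟩
        apply biprod.hom_ext <;> simp)⟩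

lemma biprodGood_fst {X X' : A} (Z : Good B X) (Z' : Good B X') :
    Z.1.Factors ((biprodGood Z Z').1.arrow ≫ biprod.fst) := by
  have : (biprodGood Z Z').1.arrow ≫ biprod.fst =
      ((Subobject.underlyingIso (biprod.map Z.1.arrow Z'.1.arrow)).hom ≫ biprod.fst) ≫
        Z.1.arrow := by
    simp [biprodGood, ← Subobject.underlyingIso_hom_comp_eq_mk]
  rw [this]
  exact Subobject.factors_comp_arrow _

lemma biprodGood_snd {X X' : A} (Z : Good B X) (Z' : Good B X') :
    Z'.1.Factors ((biprodGood Z Z').1.arrow ≫ biprod.snd) := by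
  have : (biprodGood Z Z').1.arrow ≫ biprod.snd =
      ((Subobject.underlyingIso (biprod.map Z.1.arrow Z'.1.arrow)).hom ≫ biprod.snd) ≫
        Z'.1.arrow := by
    simp [biprodGood, ← Subobject.underlyingIso_hom_comp_eq_mk]
  rw [this]
  exact Subobject.factors_comp_arrow _

/-- The direct sum `(X ⊕ X', Y ⊕ Y')`. -/
def biprodBicone (K L : EAB B) : BinaryBicone K L where
  pt := ⟨K.X ⊞ L.X, biprodGood K.Y L.Y⟩
  fst := ⟨biprod.fst, biprodGood_fst _ _⟩
  snd := ⟨biprod.snd, biprodGood_snd _ _⟩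
  inl := ⟨biprod.inl, (Subobject.mk_factors_iff _ _).2 ⟨biprod.inl, by simp⟩⟩
  inr := ⟨biprod.inr, (Subobject.mk_factors_iff _ _).2 ⟨biprod.inr, by simp⟩⟩
  inl_fst := hom_ext biprod.inl_fst
  inl_snd := hom_ext biprod.inl_snd
  inr_fst := hom_ext biprod.inr_fst
  inr_snd := hom_ext biprod.inr_snd

instance : HasBinaryBiproducts (EAB B) where
  has_binary_biproduct K L := hasBinaryBiproduct_of_total (biprodBicone K L)
    (hom_ext biprod.total)

end EAB

/-! ### The functor `α` -/

/-- The quadruple `(X, Y, u, v)` where `u` is the inclusion and `v` is `j̃(X) ⟶ j(X) ⟶ Y`. -/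
def αObj (K : EAB B) : CAB B where
  X := K.X
  Y := K.Y.toB
  u := K.Y.1.arrow
  v := (jTildeToJ B).app K.X ≫ jProj K.Y
  zero := by
    have h0 : B (cokernel (⊥ : Subobject (K.Y.1 : A)).arrow) :=
      prop_cokernel_of_kernel (𝟙 (K.Y.1 : A)) K.Y.2.1 _ (by
        rw [(cancel_mono (𝟙 _)).1 ((kernel.condition (𝟙 (K.Y.1 : A))).trans zero_comp.symm)]
        exact Subobject.factors_zero)
    let O : Good B (K.Y.1 : A) :=
      ⟨⊥, B.prop_of_mono (⊥ : Subobject (K.Y.1 : A)).arrow K.Y.2.1, h0⟩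
    have w : O.1.arrow ≫ K.Y.1.arrow = 0 := by simp [O]
    have h : K.Y.1.Factors (O.1.arrow ≫ K.Y.1.arrow) := by
      rw [w]; exact Subobject.factors_zero
    have hr : O.restrict K.Y _ h = 0 := Good.hom_ext (by
      rw [Good.restrict_hom_arrow, w]; exact zero_comp.symm)
    rw [(jTildeToJ B).naturality_assoc, j_map_jProj _ O K.Y h, hr, Functor.map_zero, comp_zero,
      comp_zero]
  comm := by rw [jToSelf_eq K.Y, map_proExtend]

variable (B) in
/-- The functor `α : E_{A,B} ⥤ C_{A,B}`. -/
def α : EAB B ⥤ CAB B where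
  obj := αObj
  map {K L} a :=
    { f := a.f
      g := a.g
      comm_u := Good.restrict_hom_arrow _ _ _ _
      comm_v := by
        change ((jTildeToJ B).app K.X ≫ jProj K.Y) ≫ (const _).map a.g =
          (jTilde B).map a.f ≫ (jTildeToJ B).app L.X ≫ jProj L.Y
        rw [(jTildeToJ B).naturality_assoc, j_map_jProj a.f K.Y L.Y a.factors, Category.assoc] }
  map_id K := CAB.Hom.ext rfl (Good.hom_ext ((Good.restrict_hom_arrow _ _ _ _).trans (by
    change _ = 𝟙 _ ≫ _
    simp)))
  map_comp {K L M} a b := CAB.Hom.ext rfl (Good.hom_ext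
    ((Good.restrict_hom_arrow _ _ _ _).trans (by
      change _ = (a.g.hom ≫ b.g.hom) ≫ _
      rw [Category.assoc, Good.restrict_hom_arrow, ← Category.assoc, Good.restrict_hom_arrow,
        Category.assoc, EAB.comp_f])))

end Devissage

end

/-!
The proof rests on a recognition criterion for the abelian envelope, `exists_LH_equivalence`: if
`E` is a full additive subcategory of an abelian category `C`, closed under subobjects, and each
object of `C` is a quotient of an object of `E`, then `C` is the abelian envelope of `E`. Indeed,
closure under subobjects implies that admissible short exact sequences of `E` are those that are
exact in `C`, that a complex in `E` is acyclic exactly if it is exact in `C`, and that canonical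
truncations of complexes in `C` with terms in `E` stay in `E`. Hence the heart consists of the
two-term complexes `X ⟶ Y` with monomorphic differential (`exists_iso_of_heart`), and `H⁰` is
fully faithful on it, by comparing roofs; it is essentially surjective since a kernel of an
epimorphism `Y ⟶ c` is in `E`.

The category of pairs is quasi-abelian by explicit kernels and cokernels: a morphism is a strict
monomorphism exactly if it is a monomorphism on `X` and on `X/Y`, and a strict epimorphism exactly
if it is an epimorphism on `X` and on `Y` (`strictMono_iff`, `strictEpi_iff`).

The functor `j̃` is used only through morphisms to constant pro-objects `Y`, which cogenerate. The
presheaf `Hom(j̃(-), Y)` is the sheafification of `Hom(j(-), Y)` (`W_homFunctorMap`), and a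
morphism `j(X) ⟶ Y` factors through some `Z ⊆ X`, so a morphism `j̃(X) ⟶ Y` is locally on `X` a
morphism `Z ⟶ Y`. Descent along epimorphisms gives the right exactness of `j̃`; conversely
`Hom(F(-), Y)` is a sheaf for a right exact functor `F`, which gives the universal property.

Kernels, cokernels and direct sums of quadruples `(X, Y, u, v)` are computed componentwise,
because `j̃` is right exact; condition (ii) for a cokernel has to be checked after composing with
`i(j̃(L)) ⟶ i(j̃(coker))`, which is allowed by `proExtend_eq_of_epi`. So `C_{A,B}` is abelian.

The essential image of `α` consists of the quadruples for which `u` is a monomorphism, and is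
therefore closed under subobjects. Here `X/Y` is in `B` because, if `v` is represented by `w : Z ⟶
Y` for a cover `p : W ⟶ X` and `Z ⊆ W`, then `p` maps `Z` to `Y`, so `X/Y` is a quotient of `W/Z`
(`CAB.prop_cokernel_of_mono`). Finally each quadruple is a quotient of `α(W, Z) ⊕ α(Y, Y)`
(`exists_epi_α`), and the criterion applies.
-/

noncomputable section

namespace QuasiAb

open Pretriangulated ZeroObject

universe v' u'

/-! ### The bounded homotopy category -/

section Bounded

variable (E : Type u) [Category.{v} E] [Preadditive E] [HasZeroObject E]

lemma bounded_quotient_obj (K : CochainComplex E ℤ) (a b : ℤ) [K.IsStrictlyGE a]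
    [K.IsStrictlyLE b] : bounded E ((HomotopyCategory.quotient _ _).obj K) :=
  ⟨a, b, ‹_›, ‹_›⟩

instance : (bounded E).ContainsZero where
  exists_zero :=
    ⟨(HomotopyCategory.quotient _ _).obj 0, Functor.map_isZero _ (isZero_zero _),
      0, 0, (inferInstance : (0 : CochainComplex E ℤ).IsStrictlyGE 0),
        (inferInstance : (0 : CochainComplex E ℤ).IsStrictlyLE 0)⟩

instance : (bounded E).IsStableUnderShift ℤ where
  isStableUnderShiftBy n :=
    { le_shift := by
        rintro K ⟨a, b, h, h'⟩
        obtain ⟨K : CochainComplex _ _, rfl⟩ := K.quotient_obj_surjective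
        have : K.IsStrictlyGE a := h
        have : K.IsStrictlyLE b := h'
        have := K.isStrictlyGE_shift a n (a - n) (by lia)
        have := K.isStrictlyLE_shift b n (b - n) (by lia)
        rw [ObjectProperty.prop_shift_iff, HomotopyCategory.shift_quotient_obj]
        exact bounded_quotient_obj E _ (a - n) (b - n) }

variable [HasBinaryBiproducts E]

variable {E} in
lemma isStrictlyLE_mappingCone {K L : CochainComplex E ℤ} (f : K ⟶ L)
    (n₁ n₂ n : ℤ) [K.IsStrictlyLE n₁] [L.IsStrictlyLE n₂] (hn₁ : n₁ ≤ n + 1) (hn₂ : n₂ ≤ n) :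
    (CochainComplex.mappingCone f).IsStrictlyLE n := by
  rw [CochainComplex.isStrictlyLE_iff]
  intro i hi
  simp only [CochainComplex.mappingCone.isZero_X_iff]
  exact ⟨K.isZero_of_isStrictlyLE n₁ _, L.isZero_of_isStrictlyLE n₂ _⟩

instance : (bounded E).IsTriangulatedClosed₃ where
  ext₃' T hT h₁ h₂ := by
    obtain ⟨a₁, b₁, _, _⟩ := h₁
    obtain ⟨a₂, b₂, _, _⟩ := h₂
    obtain ⟨f : T.obj₁.as ⟶ T.obj₂.as, hf⟩ := (HomotopyCategory.quotient _ _).map_surjective T.mor₁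
    have := CochainComplex.isStrictlyGE_mappingCone f a₁ a₂ (min (a₁ - 1) a₂)
    have := isStrictlyLE_mappingCone f b₁ b₂ (max b₁ b₂) (by grind) (by simp)
    refine ⟨_, bounded_quotient_obj E (CochainComplex.mappingCone f) (min (a₁ - 1) a₂)
      (max b₁ b₂), ⟨Triangle.π₃.mapIso (isoTriangleOfIso₁₂ T _ hT
        (HomotopyCategory.mappingCone_triangleh_distinguished f) (Iso.refl _) (Iso.refl _) ?_)⟩⟩
    exact (Category.comp_id _).trans (hf.symm.trans (Category.id_comp _).symm)

instance : (bounded E).IsTriangulated where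
  toIsTriangulatedClosed₂ := .of_isTriangulatedClosed₃

end Bounded

/-! ### Admissible sequences in a full subcategory of an abelian category -/

section Embedding

variable {E : Type u} [Category.{v} E] [Preadditive E]
  {C : Type u'} [Category.{v'} C] [Abelian C] (F : E ⥤ C) [F.Additive] [F.Full] [F.Faithful]

/-- A full embedding reflects kernels and cokernels. -/
lemma isAdmissible_of_shortExact (S : ShortComplex E) (hS : (S.map F).ShortExact) :
    IsAdmissible S :=
  ⟨⟨isLimitOfReflects F ((KernelFork.isLimitMapConeEquiv _ _).symm hS.fIsKernel)⟩,
    ⟨isColimitOfReflects F ((CokernelCofork.isColimitMapCoconeEquiv _ _).symm hS.gIsCokernel)⟩⟩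

variable {F} in
/-- If the essential image of `F` is closed under subobjects, then `F` preserves kernels, and each
morphism of `E` has an image, which `F` preserves; so cokernels of kernels are preserved too. -/
lemma shortExact_of_isAdmissible
    (hsub : ∀ ⦃X : E⦄ ⦃c : C⦄ (i : c ⟶ F.obj X) [Mono i], F.essImage c)
    (S : ShortComplex E) (hS : IsAdmissible S) : (S.map F).ShortExact := by
  obtain ⟨⟨hf⟩, ⟨hg⟩⟩ := hS
  obtain ⟨K, ⟨e⟩⟩ := hsub (kernel.ι (F.map S.g))
  let k : K ⟶ S.X₂ := F.preimage (e.hom ≫ kernel.ι _)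
  have hk : k ≫ S.g = 0 := F.map_injective (by simp [k])
  have hfk : F.map (hf.lift (KernelFork.ofι k hk)) ≫ F.map S.f = e.hom ≫ kernel.ι _ := by
    rw [← F.map_comp]
    refine (congrArg F.map (hf.fac (KernelFork.ofι k hk) .zero)).trans ?_
    simp [k]
  have hmono : Mono S.f := mono_of_isLimit_fork hf
  have hFf : Mono (F.map S.f) := by
    refine Preadditive.mono_of_cancel_zero _ fun {T} t ht => ?_
    obtain ⟨T', ⟨e'⟩⟩ := hsub (kernel.ι (F.map S.f))
    have h0 : F.preimage (e'.hom ≫ kernel.ι (F.map S.f)) ≫ S.f = 0 := F.map_injective (by simp)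
    have h1 : e'.hom ≫ kernel.ι (F.map S.f) = 0 := by
      rw [← F.map_preimage (e'.hom ≫ kernel.ι (F.map S.f)), zero_of_comp_mono _ h0, F.map_zero]
    rw [← kernel.lift_ι _ t ht, (cancel_epi e'.hom).1 (h1.trans comp_zero.symm), comp_zero]
  have hex : (S.map F).Exact := by
    rw [ShortComplex.exact_iff_epi_kernel_lift]
    have h0 : F.map S.f ≫ F.map S.g = 0 := (S.map F).zero
    have h1 : (e.inv ≫ F.map (hf.lift (KernelFork.ofι k hk))) ≫
        kernel.lift (F.map S.g) (F.map S.f) h0 = 𝟙 (kernel (F.map S.g)) := by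
      rw [← cancel_mono (kernel.ι _), Category.assoc, kernel.lift_ι]
      refine (Category.assoc _ _ _).trans ?_
      exact (congrArg (e.inv ≫ ·) hfk).trans
        ((e.inv_hom_id_assoc _).trans (Category.id_comp _).symm)
    exact (IsSplitEpi.mk' ⟨_, h1⟩).epi
  have hepi : Epi (F.map S.g) := by
    obtain ⟨I, ⟨e'⟩⟩ := hsub (image.ι (F.map S.g))
    let q : S.X₂ ⟶ I := F.preimage (factorThruImage (F.map S.g) ≫ e'.inv)
    let m : I ⟶ S.X₃ := F.preimage (e'.hom ≫ image.ι _)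
    have hqm : q ≫ m = S.g := F.map_injective (by simp [q, m])
    have hm : Mono (F.map m) := by
      simp only [m, F.map_preimage]
      infer_instance
    have hq : S.f ≫ q = 0 := F.map_injective ((cancel_mono (F.map m)).1 (by
      rw [← F.map_comp, Category.assoc, hqm, S.zero, F.map_zero, F.map_zero, zero_comp]))
    have hs : hg.desc (CokernelCofork.ofπ q hq) ≫ m = 𝟙 _ := by
      refine Cofork.IsColimit.hom_ext hg ?_
      have := hg.fac (CokernelCofork.ofπ q hq) .one
      dsimp at this ⊢
      rw [← Category.assoc, this, hqm, Category.comp_id]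
    have : IsSplitEpi (F.map m) :=
      ⟨⟨⟨F.map (hg.desc (CokernelCofork.ofπ q hq)),
        (F.map_comp _ _).symm.trans ((congrArg F.map hs).trans (F.map_id _))⟩⟩⟩
    rw [← hqm, F.map_comp]
    have : Epi (F.map q) := by
      simp only [q, F.map_preimage]
      infer_instance
    exact epi_comp _ _
  exact { exact := hex, mono_f := hFf, epi_g := hepi }

lemma toCycles_comp_eq_zero (L : CochainComplex C ℤ) (n : ℤ) :
    L.iCycles n ≫ L.toCycles n (n + 1) = 0 := by
  rw [← cancel_mono (L.iCycles (n + 1))]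
  simp

lemma shortExact_cycles (L : CochainComplex C ℤ) (h : ∀ n, L.ExactAt n) (n : ℤ) :
    (ShortComplex.mk _ _ (toCycles_comp_eq_zero L n)).ShortExact where
  exact := ShortComplex.exact_of_f_is_kernel _ (KernelFork.IsLimit.ofι' _ _
    fun k hk => ⟨L.liftCycles k (n + 1) (by simp) (by
      rw [← L.toCycles_i, reassoc_of% hk, zero_comp]), by simp⟩)
  mono_f := inferInstanceAs (Mono (L.iCycles n))
  epi_g := by
    refine Preadditive.epi_of_isZero_cokernel' _ (L.homologyIsCokernel n (n + 1) (by simp)) ?_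
    exact (h (n + 1)).isZero_homology

variable {F} in
/-- A complex in `E` is acyclic exactly if it is exact in `C`: the cycles of an exact complex are
subobjects of its terms, hence in `E`. -/
lemma strictlyAcyclic_iff
    (hsub : ∀ ⦃X : E⦄ ⦃c : C⦄ (i : c ⟶ F.obj X) [Mono i], F.essImage c)
    (K : CochainComplex E ℤ) :
    StrictlyAcyclic K ↔
      ∀ n, ((F.mapHomologicalComplex (ComplexShape.up ℤ)).obj K).ExactAt n := by
  constructor
  · rintro ⟨Z, i, p, hpi, hS⟩ n
    obtain ⟨n, rfl⟩ : ∃ m, n = m + 1 := ⟨n - 1, by simp⟩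
    have hs (m : ℤ) := shortExact_of_isAdmissible hsub _ (hS m).2
    have hi (m : ℤ) : Mono (F.map (i m)) := (hs m).mono_f
    have hp (m : ℤ) : Epi (F.map (p m)) := (hs m).epi_g
    rw [HomologicalComplex.exactAt_iff' _ n (n + 1) (n + 1 + 1) (by simp) (by simp)]
    have w : F.map (i (n + 1)) ≫ F.map (K.d (n + 1) (n + 1 + 1)) = 0 := by
      obtain ⟨w, -⟩ := hS (n + 1)
      rw [← F.map_comp, ← hpi, reassoc_of% w, zero_comp, F.map_zero]
    let S' := ShortComplex.mk _ _ w
    let φ : ((F.mapHomologicalComplex (ComplexShape.up ℤ)).obj K).sc' n (n + 1) (n + 1 + 1) ⟶ S' :=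
      { τ₁ := F.map (p n)
        τ₂ := 𝟙 _
        τ₃ := 𝟙 _
        comm₁₂ := by
          change F.map (p n) ≫ F.map (i (n + 1)) = F.map (K.d n (n + 1)) ≫ 𝟙 _
          rw [Category.comp_id, ← F.map_comp, hpi]
        comm₂₃ := (Category.id_comp _).trans (Category.comp_id _).symm }
    have : Epi φ.τ₁ := hp n
    have : IsIso φ.τ₂ := inferInstanceAs (IsIso (𝟙 _))
    have : Mono φ.τ₃ := inferInstanceAs (Mono (𝟙 _))
    rw [ShortComplex.exact_iff_of_epi_of_isIso_of_mono φ]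
    let ψ : (ShortComplex.mk _ _ (hS (n + 1)).1).map F ⟶ S' :=
      { τ₁ := 𝟙 _
        τ₂ := 𝟙 _
        τ₃ := F.map (i (n + 1 + 1))
        comm₁₂ := (Category.id_comp _).trans (Category.comp_id _).symm
        comm₂₃ := by
          change 𝟙 _ ≫ F.map (K.d (n + 1) (n + 1 + 1)) = F.map (p (n + 1)) ≫ F.map (i (n + 1 + 1))
          rw [Category.id_comp, ← F.map_comp, hpi] }
    have : Epi ψ.τ₁ := inferInstanceAs (Epi (𝟙 _))
    have : IsIso ψ.τ₂ := inferInstanceAs (IsIso (𝟙 _))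
    have : Mono ψ.τ₃ := hi _
    rw [← ShortComplex.exact_iff_of_epi_of_isIso_of_mono ψ]
    exact (hs (n + 1)).exact
  · intro h
    have hZ (n : ℤ) :
        F.essImage (((F.mapHomologicalComplex (ComplexShape.up ℤ)).obj K).cycles n) := by
      have : Mono (((F.mapHomologicalComplex (ComplexShape.up ℤ)).obj K).iCycles n) :=
        inferInstance
      exact @hsub (K.X n) _ (((F.mapHomologicalComplex (ComplexShape.up ℤ)).obj K).iCycles n) this
    let L := (F.mapHomologicalComplex (ComplexShape.up ℤ)).obj K
    let Z (n : ℤ) : E := (hZ n).witness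
    let e (n : ℤ) : F.obj (Z n) ≅ L.cycles n := (hZ n).getIso
    let i (n : ℤ) : Z n ⟶ K.X n := F.preimage ((e n).hom ≫ L.iCycles n)
    let p (n : ℤ) : K.X n ⟶ Z (n + 1) := F.preimage (L.toCycles n (n + 1) ≫ (e (n + 1)).inv)
    have hp (n : ℤ) : F.map (p n) = L.toCycles n (n + 1) ≫ (e (n + 1)).inv := F.map_preimage _
    have hi (n : ℤ) : F.map (i n) = (e n).hom ≫ L.iCycles n := F.map_preimage _
    have hS (n : ℤ) := shortExact_cycles L h n
    have hip (n : ℤ) : F.map (i n) ≫ F.map (p n) = 0 := by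
      rw [hi, hp]
      refine (Category.assoc _ _ _).trans ?_
      have h1 : L.iCycles n ≫ L.toCycles n (n + 1) ≫ (e (n + 1)).inv = 0 := by
        rw [reassoc_of% (toCycles_comp_eq_zero L n), zero_comp]
      exact (congrArg ((e n).hom ≫ ·) h1).trans comp_zero
    have w (n : ℤ) : i n ≫ p n = 0 := F.map_injective (by rw [F.map_comp, hip, F.map_zero])
    refine ⟨Z, i, p, fun n => F.map_injective ?_, fun n => ⟨w n, ?_⟩⟩
    · rw [F.map_comp, hi, hp]
      have h1 : (L.toCycles n (n + 1) ≫ (e (n + 1)).inv) ≫ (e (n + 1)).hom ≫ L.iCycles (n + 1) =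
        L.d n (n + 1) := by simp
      exact h1
    · have h1 : (e n).inv ≫ F.map (i n) = L.iCycles n := by
        rw [hi]
        exact (e n).inv_hom_id_assoc _
      exact isAdmissible_of_shortExact F _ (ShortComplex.shortExact_of_iso
        (ShortComplex.isoMk (e n).symm (Iso.refl _) (e (n + 1)).symm
          (h1.trans (Category.comp_id _).symm) ((Category.id_comp _).trans (hp n)) :
            ShortComplex.mk _ _ (toCycles_comp_eq_zero L n) ≅
              (ShortComplex.mk (i n) (p n) (w n)).map F) (hS n))

end Embedding

/-! ### Quasi-isomorphisms and cohomology of complexes in a full subcategory -/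

section Cohomology

variable {E : Type u} [Category.{v} E] [Preadditive E] [HasZeroObject E] [HasBinaryBiproducts E]
  {C : Type u'} [Category.{v'} C] [Abelian C] (F : E ⥤ C) [F.Additive] [F.Full] [F.Faithful]

/-- The full embedding of `K^b(E)` in the homotopy category `K(C)`. -/
abbrev toKC : Kb E ⥤ HomotopyCategory C (ComplexShape.up ℤ) :=
  (bounded E).ι ⋙ F.mapHomotopyCategory (ComplexShape.up ℤ)

/-- The `n`-th cohomology functor `K^b(E) ⥤ C`, computed in the ambient abelian category `C`. -/
abbrev cohomology (n : ℤ) : Kb E ⥤ C :=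
  toKC F ⋙ HomotopyCategory.homologyFunctor C (ComplexShape.up ℤ) n

variable {F} (hsub : ∀ ⦃X : E⦄ ⦃c : C⦄ (i : c ⟶ F.obj X) [Mono i], F.essImage c)
include hsub

lemma acyclic_eq : acyclic E =
    (HomotopyCategory.subcategoryAcyclic C).inverseImage
      (F.mapHomotopyCategory (ComplexShape.up ℤ)) := by
  ext K
  obtain ⟨K : CochainComplex _ _, rfl⟩ := K.quotient_obj_surjective
  exact (strictlyAcyclic_iff hsub K).trans
    (HomotopyCategory.quotient_obj_mem_subcategoryAcyclic_iff_exactAt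
      ((F.mapHomologicalComplex (ComplexShape.up ℤ)).obj K)).symm

lemma quasiIso_eq_trW : quasiIso E =
    ((HomotopyCategory.subcategoryAcyclic C).inverseImage (toKC F)).trW := by
  ext K L f
  rw [ObjectProperty.inverseImage_trW_iff]
  change (acyclic E).trW ((bounded E).ι.map f) ↔ _
  rw [acyclic_eq hsub, ObjectProperty.inverseImage_trW_iff]
  rfl

lemma quasiIso_iff {K L : Kb E} (f : K ⟶ L) :
    quasiIso E f ↔ ∀ n, IsIso ((cohomology F n).map f) := by
  rw [quasiIso_eq_trW hsub, ObjectProperty.inverseImage_trW_iff,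
    ← HomotopyCategory.quasiIso_eq_trW_subcategoryAcyclic, HomotopyCategory.mem_quasiIso_iff]
  rfl

lemma hasRightCalculusOfFractions_quasiIso : (quasiIso E).HasRightCalculusOfFractions := by
  rw [quasiIso_eq_trW hsub]
  infer_instance

lemma cohomology_inverts_quasiIso (n : ℤ) : (quasiIso E).IsInvertedBy (cohomology F n) :=
  fun _ _ f hf => (quasiIso_iff hsub f).1 hf n

/-- The functor `D^b(E) ⥤ C` given by the `n`-th cohomology. -/
def derivedCohomology (n : ℤ) : Db E ⥤ C :=
  Localization.lift (cohomology F n) (cohomology_inverts_quasiIso hsub n) (quasiIso E).Q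

/-- On complexes, `derivedCohomology` is the cohomology. -/
def derivedCohomologyIso (n : ℤ) :
    (quasiIso E).Q ⋙ derivedCohomology hsub n ≅ cohomology F n :=
  Localization.fac _ _ _

end Cohomology

/-! ### Truncations of complexes in a full subcategory -/

section Truncation

variable {E : Type u} [Category.{v} E] [Preadditive E]
  {C : Type u'} [Category.{v'} C] [Abelian C] (F : E ⥤ C) [F.Additive] [F.Full] [F.Faithful]

/-- A complex in `C` with terms in the essential image of `F` comes from a complex in `E`. -/
lemma exists_complex_iso (M : CochainComplex C ℤ) (hM : ∀ n, F.essImage (M.X n)) :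
    ∃ L : CochainComplex E ℤ,
      Nonempty ((F.mapHomologicalComplex (ComplexShape.up ℤ)).obj L ≅ M) := by
  let X (n : ℤ) : E := (hM n).witness
  let e (n : ℤ) : F.obj (X n) ≅ M.X n := (hM n).getIso
  let d (m n : ℤ) : X m ⟶ X n := F.preimage ((e m).hom ≫ M.d m n ≫ (e n).inv)
  have hd (m n : ℤ) : F.map (d m n) = (e m).hom ≫ M.d m n ≫ (e n).inv := F.map_preimage _
  let L : CochainComplex E ℤ :=
    { X := X
      d := d
      shape m n h := F.map_injective (by rw [hd, M.shape m n h]; simp)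
      d_comp_d' l m n _ _ := F.map_injective (by simp [hd]) }
  refine ⟨L, ⟨HomologicalComplex.Hom.isoOfComponents e fun m n _ => ?_⟩⟩
  have : (e m).hom ≫ M.d m n = F.map (d m n) ≫ (e n).hom := by simp [hd]
  exact this

variable [HasZeroObject E]

/-- A bounded complex, as an object of `K^b(E)`. -/
def ofComplex (K : CochainComplex E ℤ) (a b : ℤ) (ha : K.IsStrictlyGE a) (hb : K.IsStrictlyLE b) :
    Kb E :=
  ⟨(HomotopyCategory.quotient _ _).obj K, ⟨a, b, ha, hb⟩⟩

lemma exists_eq_ofComplex (K : Kb E) : ∃ (L : CochainComplex E ℤ) (a b : ℤ)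
    (ha : L.IsStrictlyGE a) (hb : L.IsStrictlyLE b), K = ofComplex L a b ha hb := by
  obtain ⟨⟨K⟩, a, b, ha, hb⟩ := K
  exact ⟨K, a, b, ha, hb, rfl⟩

section

variable {K L : CochainComplex E ℤ} {a b a' b' : ℤ} (ha : K.IsStrictlyGE a) (hb : K.IsStrictlyLE b)
  (ha' : L.IsStrictlyGE a') (hb' : L.IsStrictlyLE b')

/-- The morphism of `K^b(E)` given by a morphism of complexes. -/
def ofHom (φ : K ⟶ L) : ofComplex K a b ha hb ⟶ ofComplex L a' b' ha' hb' :=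
  ObjectProperty.homMk ((HomotopyCategory.quotient _ _).map φ)

lemma exists_eq_ofHom (f : ofComplex K a b ha hb ⟶ ofComplex L a' b' ha' hb') :
    ∃ φ : K ⟶ L, f = ofHom ha hb ha' hb' φ := by
  obtain ⟨φ, hφ⟩ := (HomotopyCategory.quotient _ _).map_surjective f.hom
  exact ⟨φ, ObjectProperty.hom_ext _ hφ.symm⟩

variable [HasBinaryBiproducts E]

/-- The cohomology of a complex in `E` is its homology in `C`. -/
def cohomologyIso (n : ℤ) : (cohomology F n).obj (ofComplex K a b ha hb) ≅
    ((F.mapHomologicalComplex (ComplexShape.up ℤ)).obj K).homology n :=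
  (HomotopyCategory.homologyFunctorFactors C (ComplexShape.up ℤ) n).app
    ((F.mapHomologicalComplex (ComplexShape.up ℤ)).obj K)

lemma cohomology_map_ofHom (n : ℤ) (φ : K ⟶ L) :
    (cohomology F n).map (ofHom ha hb ha' hb' φ) ≫ (cohomologyIso F ha' hb' n).hom =
      (cohomologyIso F ha hb n).hom ≫
        HomologicalComplex.homologyMap ((F.mapHomologicalComplex (ComplexShape.up ℤ)).map φ) n :=
  (HomotopyCategory.homologyFunctorFactors C (ComplexShape.up ℤ) n).hom.naturality
    ((F.mapHomologicalComplex (ComplexShape.up ℤ)).map φ)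

lemma isIso_cohomology_map_ofHom_iff (n : ℤ) (φ : K ⟶ L) :
    IsIso ((cohomology F n).map (ofHom ha hb ha' hb' φ)) ↔
      IsIso (HomologicalComplex.homologyMap
        ((F.mapHomologicalComplex (ComplexShape.up ℤ)).map φ) n) := by
  have h := cohomology_map_ofHom F ha hb ha' hb' n φ
  rw [← isIso_comp_right_iff _ (cohomologyIso F ha' hb' n).hom, h, isIso_comp_left_iff]

lemma isZero_cohomology (n : ℤ) (h : b < n) :
    IsZero ((cohomology F n).obj (ofComplex K a b ha hb)) := by
  refine IsZero.of_iso ?_ (cohomologyIso F ha hb n)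
  have := (CochainComplex.isStrictlyLE_mapHomologicalComplex_obj_iff K F b).2 hb
  exact CochainComplex.isZero_of_isLE _ b n h

end

variable [HasBinaryBiproducts E]
variable {F} (hsub : ∀ ⦃X : E⦄ ⦃c : C⦄ (i : c ⟶ F.obj X) [Mono i], F.essImage c)
include hsub

/-- Canonical truncations exist in `K^b(E)`, since cycles are subobjects. -/
lemma exists_truncLE (K : Kb E) (n : ℤ) :
    ∃ (L : CochainComplex E ℤ) (a : ℤ) (ha : L.IsStrictlyGE a) (hn : L.IsStrictlyLE n)
      (s : ofComplex L a n ha hn ⟶ K), ∀ i ≤ n, IsIso ((cohomology F i).map s) := by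
  obtain ⟨K, a, b, ha, hb, rfl⟩ := exists_eq_ofComplex K
  obtain ⟨M, ⟨e⟩⟩ : ∃ M : CochainComplex C ℤ,
      Nonempty (M ≅ (F.mapHomologicalComplex (ComplexShape.up ℤ)).obj K) :=
    ⟨_, ⟨Iso.refl _⟩⟩
  have hM (i : ℤ) : F.essImage (M.X i) :=
    ⟨K.X i, ⟨((HomologicalComplex.eval _ _ i).mapIso e).symm⟩⟩
  have hT (i : ℤ) : F.essImage ((M.truncLE n).X i) := by
    obtain ⟨X, ⟨e'⟩⟩ := hM i
    have : Mono ((M.ιTruncLE n).f i) :=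
      inferInstanceAs (Mono ((HomologicalComplex.ιTruncLE M _).f i))
    exact hsub (X := X) ((M.ιTruncLE n).f i ≫ e'.inv)
  obtain ⟨L, ⟨e'⟩⟩ := exists_complex_iso F _ hT
  have ha' := (CochainComplex.isStrictlyGE_mapHomologicalComplex_obj_iff K F a).2 ha
  have : M.IsStrictlyGE a := CochainComplex.isStrictlyGE_of_iso e.symm a
  have : (M.truncLE n).IsStrictlyGE a := inferInstance
  have hLa : L.IsStrictlyGE a :=
    (CochainComplex.isStrictlyGE_mapHomologicalComplex_obj_iff L F a).1
      (CochainComplex.isStrictlyGE_of_iso e'.symm a)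
  have hLn : L.IsStrictlyLE n :=
    (CochainComplex.isStrictlyLE_mapHomologicalComplex_obj_iff L F n).1
      (CochainComplex.isStrictlyLE_of_iso e'.symm n)
  let φ : L ⟶ K := (F.mapHomologicalComplex (ComplexShape.up ℤ)).preimage
    (e'.hom ≫ M.ιTruncLE n ≫ e.hom)
  refine ⟨L, a, hLa, hLn, ofHom _ _ _ _ φ, fun i hi => ?_⟩
  rw [isIso_cohomology_map_ofHom_iff]
  have := M.quasiIsoAt_ιTruncLE n i hi
  simp only [φ, Functor.map_preimage]
  have : QuasiIsoAt (e'.hom ≫ M.ιTruncLE n ≫ e.hom) i := inferInstance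
  rwa [quasiIsoAt_iff_isIso_homologyMap] at this

/-- A complex in nonpositive degrees whose cohomology vanishes in negative degrees is
quasi-isomorphic to a complex with two terms and monomorphic differential, since the image of
the differential is a subobject. -/
lemma exists_truncGE (K : CochainComplex E ℤ) (a : ℤ) (ha : K.IsStrictlyGE a)
    (hb : K.IsStrictlyLE 0)
    (hK : ∀ n < 0, IsZero ((cohomology F n).obj (ofComplex K a 0 ha hb))) :
    ∃ (L : CochainComplex E ℤ) (ha' : L.IsStrictlyGE (-1)) (hb' : L.IsStrictlyLE 0)
      (s : ofComplex K a 0 ha hb ⟶ ofComplex L (-1) 0 ha' hb'),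
        quasiIso E s ∧ Mono (F.map (L.d (-1) 0)) := by
  obtain ⟨M, ⟨e⟩⟩ : ∃ M : CochainComplex C ℤ,
      Nonempty (M ≅ (F.mapHomologicalComplex (ComplexShape.up ℤ)).obj K) :=
    ⟨_, ⟨Iso.refl _⟩⟩
  have hM (i : ℤ) : F.essImage (M.X i) :=
    ⟨K.X i, ⟨((HomologicalComplex.eval _ _ i).mapIso e).symm⟩⟩
  have hz (n : ℤ) (hn : n < 0) : M.ExactAt n := by
    rw [HomologicalComplex.exactAt_iff_isZero_homology]
    exact (hK n hn).of_iso
      (HomologicalComplex.homologyMapIso e n ≪≫ (cohomologyIso F ha hb n).symm)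
  have h0 := (CochainComplex.isStrictlyLE_mapHomologicalComplex_obj_iff K F 0).2 hb
  have : M.IsStrictlyLE 0 := CochainComplex.isStrictlyLE_of_iso e.symm 0
  have hmono : Mono (M.fromOpcycles (-1) 0) := by
    refine Preadditive.mono_of_isZero_kernel' _ (M.homologyIsKernel (-1) 0 (by simp)) ?_
    exact (hz (-1) (by simp)).isZero_homology
  have hGE : (M.truncGE (-1)).IsStrictlyGE (-1) := inferInstance
  have hLE : (M.truncGE (-1)).IsStrictlyLE 0 := inferInstance
  have hT (i : ℤ) : F.essImage ((M.truncGE (-1)).X i) := by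
    obtain hi | rfl | hi := lt_trichotomy i (-1)
    · exact ⟨0, ⟨(F.map_isZero (isZero_zero _)).iso
        (CochainComplex.isZero_of_isStrictlyGE _ (-1) i)⟩⟩
    · obtain ⟨X, ⟨e'⟩⟩ := hM 0
      exact hsub (X := X) ((M.truncGEXIsoOpcycles (-1)).hom ≫ M.fromOpcycles (-1) 0 ≫ e'.inv)
    · exact F.essImage.prop_of_iso (M.truncGEXIso (-1) i hi).symm (hM i)
  obtain ⟨L, ⟨e'⟩⟩ := exists_complex_iso F _ hT
  have ha' : L.IsStrictlyGE (-1) :=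
    (CochainComplex.isStrictlyGE_mapHomologicalComplex_obj_iff L F (-1)).1
      (CochainComplex.isStrictlyGE_of_iso e'.symm (-1))
  have hb' : L.IsStrictlyLE 0 :=
    (CochainComplex.isStrictlyLE_mapHomologicalComplex_obj_iff L F 0).1
      (CochainComplex.isStrictlyLE_of_iso e'.symm 0)
  let φ : K ⟶ L := (F.mapHomologicalComplex (ComplexShape.up ℤ)).preimage
    (e.inv ≫ M.πTruncGE (-1) ≫ e'.inv)
  have : M.IsGE (-1) := by
    rw [CochainComplex.isGE_iff]
    exact fun i hi => hz i (by lia)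
  refine ⟨L, ha', hb', ofHom _ _ _ _ φ, ?_, ?_⟩
  · rw [quasiIso_iff hsub]
    intro n
    rw [isIso_cohomology_map_ofHom_iff]
    simp only [φ, Functor.map_preimage]
    have : QuasiIsoAt (e.inv ≫ M.πTruncGE (-1) ≫ e'.inv) n := inferInstance
    rwa [quasiIsoAt_iff_isIso_homologyMap] at this
  · have hex : (M.truncGE (-1)).ExactAt (-1) := by
      have : QuasiIso (M.πTruncGE (-1)) := inferInstance
      exact (quasiIsoAt_iff_exactAt (M.πTruncGE (-1)) (-1) (hz _ (by simp))).1 inferInstance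
    have h1 : Mono ((M.truncGE (-1)).d (-1) 0) := by
      rw [HomologicalComplex.exactAt_iff' _ (-2) (-1) 0 (by simp) (by simp)] at hex
      exact hex.mono_g (((M.truncGE (-1)).isZero_of_isStrictlyGE (-1) (-2)).eq_of_src
        ((M.truncGE (-1)).d (-2) (-1)) 0)
    have h2 := e'.hom.comm (-1) 0
    have h3 : Mono (e'.hom.f (-1) ≫ (M.truncGE (-1)).d (-1) 0) := mono_comp _ _
    rw [h2] at h3
    exact @mono_of_mono _ _ _ _ _ (F.map (L.d (-1) 0)) (e'.hom.f 0) h3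

end Truncation

/-! ### Two-term complexes with monomorphic differential -/

section Homotopy

variable {C : Type u'} [Category.{v'} C] [Abelian C]

/-- A morphism from a complex in nonpositive degrees to a two-term complex with monomorphic
differential is null-homotopic as soon as it vanishes on `H⁰`: its component in degree `0` lifts to
the image of the differential. -/
lemma exists_homotopy_zero {M N : CochainComplex C ℤ} (φ : M ⟶ N) [M.IsStrictlyLE 0]
    [N.IsStrictlyGE (-1)] [Mono (N.d (-1) 0)]
    (h0 : HomologicalComplex.homologyMap φ 0 = 0) : Nonempty (Homotopy φ 0) := by
  have h1 : φ.f 0 ≫ N.pOpcycles 0 = 0 := by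
    have hM : M.d 0 1 = 0 := (M.isZero_of_isStrictlyLE 0 1).eq_of_tgt _ _
    have h2 : M.liftCycles (𝟙 (M.X 0)) 1 (by simp) (by simp [hM]) ≫ M.iCycles 0 = 𝟙 _ := by simp
    rw [← Category.id_comp (φ.f 0), ← h2, Category.assoc, Category.assoc,
      ← HomologicalComplex.cyclesMap_i_assoc, ← HomologicalComplex.homology_π_ι,
      ← HomologicalComplex.homologyπ_naturality_assoc, h0]
    simp
  have hex : (ShortComplex.mk (N.d (-1) 0) (N.pOpcycles 0) (by simp)).Exact :=
    ShortComplex.exact_of_g_is_cokernel _ (N.opcyclesIsCokernel (-1) 0 (by simp))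
  have : Mono (ShortComplex.mk (N.d (-1) 0) (N.pOpcycles 0) (by simp)).f :=
    inferInstanceAs (Mono (N.d (-1) 0))
  let h : M.X 0 ⟶ N.X (-1) := hex.lift (φ.f 0) h1
  have hh : h ≫ N.d (-1) 0 = φ.f 0 := hex.lift_f _ _
  let H (i j : ℤ) (_ : (ComplexShape.up ℤ).Rel j i) : M.X i ⟶ N.X j :=
    if hij : i = 0 ∧ j = -1 then
      eqToHom (by rw [hij.1]) ≫ h ≫ eqToHom (by rw [hij.2])
    else 0
  have hH : φ = Homotopy.nullHomotopicMap' H := by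
    ext i
    obtain hi | rfl | rfl | hi : i < -1 ∨ i = -1 ∨ i = 0 ∨ 0 < i := by lia
    · exact (N.isZero_of_isStrictlyGE (-1) i).eq_of_tgt _ _
    · rw [← cancel_mono (N.d (-1) 0), Homotopy.nullHomotopicMap'_f (k₂ := -2) (k₁ := -1) (k₀ := 0)
        (by simp) (by simp)]
      have e1 : H 0 (-1) (by simp) = h := by simp [H]
      have e2 : H (-1) (-2) (by simp) = 0 := by simp [H]
      rw [e1, e2, zero_comp, add_zero, Category.assoc, hh, φ.comm]
    · rw [Homotopy.nullHomotopicMap'_f (k₂ := -1) (k₁ := 0) (k₀ := 1) (by simp) (by simp)]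
      have e1 : H 0 (-1) (by simp) = h := by simp [H]
      have e2 : H 1 0 (by simp) = 0 := by simp [H]
      rw [e1, e2, comp_zero, zero_add, hh]
    · exact (M.isZero_of_isStrictlyLE 0 i).eq_of_src _ _
  rw [hH]
  exact ⟨Homotopy.nullHomotopy' H⟩

end Homotopy

section ToHomology

variable {C : Type u'} [Category.{v'} C] [Abelian C] (M N : CochainComplex C ℤ)
  [M.IsStrictlyLE 0] [N.IsStrictlyLE 0]

/-- The quotient morphism `M⁰ ⟶ H⁰(M)`, for a complex `M` in nonpositive degrees. -/
def toHomology : M.X 0 ⟶ M.homology 0 :=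
  M.liftCycles (𝟙 (M.X 0)) 1 (by simp) ((M.isZero_of_isStrictlyLE 0 1).eq_of_tgt _ _) ≫
    M.homologyπ 0

lemma iCycles_toHomology : M.iCycles 0 ≫ toHomology M = M.homologyπ 0 := by
  rw [toHomology, ← Category.assoc]
  convert Category.id_comp _
  rw [← cancel_mono (M.iCycles 0)]
  simp

instance : Epi (toHomology M) := epi_of_epi_fac (iCycles_toHomology M)

lemma d_toHomology : M.d (-1) 0 ≫ toHomology M = 0 := by
  rw [← M.toCycles_i, Category.assoc, iCycles_toHomology, M.toCycles_comp_homologyπ]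

lemma exists_toHomology_comp {T : C} (k : M.X 0 ⟶ T) (hk : M.d (-1) 0 ≫ k = 0) :
    ∃ l, toHomology M ≫ l = k := by
  have h1 : M.toCycles (-1) 0 ≫ M.iCycles 0 ≫ k = 0 := by rw [M.toCycles_i_assoc, hk]
  have h2 := (M.homologyIsCokernel (-1) 0 (by simp)).fac
    (CokernelCofork.ofπ (M.iCycles 0 ≫ k) h1) .one
  refine ⟨(M.homologyIsCokernel (-1) 0 (by simp)).desc
    (CokernelCofork.ofπ (M.iCycles 0 ≫ k) h1), ?_⟩
  rw [toHomology, Category.assoc]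
  refine (congrArg (_ ≫ ·) h2).trans ?_
  simp

variable {M N}

lemma toHomology_naturality (φ : M ⟶ N) :
    toHomology M ≫ HomologicalComplex.homologyMap φ 0 = φ.f 0 ≫ toHomology N := by
  rw [toHomology, toHomology, Category.assoc, HomologicalComplex.homologyπ_naturality,
    ← Category.assoc, ← Category.assoc]
  congr 1
  rw [← cancel_mono (HomologicalComplex.iCycles _ 0)]
  simp

end ToHomology

section TwoTerm

variable {E : Type u} [Category.{v} E] [Preadditive E] [HasZeroObject E] [HasBinaryBiproducts E]
  {C : Type u'} [Category.{v'} C] [Abelian C] (F : E ⥤ C) [F.Additive] [F.Full] [F.Faithful]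

section

variable {K L : CochainComplex E ℤ} {a b : ℤ} (ha : K.IsStrictlyGE a) (hb : K.IsStrictlyLE 0)
  (ha' : L.IsStrictlyGE b) (hb' : L.IsStrictlyLE 0)

lemma isStrictlyLE_map (hb : K.IsStrictlyLE 0) : CochainComplex.IsStrictlyLE
    ((F.mapHomologicalComplex (ComplexShape.up ℤ)).obj K) 0 :=
  (CochainComplex.isStrictlyLE_mapHomologicalComplex_obj_iff K F 0).2 hb

/-- The quotient morphism `K⁰ ⟶ H⁰(K)`, for a complex `K` in nonpositive degrees. -/
def toCohomology : F.obj (K.X 0) ⟶ (cohomology F 0).obj (ofComplex K a 0 ha hb) :=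
  have := isStrictlyLE_map F hb
  toHomology ((F.mapHomologicalComplex (ComplexShape.up ℤ)).obj K) ≫ (cohomologyIso F ha hb 0).inv

lemma d_toCohomology : F.map (K.d (-1) 0) ≫ toCohomology F ha hb = 0 := by
  have := isStrictlyLE_map F hb
  refine (Category.assoc _ _ _).symm.trans ?_
  exact (congrArg (· ≫ (cohomologyIso F ha hb 0).inv) (d_toHomology
    ((F.mapHomologicalComplex (ComplexShape.up ℤ)).obj K))).trans zero_comp

instance : Epi (toCohomology F ha hb) := by
  have := isStrictlyLE_map F hb
  exact epi_comp (toHomology ((F.mapHomologicalComplex (ComplexShape.up ℤ)).obj K)) _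

lemma exists_toCohomology_comp {T : C} (k : F.obj (K.X 0) ⟶ T) (hk : F.map (K.d (-1) 0) ≫ k = 0) :
    ∃ l, toCohomology F ha hb ≫ l = k := by
  have := isStrictlyLE_map F hb
  obtain ⟨l, hl⟩ := exists_toHomology_comp
    ((F.mapHomologicalComplex (ComplexShape.up ℤ)).obj K) k hk
  refine ⟨(cohomologyIso F ha hb 0).hom ≫ l, Eq.trans ?_ hl⟩
  refine (Category.assoc _ _ _).trans (congrArg (_ ≫ ·) ?_)
  exact Iso.inv_hom_id_assoc _ _

lemma toCohomology_naturality (φ : K ⟶ L) :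
    toCohomology F ha hb ≫ (cohomology F 0).map (ofHom ha hb ha' hb' φ) =
      F.map (φ.f 0) ≫ toCohomology F ha' hb' := by
  have := isStrictlyLE_map F hb
  have := isStrictlyLE_map F hb'
  have h := toHomology_naturality ((F.mapHomologicalComplex (ComplexShape.up ℤ)).map φ)
  have h' : (cohomologyIso F ha hb 0).inv ≫ (cohomology F 0).map (ofHom ha hb ha' hb' φ) =
      HomologicalComplex.homologyMap ((F.mapHomologicalComplex (ComplexShape.up ℤ)).map φ) 0 ≫
        (cohomologyIso F ha' hb' 0).inv := by
    rw [Iso.inv_comp_eq, ← Category.assoc, Iso.eq_comp_inv, cohomology_map_ofHom]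
  refine (Category.assoc _ _ _).trans ((congrArg (_ ≫ ·) h').trans ?_)
  refine (Category.assoc _ _ _).symm.trans ((congrArg (· ≫ _) h).trans ?_)
  exact Category.assoc _ _ _

lemma exists_cohomology_iso {c : C} (q : F.obj (K.X 0) ⟶ c) [Epi q]
    (w : F.map (K.d (-1) 0) ≫ q = 0)
    (hq : ∀ {T : C} (t : T ⟶ F.obj (K.X 0)), t ≫ q = 0 → ∃ t', t' ≫ F.map (K.d (-1) 0) = t) :
    ∃ e : (cohomology F 0).obj (ofComplex K a 0 ha hb) ≅ c, toCohomology F ha hb ≫ e.hom = q := by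
  obtain ⟨f, hf⟩ := exists_toCohomology_comp F ha hb q w
  obtain ⟨t, ht⟩ := hq (kernel.ι q) (kernel.condition q)
  have h : kernel.ι q ≫ toCohomology F ha hb = 0 := by
    rw [← ht, Category.assoc, d_toCohomology, comp_zero]
  let g := Abelian.epiDesc q (toCohomology F ha hb) h
  have hg : q ≫ g = toCohomology F ha hb := Abelian.comp_epiDesc _ _ _
  exact ⟨⟨f, g, by rw [← cancel_epi (toCohomology F ha hb), reassoc_of% hf, hg, Category.comp_id],
    by rw [← cancel_epi q, reassoc_of% hg, hf, Category.comp_id]⟩, hf⟩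

/-- Cohomology of a two-term complex with monomorphic differential vanishes outside degree `0`. -/
lemma isZero_cohomology_of_mono (hL : L.IsStrictlyGE (-1)) [Mono (F.map (L.d (-1) 0))] (n : ℤ)
    (hn : n ≠ 0) : IsZero ((cohomology F n).obj (ofComplex L (-1) 0 hL hb')) := by
  refine IsZero.of_iso ?_ (cohomologyIso F hL hb' n)
  rw [← HomologicalComplex.exactAt_iff_isZero_homology]
  have h1 := (CochainComplex.isStrictlyLE_mapHomologicalComplex_obj_iff L F 0).2 hb'
  have h2 := (CochainComplex.isStrictlyGE_mapHomologicalComplex_obj_iff L F (-1)).2 hL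
  obtain h | rfl | h : n < -1 ∨ n = -1 ∨ 0 < n := by lia
  · exact CochainComplex.exactAt_of_isGE _ (-1) n
  · rw [HomologicalComplex.exactAt_iff' _ (-2) (-1) 0 (by simp) (by simp)]
    have : Mono (HomologicalComplex.sc' ((F.mapHomologicalComplex (ComplexShape.up ℤ)).obj L)
      (-2) (-1) 0).g := inferInstanceAs (Mono (F.map (L.d (-1) 0)))
    exact (ShortComplex.exact_iff_mono _ ((CochainComplex.isZero_of_isStrictlyGE
      ((F.mapHomologicalComplex (ComplexShape.up ℤ)).obj L) (-1) (-2)).eq_of_src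
        (HomologicalComplex.d _ (-2) (-1)) 0)).2 this
  · exact CochainComplex.exactAt_of_isLE _ 0 n

end

/-- The complex with terms `X` in degree `-1` and `Y` in degree `0`. -/
abbrev twoTerm {X Y : E} (d : X ⟶ Y) : CochainComplex E ℤ :=
  HomologicalComplex.double d (c := ComplexShape.up ℤ) (i₀ := -1) (i₁ := 0) (by simp)

instance {X Y : E} (d : X ⟶ Y) : (twoTerm d).IsStrictlyGE (-1) := by
  rw [CochainComplex.isStrictlyGE_iff]
  exact fun i hi => HomologicalComplex.isZero_double_X _ _ _ (by lia) (by lia)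

instance {X Y : E} (d : X ⟶ Y) : (twoTerm d).IsStrictlyLE 0 := by
  rw [CochainComplex.isStrictlyLE_iff]
  exact fun i hi => HomologicalComplex.isZero_double_X _ _ _ (by lia) (by lia)

/-- The term in degree `0` of a two-term complex. -/
def twoTermIso {X Y : E} (d : X ⟶ Y) : (twoTerm d).X 0 ≅ Y :=
  HomologicalComplex.doubleXIso₁ _ _ (by simp)

lemma twoTerm_d {X Y : E} (d : X ⟶ Y) : ∃ e : (twoTerm d).X (-1) ≅ X,
    (twoTerm d).d (-1) 0 = e.hom ≫ d ≫ (twoTermIso d).inv :=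
  ⟨_, HomologicalComplex.double_d _ _ _⟩

variable {F} in
lemma exists_hom_twoTerm {X Y : E} (d : X ⟶ Y) {L : CochainComplex E ℤ} {b : ℤ}
    (ha : L.IsStrictlyGE b) (hb : L.IsStrictlyLE 0) [Mono (F.map (L.d (-1) 0))] (g : Y ⟶ L.X 0)
    (w : F.map d ≫ F.map g ≫ toCohomology F ha hb = 0) :
    ∃ φ : twoTerm d ⟶ L, φ.f 0 = (twoTermIso d).hom ≫ g := by
  have hex : (ShortComplex.mk _ _ (d_toCohomology F ha hb)).Exact :=
    ShortComplex.exact_of_g_is_cokernel _ (CokernelCofork.IsColimit.ofπ' _ _ fun k hk =>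
      ⟨(exists_toCohomology_comp F ha hb k hk).choose,
        (exists_toCohomology_comp F ha hb k hk).choose_spec⟩)
  have : Mono (ShortComplex.mk _ _ (d_toCohomology F ha hb)).f := ‹_›
  let l := hex.lift (F.map d ≫ F.map g) (by simpa using w)
  have hl : l ≫ F.map (L.d (-1) 0) = F.map d ≫ F.map g := hex.lift_f _ _
  refine ⟨HomologicalComplex.mkHomFromDouble _ (by simp) (F.preimage l) g
    (F.map_injective (by simpa using hl)) fun k hk => ?_,
      HomologicalComplex.mkHomFromDouble_f₁ _ _ _ _ _ _⟩
  obtain rfl : 0 + 1 = k := hk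
  exact (L.isZero_of_isStrictlyLE 0 _).eq_of_tgt _ _

variable {F} (hsub : ∀ ⦃X : E⦄ ⦃c : C⦄ (i : c ⟶ F.obj X) [Mono i], F.essImage c)
include hsub

/-- A quotient of an object of `E` is the cohomology of a two-term complex. -/
lemma exists_twoTerm {Y : E} {c : C} (q : F.obj Y ⟶ c) [Epi q] :
    ∃ (X : E) (d : X ⟶ Y) (_ : Mono (F.map ((twoTerm d).d (-1) 0))) (_ : F.map d ≫ q = 0)
      (e : (cohomology F 0).obj (ofComplex (twoTerm d) (-1) 0 inferInstance inferInstance) ≅ c),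
      toCohomology F (K := twoTerm d) (a := -1) inferInstance inferInstance ≫ e.hom =
        F.map (twoTermIso d).hom ≫ q := by
  obtain ⟨X, ⟨e⟩⟩ := hsub (kernel.ι q)
  let d : X ⟶ Y := F.preimage (e.hom ≫ kernel.ι q)
  have hd : F.map d = e.hom ≫ kernel.ι q := F.map_preimage _
  have hdq : F.map d ≫ q = 0 := by simp [hd]
  have hm : Mono (F.map d) := hd ▸ inferInstance
  obtain ⟨e', he'⟩ := twoTerm_d d
  have h1 : F.map ((twoTerm d).d (-1) 0) = F.map e'.hom ≫ F.map d ≫ F.map (twoTermIso d).inv := by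
    rw [he']
    simp
  have h2 : F.map (twoTermIso d).inv ≫ F.map (twoTermIso d).hom = 𝟙 _ := by
    rw [← F.map_comp, Iso.inv_hom_id, F.map_id]
  refine ⟨X, d, ?_, hdq, ?_⟩
  · rw [h1]
    infer_instance
  · refine exists_cohomology_iso F (K := twoTerm d) _ _ (F.map (twoTermIso d).hom ≫ q) ?_ ?_
    · rw [h1, Category.assoc, Category.assoc, reassoc_of% h2, hdq, comp_zero]
    · intro T t ht
      refine ⟨kernel.lift q (t ≫ F.map (twoTermIso d).hom) (by simpa using ht) ≫ e.inv ≫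
        F.map e'.inv, ?_⟩
      have h3 : F.map e'.inv ≫ F.map e'.hom = 𝟙 _ := by
        rw [← F.map_comp, Iso.inv_hom_id, F.map_id]
      have h4 : F.map (twoTermIso d).hom ≫ F.map (twoTermIso d).inv = 𝟙 _ := by
        rw [← F.map_comp, Iso.hom_inv_id, F.map_id]
      rw [h1, hd]
      simp only [Category.assoc]
      rw [reassoc_of% h3, Iso.inv_hom_id_assoc, kernel.lift_ι_assoc, Category.assoc, h4,
        Category.comp_id]

end TwoTerm

/-! ### The heart of the bounded derived category -/

section Heart

variable {E : Type u} [Category.{v} E] [Preadditive E] [HasZeroObject E] [HasBinaryBiproducts E]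
  {C : Type u'} [Category.{v'} C] [Abelian C] {F : E ⥤ C} [F.Additive] [F.Full] [F.Faithful]

lemma connective_ofComplex (K : CochainComplex E ℤ) (a b : ℤ) (ha : K.IsStrictlyGE a)
    (hb : K.IsStrictlyLE b) : connective E b ((quasiIso E).Q.obj (ofComplex K a b ha hb)) :=
  ⟨_, hb, ⟨Iso.refl _⟩⟩

variable (hsub : ∀ ⦃X : E⦄ ⦃c : C⦄ (i : c ⟶ F.obj X) [Mono i], F.essImage c)

/-- Morphisms from a complex in nonpositive degrees to a two-term complex with monomorphic
differential are determined by their effect on `H⁰`. -/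
lemma eq_of_cohomology_map_eq {K L : CochainComplex E ℤ} {a : ℤ} (ha : K.IsStrictlyGE a)
    (hb : K.IsStrictlyLE 0) (ha' : L.IsStrictlyGE (-1)) (hb' : L.IsStrictlyLE 0)
    [hd : Mono (F.map (L.d (-1) 0))]
    (f g : ofComplex K a 0 ha hb ⟶ ofComplex L (-1) 0 ha' hb')
    (hfg : (cohomology F 0).map f = (cohomology F 0).map g) : f = g := by
  obtain ⟨φ, rfl⟩ := exists_eq_ofHom _ _ _ _ f
  obtain ⟨ψ, rfl⟩ := exists_eq_ofHom _ _ _ _ g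
  have h1 := isStrictlyLE_map F hb
  have h2 := (CochainComplex.isStrictlyGE_mapHomologicalComplex_obj_iff L F (-1)).2 ha'
  have h3 : Mono (((F.mapHomologicalComplex (ComplexShape.up ℤ)).obj L).d (-1) 0) := hd
  have h4 := cohomology_map_ofHom F ha hb ha' hb' 0 φ
  rw [hfg, cohomology_map_ofHom, cancel_epi] at h4
  obtain ⟨h⟩ := exists_homotopy_zero ((F.mapHomologicalComplex (ComplexShape.up ℤ)).map φ -
    (F.mapHomologicalComplex (ComplexShape.up ℤ)).map ψ)
      (by rw [HomologicalComplex.homologyMap_sub, h4, sub_self])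
  refine ObjectProperty.hom_ext _ ((F.mapHomotopyCategory (ComplexShape.up ℤ)).map_injective ?_)
  exact HomotopyCategory.eq_of_homotopy _ _ (Homotopy.equivSubZero.symm h)

include hsub

/-- Two parallel morphisms of `D^b(E)` out of a complex in degrees `≤ n` are represented by roofs
with common vertex, which is in degrees `≤ n`. -/
lemma exists_roof {n : ℤ} (K : CochainComplex E ℤ) {a : ℤ} (ha : K.IsStrictlyGE a)
    (hb : K.IsStrictlyLE n) {L : Kb E}
    (f f' : (quasiIso E).Q.obj (ofComplex K a n ha hb) ⟶ (quasiIso E).Q.obj L) :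
    ∃ (M : CochainComplex E ℤ) (c : ℤ) (hc : M.IsStrictlyGE c) (hn : M.IsStrictlyLE n)
      (s : ofComplex M c n hc hn ⟶ ofComplex K a n ha hb) (g g' : ofComplex M c n hc hn ⟶ L),
      IsIso ((quasiIso E).Q.map s) ∧ (quasiIso E).Q.map s ≫ f = (quasiIso E).Q.map g ∧
        (quasiIso E).Q.map s ≫ f' = (quasiIso E).Q.map g' := by
  have := hasRightCalculusOfFractions_quasiIso hsub
  obtain ⟨φ, hφ⟩ := Localization.exists_rightFraction (quasiIso E).Q (quasiIso E) f
  obtain ⟨φ', hφ'⟩ := Localization.exists_rightFraction (quasiIso E).Q (quasiIso E) f'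
  obtain ⟨ψ, hψ⟩ := MorphismProperty.HasRightCalculusOfFractions.exists_rightFraction
    (MorphismProperty.LeftFraction.mk φ.s φ'.s φ'.hs)
  replace hψ : ψ.s ≫ φ.s = ψ.f ≫ φ'.s := hψ
  have h1 : (quasiIso E).Q.map φ.s ≫ f = (quasiIso E).Q.map φ.f := by
    rw [hφ]
    exact φ.map_s_comp_map _ _
  have h1' : (quasiIso E).Q.map φ'.s ≫ f' = (quasiIso E).Q.map φ'.f := by
    rw [hφ']
    exact φ'.map_s_comp_map _ _
  obtain ⟨M, c, hc, hn, s, hs⟩ := exists_truncLE hsub ψ.X' n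
  have hs' : quasiIso E (s ≫ ψ.s ≫ φ.s) := by
    rw [quasiIso_iff hsub]
    intro i
    have h1 := (quasiIso_iff hsub _).1 φ.hs i
    have h2 : IsIso ((cohomology F i).map ψ.s) := (quasiIso_iff hsub _).1 ψ.hs i
    by_cases hi : i ≤ n
    · have := hs i hi
      rw [Functor.map_comp, Functor.map_comp]
      exact IsIso.comp_isIso
    · exact (isZero_cohomology F hc hn i (by lia)).isIso (isZero_cohomology F ha hb i (by lia)) _
  refine ⟨M, c, hc, hn, s ≫ ψ.s ≫ φ.s, s ≫ ψ.s ≫ φ.f, s ≫ ψ.f ≫ φ'.f,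
    Localization.inverts _ (quasiIso E) _ hs', ?_, ?_⟩
  · simp only [Functor.map_comp, Category.assoc]
    rw [← h1]
  · rw [hψ]
    simp only [Functor.map_comp, Category.assoc]
    rw [← h1']

/-- A morphism from a complex in degrees `≤ -1` to a two-term complex with monomorphic differential
is zero, because it is represented by a roof whose vertex is in degrees `≤ -1`, on which `H⁰`
vanishes. -/
lemma heart_of_mono (L : CochainComplex E ℤ) (ha : L.IsStrictlyGE (-1)) (hb : L.IsStrictlyLE 0)
    [Mono (F.map (L.d (-1) 0))] : heart E ((quasiIso E).Q.obj (ofComplex L (-1) 0 ha hb)) := by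
  refine ⟨connective_ofComplex L (-1) 0 ha hb, ?_⟩
  rintro K ⟨K', hK', ⟨e⟩⟩
  obtain ⟨K', a, b, h₁, h₂, rfl⟩ := exists_eq_ofComplex K'
  replace hK' : K'.IsStrictlyLE (-1) := hK'
  replace e : K ≅ (quasiIso E).Q.obj (ofComplex K' a (-1) h₁ hK') := e
  refine ⟨fun f f' => ?_⟩
  obtain ⟨M, c, hc, hn, s, g, g', hs, hg, hg'⟩ :=
    exists_roof hsub K' h₁ hK' (e.inv ≫ f) (e.inv ≫ f')
  have hM : M.IsStrictlyLE 0 := M.isStrictlyLE_of_le (-1) 0 (by simp)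
  have h0 : g = g' := eq_of_cohomology_map_eq (F := F) hc hM ha hb g g'
    ((isZero_cohomology F hc hn 0 (by simp)).eq_of_src _ _)
  rw [← cancel_epi e.inv, ← cancel_epi ((quasiIso E).Q.map s), hg, hg', h0]

/-- The objects of the heart are the two-term complexes with monomorphic differential. -/
lemma exists_iso_of_heart (K : Db E) (hK : heart E K) :
    ∃ (L : CochainComplex E ℤ) (ha : L.IsStrictlyGE (-1)) (hb : L.IsStrictlyLE 0),
      Mono (F.map (L.d (-1) 0)) ∧ Nonempty (K ≅ (quasiIso E).Q.obj (ofComplex L (-1) 0 ha hb)) := by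
  obtain ⟨⟨L, hL, ⟨e⟩⟩, hK⟩ := hK
  obtain ⟨L, a, b, ha, hb, rfl⟩ := exists_eq_ofComplex L
  replace hL : L.IsStrictlyLE 0 := hL
  replace e : K ≅ (quasiIso E).Q.obj (ofComplex L a 0 ha hL) := e
  have hz (n : ℤ) (hn : n < 0) : IsZero ((cohomology F n).obj (ofComplex L a 0 ha hL)) := by
    obtain ⟨M, c, hc, hM, s, hs⟩ := exists_truncLE hsub (ofComplex L a 0 ha hL) (-1)
    have := hs n (by lia)
    have := hK _ (connective_ofComplex M c (-1) hc hM)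
    have h1 : (quasiIso E).Q.map s ≫ e.inv = (quasiIso E).Q.map (ObjectProperty.homMk 0) ≫ e.inv :=
      Subsingleton.elim _ _
    have h2 := (cancel_mono e.inv).1 h1
    have h3 : (cohomology F n).map s = (cohomology F n).map (ObjectProperty.homMk 0) := by
      rw [← cancel_mono ((derivedCohomologyIso hsub n).inv.app _)]
      refine ((derivedCohomologyIso hsub n).inv.naturality _).trans
        (Eq.trans ?_ ((derivedCohomologyIso hsub n).inv.naturality _).symm)
      exact congrArg (fun t => _ ≫ (derivedCohomology hsub n).map t) h2
    have h4 : (cohomology F n).map s = 0 := by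
      rw [h3]
      exact Functor.map_zero (F.mapHomotopyCategory _ ⋙ HomotopyCategory.homologyFunctor _ _ n) _ _
    rw [IsZero.iff_id_eq_zero, ← cancel_epi ((cohomology F n).map s), h4, zero_comp, zero_comp]
  obtain ⟨L', ha', hb', s, hs, hm⟩ := exists_truncGE hsub L a ha hL hz
  have : IsIso ((quasiIso E).Q.map s) := Localization.inverts _ (quasiIso E) s hs
  exact ⟨L', ha', hb', hm, ⟨e ≪≫ asIso ((quasiIso E).Q.map s)⟩⟩

lemma heart_toDb (X : E) : heart E ((toDb E).obj X) := by
  have : Mono (F.map (((HomologicalComplex.single E (ComplexShape.up ℤ) 0).obj X).d (-1) 0)) := by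
    have h : IsZero (((HomologicalComplex.single E (ComplexShape.up ℤ) 0).obj X).X (-1)) :=
      HomologicalComplex.isZero_single_obj_X _ _ _ _ (by simp)
    exact ⟨fun _ _ _ => (F.map_isZero h).eq_of_tgt _ _⟩
  exact heart_of_mono hsub ((HomologicalComplex.single E (ComplexShape.up ℤ) 0).obj X)
    (CochainComplex.isStrictlyGE_of_ge _ (-1) 0 (by simp)) inferInstance

/-- The functor `H⁰` on the heart. -/
def heartCohomology : LH E ⥤ C := (heart E).ι ⋙ derivedCohomology hsub 0

lemma derivedCohomology_injective {K L : CochainComplex E ℤ} (ha : K.IsStrictlyGE (-1))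
    (hb : K.IsStrictlyLE 0) (ha' : L.IsStrictlyGE (-1)) (hb' : L.IsStrictlyLE 0)
    [Mono (F.map (L.d (-1) 0))]
    (f g : (quasiIso E).Q.obj (ofComplex K (-1) 0 ha hb) ⟶
      (quasiIso E).Q.obj (ofComplex L (-1) 0 ha' hb'))
    (hfg : (derivedCohomology hsub 0).map f = (derivedCohomology hsub 0).map g) : f = g := by
  obtain ⟨M, c, hc, hn, s, f', g', hs, hf, hg⟩ := exists_roof hsub K ha hb f g
  have h : (cohomology F 0).map f' = (cohomology F 0).map g' := by
    rw [← cancel_mono ((derivedCohomologyIso hsub 0).inv.app _)]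
    refine ((derivedCohomologyIso hsub 0).inv.naturality _).trans
      (Eq.trans ?_ ((derivedCohomologyIso hsub 0).inv.naturality _).symm)
    refine congrArg (fun t => _ ≫ t) ?_
    change (derivedCohomology hsub 0).map ((quasiIso E).Q.map f') =
      (derivedCohomology hsub 0).map ((quasiIso E).Q.map g')
    rw [← hf, ← hg, Functor.map_comp, Functor.map_comp, hfg]
  rw [← cancel_epi ((quasiIso E).Q.map s), hf, hg, eq_of_cohomology_map_eq hc hn ha' hb' f' g' h]

/-- A morphism `γ` on `H⁰` is realized by a roof: its vertex is the two-term complex that resolves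
`H⁰(K)` by the fibre product of `K⁰` and `L⁰` over `H⁰(L)`, which is a subobject of `K⁰ ⊞ L⁰`. -/
lemma derivedCohomology_surjective {K L : CochainComplex E ℤ} (ha : K.IsStrictlyGE (-1))
    (hb : K.IsStrictlyLE 0) (ha' : L.IsStrictlyGE (-1)) (hb' : L.IsStrictlyLE 0)
    [Mono (F.map (K.d (-1) 0))] [Mono (F.map (L.d (-1) 0))]
    (γ : (cohomology F 0).obj (ofComplex K (-1) 0 ha hb) ⟶
      (cohomology F 0).obj (ofComplex L (-1) 0 ha' hb')) :
    ∃ (M : Kb E) (s : M ⟶ ofComplex K (-1) 0 ha hb) (f : M ⟶ ofComplex L (-1) 0 ha' hb'),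
      quasiIso E s ∧ (cohomology F 0).map s ≫ γ = (cohomology F 0).map f := by
  have := preservesBinaryBiproducts_of_preservesBiproducts F
  let P := pullback (toCohomology F ha hb ≫ γ) (toCohomology F ha' hb')
  have hm : Mono (biprod.lift (pullback.fst _ _ : P ⟶ _) (pullback.snd _ _)) :=
    ⟨fun u w h => pullback.hom_ext (by simpa using h =≫ biprod.fst)
      (by simpa using h =≫ biprod.snd)⟩
  obtain ⟨Y, ⟨e⟩⟩ := hsub (X := K.X 0 ⊞ L.X 0)
    (biprod.lift (pullback.fst _ _ : P ⟶ _) (pullback.snd _ _) ≫ (F.mapBiprod _ _).inv)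
  let s₀ : Y ⟶ K.X 0 := F.preimage (e.hom ≫ pullback.fst _ _)
  let f₀ : Y ⟶ L.X 0 := F.preimage (e.hom ≫ pullback.snd _ _)
  have hs₀ : F.map s₀ = e.hom ≫ pullback.fst _ _ := F.map_preimage _
  have hf₀ : F.map f₀ = e.hom ≫ pullback.snd _ _ := F.map_preimage _
  have hs₁ : Epi (F.map s₀) := hs₀ ▸ inferInstance
  have hsf : F.map s₀ ≫ toCohomology F ha hb ≫ γ = F.map f₀ ≫ toCohomology F ha' hb' := by
    rw [hs₀, hf₀, Category.assoc, Category.assoc, pullback.condition]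
  obtain ⟨X, d, hd, w, ε, hε⟩ := exists_twoTerm hsub (F.map s₀ ≫ toCohomology F ha hb)
  obtain ⟨s, hs⟩ := exists_hom_twoTerm d ha hb s₀ w
  obtain ⟨f, hf⟩ := exists_hom_twoTerm d ha' hb' f₀ (by
    rw [← hsf, reassoc_of% w, zero_comp])
  have h1 : (cohomology F 0).map (ofHom inferInstance inferInstance ha hb s) = ε.hom := by
    rw [← cancel_epi (toCohomology F (K := twoTerm d) _ _), hε, toCohomology_naturality, hs,
      F.map_comp, Category.assoc]
  refine ⟨ofComplex (twoTerm d) (-1) 0 inferInstance inferInstance, ofHom _ _ _ _ s,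
    ofHom _ _ _ _ f, ?_, ?_⟩
  · rw [quasiIso_iff hsub]
    intro n
    obtain rfl | hn := eq_or_ne n 0
    · rw [h1]
      infer_instance
    · exact (isZero_cohomology_of_mono F _ _ n hn).isIso (isZero_cohomology_of_mono F _ _ n hn) _
  · rw [← cancel_epi (toCohomology F (K := twoTerm d) _ _), ← Category.assoc,
      toCohomology_naturality, toCohomology_naturality, hs, hf, F.map_comp, F.map_comp,
      Category.assoc, Category.assoc, Category.assoc, ← hsf]

instance : (heartCohomology hsub).Faithful where
  map_injective {K L} f g hfg := by
    obtain ⟨K', ha, hb, -, ⟨e⟩⟩ := exists_iso_of_heart hsub K.obj K.property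
    obtain ⟨L', ha', hb', hL, ⟨e'⟩⟩ := exists_iso_of_heart hsub L.obj L.property
    replace hfg : (derivedCohomology hsub 0).map f.hom = (derivedCohomology hsub 0).map g.hom := hfg
    have h := derivedCohomology_injective hsub ha hb ha' hb' (e.inv ≫ f.hom ≫ e'.hom)
      (e.inv ≫ g.hom ≫ e'.hom) (by simp only [Functor.map_comp, hfg])
    exact ObjectProperty.hom_ext _ ((cancel_mono e'.hom).1 ((cancel_epi e.inv).1 h))

instance : (heartCohomology hsub).Full where
  map_surjective {K L} γ := by
    obtain ⟨K', ha, hb, hK, ⟨e⟩⟩ := exists_iso_of_heart hsub K.obj K.property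
    obtain ⟨L', ha', hb', hL, ⟨e'⟩⟩ := exists_iso_of_heart hsub L.obj L.property
    let H := derivedCohomology hsub 0
    let η := derivedCohomologyIso hsub 0
    obtain ⟨γ', hγ⟩ : ∃ γ' : H.obj K.obj ⟶ H.obj L.obj, γ' = γ := ⟨γ, rfl⟩
    obtain ⟨M, s, f, hs, h⟩ := derivedCohomology_surjective hsub ha hb ha' hb'
      (η.inv.app _ ≫ H.map e.inv ≫ γ' ≫ H.map e'.hom ≫ η.hom.app _)
    have hs' := Localization.inverts (quasiIso E).Q (quasiIso E) s hs
    have h1 : H.map ((quasiIso E).Q.map s) ≫ η.hom.app _ = η.hom.app _ ≫ (cohomology F 0).map s :=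
      η.hom.naturality s
    have h2 : H.map ((quasiIso E).Q.map f) ≫ η.hom.app _ = η.hom.app _ ≫ (cohomology F 0).map f :=
      η.hom.naturality f
    have h3 : H.map ((quasiIso E).Q.map f) =
        H.map ((quasiIso E).Q.map s) ≫ H.map e.inv ≫ γ' ≫ H.map e'.hom := by
      rw [← cancel_mono (η.hom.app _), h2, ← h, ← Category.assoc, ← h1]
      simp only [Category.assoc, Iso.hom_inv_id_app_assoc]
    let g : K.obj ⟶ L.obj :=
      e.hom ≫ inv ((quasiIso E).Q.map s) ≫ (quasiIso E).Q.map f ≫ e'.inv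
    have hg : H.map g = γ' := by
      simp only [g, Functor.map_comp, Functor.map_inv, h3]
      simp [← Functor.map_comp]
    exact ⟨ObjectProperty.homMk g, hg.trans hγ⟩

lemma essSurj_heartCohomology (hquot : ∀ c : C, ∃ (X : E) (p : F.obj X ⟶ c), Epi p) :
    (heartCohomology hsub).EssSurj where
  mem_essImage c := by
    obtain ⟨Y, p, hp⟩ := hquot c
    obtain ⟨X, d, hd, -, ε, -⟩ := exists_twoTerm hsub p
    exact ⟨⟨_, heart_of_mono hsub (twoTerm d) inferInstance inferInstance⟩,
      ⟨(derivedCohomologyIso hsub 0).app _ ≪≫ ε⟩⟩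

/-- The restriction of `H⁰` to objects of `E` in degree `0` is `F`. -/
def heartCohomologyIso :
    (heart E).lift (toDb E) (heart_toDb hsub) ⋙ heartCohomology hsub ≅ F :=
  Functor.isoWhiskerLeft (toKb E) (derivedCohomologyIso hsub 0) ≪≫
    Functor.isoWhiskerLeft (HomologicalComplex.single E (ComplexShape.up ℤ) 0 ⋙
      F.mapHomologicalComplex (ComplexShape.up ℤ))
      (HomotopyCategory.homologyFunctorFactors C (ComplexShape.up ℤ) 0) ≪≫
    Functor.isoWhiskerRight (HomologicalComplex.singleMapHomologicalComplex F _ 0)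
      (HomologicalComplex.homologyFunctor C (ComplexShape.up ℤ) 0) ≪≫
    Functor.isoWhiskerLeft F (HomologicalComplex.homologyFunctorSingleIso C _ 0) ≪≫
    F.rightUnitor

/-- If `E` is a full subcategory of an abelian category `C`, closed under subobjects and such that
each object of `C` is a quotient of an object of `E`, then `C` is the abelian envelope of `E`. -/
theorem exists_LH_equivalence (hquot : ∀ c : C, ∃ (X : E) (p : F.obj X ⟶ c), Epi p) :
    ∃ (h : ∀ K : E, heart E ((toDb E).obj K)) (e : LH E ≌ C),
      Nonempty ((heart E).lift (toDb E) h ⋙ e.functor ≅ F) := by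
  have := essSurj_heartCohomology hsub hquot
  have : (heartCohomology hsub).IsEquivalence := { }
  exact ⟨heart_toDb hsub, (heartCohomology hsub).asEquivalence, ⟨heartCohomologyIso hsub⟩⟩

end Heart

end QuasiAb

namespace Devissage

open QuasiAb

namespace EAB

variable {A : Type v} [SmallCategory A] [Abelian A] {B : ObjectProperty A} [IsTwoStep B]

/-! ### The category of pairs is quasi-abelian -/

instance : HasFiniteBiproducts (EAB B) :=
  have : HasFiniteProducts (EAB B) := hasFiniteProducts_of_has_binary_and_terminal
  HasFiniteBiproducts.of_hasFiniteProducts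

/-- The functor `(X, Y) ↦ X`. -/
abbrev forgetX : EAB B ⥤ A where
  obj K := K.X
  map a := a.f

/-- The functor `(X, Y) ↦ Y`. -/
abbrev forgetY : EAB B ⥤ A where
  obj K := (K.Y.1 : A)
  map a := a.g.hom
  map_id K := (cancel_mono K.Y.1.arrow).1 ((Good.restrict_hom_arrow _ _ _ _).trans (by simp))
  map_comp {K L M} a b := (cancel_mono M.Y.1.arrow).1 ((Good.restrict_hom_arrow _ _ _ _).trans (by
    rw [Category.assoc, Good.restrict_hom_arrow, ← Category.assoc, Good.restrict_hom_arrow,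
      Category.assoc, comp_f]))

/-- The functor `(X, Y) ↦ X/Y`. -/
abbrev quot : EAB B ⥤ A where
  obj K := cokernel K.Y.1.arrow
  map {K L} a := cokernel.map _ _ a.g.hom a.f (Good.restrict_hom_arrow _ _ _ _).symm

instance : (forgetX (B := B)).Additive where
instance : (forgetY (B := B)).Additive where
  map_add {K L a b} := (cancel_mono L.Y.1.arrow).1 (by
    refine (Good.restrict_hom_arrow K.Y L.Y (a + b).f (a + b).factors).trans ?_
    refine Eq.trans ?_ (Preadditive.add_comp _ _ _ a.g.hom b.g.hom L.Y.1.arrow).symm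
    rw [Good.restrict_hom_arrow, Good.restrict_hom_arrow, add_f, Preadditive.comp_add])

lemma π_quot_map {K L : EAB B} (a : K ⟶ L) :
    cokernel.π K.Y.1.arrow ≫ quot.map a = a.f ≫ cokernel.π L.Y.1.arrow :=
  cokernel.π_desc _ _ _

lemma forgetY_map_arrow {K L : EAB B} (a : K ⟶ L) :
    forgetY.map a ≫ L.Y.1.arrow = K.Y.1.arrow ≫ a.f :=
  Good.restrict_hom_arrow K.Y L.Y a.f a.factors

instance : (quot (B := B)).Additive where
  map_add {K L a b} := (cancel_epi (cokernel.π K.Y.1.arrow)).1 (by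
    refine (π_quot_map (a + b)).trans ?_
    refine Eq.trans ?_ (Preadditive.comp_add _ _ _ (cokernel.π K.Y.1.arrow)
      (quot.map a) (quot.map b)).symm
    rw [π_quot_map, π_quot_map, add_f, Preadditive.add_comp])

lemma factors_iff {X T : A} (P : Subobject X) (k : T ⟶ X) :
    P.Factors k ↔ k ≫ cokernel.π P.arrow = 0 := by
  refine ⟨fun h => ?_, factors_of_comp_π P k⟩
  rw [← P.factorThru_arrow k h, Category.assoc, cokernel.condition, comp_zero]

/-- The preimage of `Y ⊆ X` under a monomorphism `X' ⟶ X`. -/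
def comapGood {X X' : A} (m : X' ⟶ X) [Mono m] (Y : Good B X) : Good B X' :=
  ⟨kernelSubobject (m ≫ cokernel.π Y.1.arrow), by
    have h : Y.1.Factors ((kernelSubobject (m ≫ cokernel.π Y.1.arrow)).arrow ≫ m) := by
      rw [factors_iff, Category.assoc]
      exact kernelSubobject_arrow_comp _
    have : Mono (Y.1.factorThru _ h) := mono_of_mono_fac (Y.1.factorThru_arrow _ h)
    exact B.prop_of_mono (Y.1.factorThru _ h) Y.2.1,
    prop_cokernel_of_kernel (m ≫ cokernel.π Y.1.arrow) Y.2.2 _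
      ((kernelSubobject_factors_iff _ _).2 (kernel.condition _))⟩

lemma comapGood_factors_iff {X X' T : A} (m : X' ⟶ X) [Mono m] (Y : Good B X) (t : T ⟶ X') :
    (comapGood m Y).1.Factors t ↔ Y.1.Factors (t ≫ m) := by
  rw [factors_iff Y.1, Category.assoc]
  exact kernelSubobject_factors_iff _ _

/-- The image of `Y ⊆ X` under an epimorphism `X ⟶ X'`. -/
def mapGood {X X' : A} (e : X ⟶ X') [Epi e] (Y : Good B X) : Good B X' :=
  ⟨imageSubobject (Y.1.arrow ≫ e),
    B.prop_of_epi (factorThruImageSubobject (Y.1.arrow ≫ e)) Y.2.1, by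
    have h : Y.1.arrow ≫ e ≫ cokernel.π (imageSubobject (Y.1.arrow ≫ e)).arrow = 0 := by
      have h := Subobject.factors_comp_arrow (P := imageSubobject (Y.1.arrow ≫ e))
        (factorThruImageSubobject (Y.1.arrow ≫ e))
      rwa [imageSubobject_arrow_comp, factors_iff, Category.assoc] at h
    have : Epi (cokernel.desc _ _ h) := epi_of_epi_fac (cokernel.π_desc _ _ h)
    exact B.prop_of_epi (cokernel.desc _ _ h) Y.2.2⟩

/-- The projection from `Y` to its image. -/
def toMapGood {X X' : A} (e : X ⟶ X') [Epi e] (Y : Good B X) :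
    (Y.1 : A) ⟶ ((mapGood e Y).1 : A) :=
  factorThruImageSubobject (Y.1.arrow ≫ e)

instance {X X' : A} (e : X ⟶ X') [Epi e] (Y : Good B X) : Epi (toMapGood e Y) :=
  inferInstanceAs (Epi (factorThruImageSubobject (Y.1.arrow ≫ e)))

lemma toMapGood_arrow {X X' : A} (e : X ⟶ X') [Epi e] (Y : Good B X) :
    toMapGood e Y ≫ (mapGood e Y).1.arrow = Y.1.arrow ≫ e :=
  imageSubobject_arrow_comp _

lemma toMapGood_arrow_assoc {X X' T : A} (e : X ⟶ X') [Epi e] (Y : Good B X) (t : X' ⟶ T) :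
    toMapGood e Y ≫ (mapGood e Y).1.arrow ≫ t = Y.1.arrow ≫ e ≫ t := by
  rw [← Category.assoc, toMapGood_arrow, Category.assoc]

lemma mapGood_factors {X X' : A} (e : X ⟶ X') [Epi e] (Y : Good B X) :
    (mapGood e Y).1.Factors (Y.1.arrow ≫ e) := by
  rw [← toMapGood_arrow]
  exact Subobject.factors_comp_arrow _

lemma factors_mapGood_comp {X X' T : A} (e : X ⟶ X') [Epi e] (Y : Good B X) (t : X' ⟶ T)
    (P : Subobject T) (h : P.Factors (Y.1.arrow ≫ e ≫ t)) :
    P.Factors ((mapGood e Y).1.arrow ≫ t) := by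
  rw [factors_iff] at h ⊢
  rw [← cancel_epi (toMapGood e Y), Category.assoc, toMapGood_arrow_assoc, comp_zero, ← h,
    Category.assoc, Category.assoc]

section

variable {K L : EAB B} (a : K ⟶ L)

instance : Mono (kernel.ι (Hom.f a)) := inferInstanceAs (Mono (kernel.ι (a.f : K.X ⟶ L.X)))

instance : Epi (cokernel.π (Hom.f a)) := inferInstanceAs (Epi (cokernel.π (a.f : K.X ⟶ L.X)))

/-- The kernel of a morphism of pairs. -/
abbrev kernelObj : EAB B := ⟨kernel a.f, comapGood (kernel.ι a.f) K.Y⟩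

/-- The inclusion of the kernel. -/
abbrev kernelι : kernelObj a ⟶ K :=
  Hom.mk (K := kernelObj a) (kernel.ι a.f)
    ((comapGood_factors_iff (kernel.ι a.f) K.Y _).1 (Subobject.factors_self _))

lemma kernelι_comp : kernelι a ≫ a = 0 := hom_ext (kernel.condition (a.f : K.X ⟶ L.X))

lemma factors_kernel_lift {T : EAB B} (t : T ⟶ K) (ht : t.f ≫ a.f = 0) :
    (comapGood (kernel.ι a.f) K.Y).1.Factors (T.Y.1.arrow ≫ kernel.lift a.f t.f ht) := by
  rw [comapGood_factors_iff, Category.assoc, kernel.lift_ι]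
  exact t.factors

/-- `kernelι a` is a kernel of `a`. -/
def kernelIsLimit : IsLimit (KernelFork.ofι (kernelι a) (kernelι_comp a)) :=
  KernelFork.IsLimit.ofι _ _
    (fun {T} t ht => Hom.mk (K := T) (L := kernelObj a)
      (kernel.lift a.f t.f (congrArg Hom.f ht)) (factors_kernel_lift a t _))
    (fun _ _ => hom_ext (kernel.lift_ι _ _ _))
    (fun _ _ _ hm => hom_ext ((cancel_mono (kernel.ι a.f)).1
      ((congrArg Hom.f hm).trans (kernel.lift_ι _ _ _).symm)))

/-- The cokernel of a morphism of pairs. -/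
abbrev cokernelObj : EAB B := ⟨cokernel a.f, mapGood (cokernel.π a.f) L.Y⟩

/-- The projection to the cokernel. -/
abbrev cokernelπ : L ⟶ cokernelObj a :=
  Hom.mk (L := cokernelObj a) (cokernel.π a.f) (mapGood_factors (cokernel.π a.f) L.Y)

lemma comp_cokernelπ : a ≫ cokernelπ a = 0 := hom_ext (cokernel.condition (a.f : K.X ⟶ L.X))

lemma factors_cokernel_desc {T : EAB B} (t : L ⟶ T) (ht : a.f ≫ t.f = 0) :
    T.Y.1.Factors ((mapGood (cokernel.π a.f) L.Y).1.arrow ≫ cokernel.desc a.f t.f ht) := by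
  refine factors_mapGood_comp _ _ _ _ ?_
  rw [cokernel.π_desc]
  exact t.factors

/-- `cokernelπ a` is a cokernel of `a`. -/
def cokernelIsColimit : IsColimit (CokernelCofork.ofπ (cokernelπ a) (comp_cokernelπ a)) :=
  CokernelCofork.IsColimit.ofπ _ _
    (fun {T} t ht => Hom.mk (K := cokernelObj a) (L := T)
      (cokernel.desc a.f t.f (congrArg Hom.f ht)) (factors_cokernel_desc a t _))
    (fun _ _ => hom_ext (cokernel.π_desc _ _ _))
    (fun _ _ _ hm => hom_ext ((cancel_epi (cokernel.π a.f)).1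
      ((congrArg Hom.f hm).trans (cokernel.π_desc _ _ _).symm)))

end

instance : HasKernels (EAB B) where
  has_limit a := ⟨_, kernelIsLimit a⟩

instance : HasCokernels (EAB B) where
  has_colimit a := ⟨_, cokernelIsColimit a⟩

instance : PreservesFiniteColimits (forgetX (B := B)) := by
  have : HasFiniteCoproducts (EAB B) := inferInstance
  have : HasCoequalizers (EAB B) := Preadditive.hasCoequalizers_of_hasCokernels
  have (K L : EAB B) (a : K ⟶ L) : PreservesColimit (parallelPair a 0) (forgetX (B := B)) :=
    preservesColimit_of_preserves_colimit_cocone (cokernelIsColimit a)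
      ((CokernelCofork.isColimitMapCoconeEquiv _ _).symm (cokernelIsCokernel (a.f : K.X ⟶ L.X)))
  exact Functor.preservesFiniteColimits_of_preservesCokernels _

instance : PreservesFiniteLimits (forgetX (B := B)) := by
  have : HasFiniteProducts (EAB B) := inferInstance
  have : HasEqualizers (EAB B) := Preadditive.hasEqualizers_of_hasKernels
  have (K L : EAB B) (a : K ⟶ L) : PreservesLimit (parallelPair a 0) (forgetX (B := B)) :=
    preservesLimit_of_preserves_limit_cone (kernelIsLimit a)
      ((KernelFork.isLimitMapConeEquiv _ _).symm (kernelIsKernel (a.f : K.X ⟶ L.X)))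
  exact Functor.preservesFiniteLimits_of_preservesKernels _

instance : PreservesFiniteColimits (quot (B := B)) := by
  have : HasFiniteCoproducts (EAB B) := inferInstance
  have : HasCoequalizers (EAB B) := Preadditive.hasCoequalizers_of_hasCokernels
  have (K L : EAB B) (a : K ⟶ L) : PreservesColimit (parallelPair a 0) (quot (B := B)) := by
    refine preservesColimit_of_preserves_colimit_cocone (cokernelIsColimit a)
      ((CokernelCofork.isColimitMapCoconeEquiv _ _).symm ?_)
    have h₁ := π_quot_map a
    have h₂ := π_quot_map (cokernelπ a)
    have hd {T : A} (t : quot.obj L ⟶ T) (ht : quot.map a ≫ t = 0) :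
        a.f ≫ cokernel.π L.Y.1.arrow ≫ t = 0 := by
      rw [← reassoc_of% h₁, ht, comp_zero]
    have hd' {T : A} (t : quot.obj L ⟶ T) (ht : quot.map a ≫ t = 0) :
        (cokernelObj a).Y.1.arrow ≫
          cokernel.desc a.f (cokernel.π L.Y.1.arrow ≫ t) (hd t ht) = 0 := by
      rw [← cancel_epi (toMapGood (cokernel.π a.f) L.Y), toMapGood_arrow_assoc, cokernel.π_desc,
        cokernel.condition_assoc, zero_comp, comp_zero]
    have hf {T : A} (t : quot.obj L ⟶ T) (ht : quot.map a ≫ t = 0) :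
        quot.map (cokernelπ a) ≫ cokernel.desc _ _ (hd' t ht) = t := by
      rw [← cancel_epi (cokernel.π L.Y.1.arrow), reassoc_of% h₂, cokernel.π_desc, cokernel.π_desc]
    have : Epi (quot.map (cokernelπ a)) := epi_of_epi_fac h₂
    exact CokernelCofork.IsColimit.ofπ _
      (by rw [← Functor.map_comp, CokernelCofork.condition, Functor.map_zero])
      (fun {T} t ht => cokernel.desc (cokernelObj a).Y.1.arrow _ (hd' t ht)) hf
      (fun t ht m hm => (cancel_epi (quot.map (cokernelπ a))).1 (hm.trans (hf t ht).symm))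
  exact Functor.preservesFiniteColimits_of_preservesCokernels _

instance : PreservesFiniteLimits (forgetY (B := B)) := by
  have : HasFiniteProducts (EAB B) := inferInstance
  have : HasEqualizers (EAB B) := Preadditive.hasEqualizers_of_hasKernels
  have (K L : EAB B) (a : K ⟶ L) : PreservesLimit (parallelPair a 0) (forgetY (B := B)) := by
    refine preservesLimit_of_preserves_limit_cone (kernelIsLimit a)
      ((KernelFork.isLimitMapConeEquiv _ _).symm ?_)
    have h₁ := forgetY_map_arrow a
    have h₂ := forgetY_map_arrow (kernelι a)
    have hd {T : A} (t : T ⟶ forgetY.obj K) (ht : t ≫ forgetY.map a = 0) :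
        (t ≫ K.Y.1.arrow) ≫ a.f = 0 := by
      rw [Category.assoc, ← h₁, reassoc_of% ht, zero_comp]
    have hd' {T : A} (t : T ⟶ forgetY.obj K) (ht : t ≫ forgetY.map a = 0) :
        (comapGood (kernel.ι a.f) K.Y).1.Factors (kernel.lift a.f (t ≫ K.Y.1.arrow) (hd t ht)) := by
      rw [comapGood_factors_iff, kernel.lift_ι]
      exact Subobject.factors_comp_arrow _
    have hf {T : A} (t : T ⟶ forgetY.obj K) (ht : t ≫ forgetY.map a = 0) :
        Subobject.factorThru _ _ (hd' t ht) ≫ forgetY.map (kernelι a) = t := by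
      rw [← cancel_mono K.Y.1.arrow, Category.assoc, h₂, ← Category.assoc,
        Subobject.factorThru_arrow, kernel.lift_ι]
    have : Mono (forgetY.map (kernelι a)) := mono_of_mono_fac h₂
    exact KernelFork.IsLimit.ofι _
      (by rw [← Functor.map_comp, KernelFork.condition, Functor.map_zero])
      (fun {T} t ht => Subobject.factorThru (kernelObj a).Y.1 _ (hd' t ht)) hf
      (fun t ht m hm => (cancel_mono (forgetY.map (kernelι a))).1 (hm.trans (hf t ht).symm))
  exact Functor.preservesFiniteLimits_of_preservesKernels _

lemma mono_quot_kernelι {K L : EAB B} (a : K ⟶ L) : Mono (quot.map (kernelι a)) := by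
  refine Preadditive.mono_of_cancel_zero _ fun {T} k hk => ?_
  obtain ⟨T', p, _, k', hk'⟩ := surjective_up_to_refinements_of_epi
    (cokernel.π (kernelObj a).Y.1.arrow) k
  refine (cancel_epi p).1 ?_
  rw [hk', comp_zero, ← factors_iff, comapGood_factors_iff, factors_iff, Category.assoc]
  refine (congrArg (k' ≫ ·) (π_quot_map (kernelι a))).symm.trans ?_
  rw [← Category.assoc, ← hk', Category.assoc, hk, comp_zero]

lemma epi_forgetY_cokernelπ {K L : EAB B} (a : K ⟶ L) : Epi (forgetY.map (cokernelπ a)) := by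
  have : forgetY.map (cokernelπ a) = toMapGood (cokernel.π a.f) L.Y :=
    (cancel_mono (cokernelObj a).Y.1.arrow).1 ((forgetY_map_arrow (cokernelπ a)).trans
      (toMapGood_arrow (cokernel.π a.f) L.Y).symm)
  rw [this]
  infer_instance

/-- The strict monomorphisms are the `X ⟶ X'` for which `Y` is the preimage of `Y'`. -/
lemma strictMono_iff {K L : EAB B} (a : K ⟶ L) :
    strictMono (EAB B) a ↔ Mono (forgetX.map a) ∧ Mono (quot.map a) := by
  constructor
  · rintro ⟨Z, g, w, -, ⟨h⟩⟩
    let φ := h.conePointUniqueUpToIso (kernelIsLimit g)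
    have hφ : φ.hom ≫ kernelι g = a :=
      h.conePointUniqueUpToIso_hom_comp (kernelIsLimit g) WalkingParallelPair.zero
    have h₁ : Mono (forgetX.map (kernelι g)) := inferInstanceAs (Mono (kernel.ι (Hom.f g)))
    have h₂ := mono_quot_kernelι g
    have h₃ : IsIso (forgetX.map φ.hom) := (forgetX.mapIso φ).isIso_hom
    have h₄ : IsIso (quot.map φ.hom) := (quot.mapIso φ).isIso_hom
    rw [← hφ, Functor.map_comp, Functor.map_comp]
    exact ⟨@mono_comp _ _ _ _ _ _ (@IsIso.mono_of_iso _ _ _ _ _ h₃) _ h₁,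
      @mono_comp _ _ _ _ _ _ (@IsIso.mono_of_iso _ _ _ _ _ h₄) _ h₂⟩
  · rintro ⟨h₁, h₂⟩
    refine ⟨_, _, comp_cokernelπ a, ⟨cokernelIsColimit a⟩, ⟨?_⟩⟩
    have : Mono (a.f : K.X ⟶ L.X) := h₁
    have hf {T : EAB B} (t : T ⟶ L) (ht : t.f ≫ cokernel.π a.f = 0) :
        K.Y.1.Factors (T.Y.1.arrow ≫ Abelian.monoLift a.f t.f ht) := by
      refine factors_of_comp_π _ _ ((cancel_mono (quot.map a)).1 ?_)
      have h := t.factors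
      rw [factors_iff] at h
      rw [Category.assoc, Category.assoc, π_quot_map, Abelian.monoLift_comp_assoc, zero_comp, ← h,
        Category.assoc]
    exact KernelFork.IsLimit.ofι _ _
      (fun {T} t ht => Hom.mk (K := T) (L := K)
        (Abelian.monoLift a.f t.f (congrArg Hom.f ht)) (hf t _))
      (fun _ _ => hom_ext (Abelian.monoLift_comp _ _ _))
      (fun _ _ _ hm => hom_ext ((cancel_mono (a.f : K.X ⟶ L.X)).1
        ((congrArg Hom.f hm).trans (Abelian.monoLift_comp _ _ _).symm)))

/-- The strict epimorphisms are the `X ⟶ X'` for which `Y'` is the image of `Y`. -/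
lemma strictEpi_iff {K L : EAB B} (a : K ⟶ L) :
    strictEpi (EAB B) a ↔ Epi (forgetX.map a) ∧ Epi (forgetY.map a) := by
  constructor
  · rintro ⟨Z, g, w, -, ⟨h⟩⟩
    let φ := (cokernelIsColimit g).coconePointUniqueUpToIso h
    have hφ : cokernelπ g ≫ φ.hom = a :=
      (cokernelIsColimit g).comp_coconePointUniqueUpToIso_hom h WalkingParallelPair.one
    have h₁ : Epi (forgetX.map (cokernelπ g)) := inferInstanceAs (Epi (cokernel.π (Hom.f g)))
    have h₂ := epi_forgetY_cokernelπ g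
    have h₃ : IsIso (forgetX.map φ.hom) := (forgetX.mapIso φ).isIso_hom
    have h₄ : IsIso (forgetY.map φ.hom) := (forgetY.mapIso φ).isIso_hom
    rw [← hφ, Functor.map_comp, Functor.map_comp]
    exact ⟨@epi_comp _ _ _ _ _ _ h₁ _ (@IsIso.epi_of_iso _ _ _ _ _ h₃),
      @epi_comp _ _ _ _ _ _ h₂ _ (@IsIso.epi_of_iso _ _ _ _ _ h₄)⟩
  · rintro ⟨h₁, h₂⟩
    refine ⟨_, _, kernelι_comp a, ⟨kernelIsLimit a⟩, ⟨?_⟩⟩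
    have : Epi (a.f : K.X ⟶ L.X) := h₁
    have hf {T : EAB B} (t : K ⟶ T) (ht : kernel.ι a.f ≫ t.f = 0) :
        T.Y.1.Factors (L.Y.1.arrow ≫ Abelian.epiDesc a.f t.f ht) := by
      refine factors_of_comp_π _ _ ((cancel_epi (forgetY.map a)).1 ?_)
      have h := t.factors
      rw [factors_iff] at h
      rw [← Category.assoc, ← Category.assoc, forgetY_map_arrow, comp_zero, Category.assoc _ a.f,
        Abelian.comp_epiDesc, h]
    exact CokernelCofork.IsColimit.ofπ _ _
      (fun {T} t ht => Hom.mk (K := L) (L := T)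
        (Abelian.epiDesc a.f t.f (congrArg Hom.f ht)) (hf t _))
      (fun _ _ => hom_ext (Abelian.comp_epiDesc _ _ _))
      (fun _ _ _ hm => hom_ext ((cancel_epi (a.f : K.X ⟶ L.X)).1
        ((congrArg Hom.f hm).trans (Abelian.comp_epiDesc _ _ _).symm)))

/-- The functors `X` and `X/Y` preserve pushouts and detect strict monomorphisms; the functors `X`
and `Y` preserve pullbacks and detect strict epimorphisms. -/
lemma isQuasiAbelian : IsQuasiAbelian (EAB B) where
  hasFiniteBiproducts := inferInstance
  hasKernels := inferInstance
  hasCokernels := inferInstance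
  strictMono_pushout := ⟨fun {K L K' L' f g f' g'} sq hf => by
    rw [strictMono_iff] at hf ⊢
    exact ⟨(MorphismProperty.monomorphisms A).of_isPushout (sq.map forgetX) hf.1,
      (MorphismProperty.monomorphisms A).of_isPushout (sq.map quot) hf.2⟩⟩
  strictEpi_pullback := ⟨fun {K L K' L' f g f' g'} sq hf => by
    rw [strictEpi_iff] at hf ⊢
    exact ⟨(MorphismProperty.epimorphisms A).of_isPullback (sq.map forgetX) hf.1,
      (MorphismProperty.epimorphisms A).of_isPullback (sq.map forgetY) hf.2⟩⟩

end EAB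

end Devissage

namespace ProObj

/-! ### Morphisms from filtered limits of pro-objects to constant pro-objects -/

section

variable {C : Type v} [SmallCategory C] {I : Type v} [SmallCategory I]

/-- The morphisms from a constant ind-object `X` to an ind-object are the values at `X` of the
corresponding presheaf. -/
def indHomEquiv (X : C) (P : Ind C) :
    (Ind.yoneda.obj X ⟶ P) ≃ ((Ind.inclusion C).obj P).obj (op X) :=
  (Ind.inclusion.fullyFaithful (C := C)).homEquiv.trans
    (((Ind.yonedaCompInclusion (C := C)).app X).homFromEquiv.trans yonedaEquiv)

lemma indHomEquiv_apply {X : C} {P : Ind C} (a : Ind.yoneda.obj X ⟶ P) :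
    indHomEquiv X P a =
      yonedaEquiv ((Ind.yonedaCompInclusion (C := C)).inv.app X ≫ (Ind.inclusion C).map a) :=
  rfl

lemma indHomEquiv_comp {X : C} {P Q : Ind C} (a : Ind.yoneda.obj X ⟶ P) (f : P ⟶ Q) :
    indHomEquiv X Q (a ≫ f) = ((Ind.inclusion C).map f).app (op X) (indHomEquiv X P a) := by
  rw [indHomEquiv_apply, indHomEquiv_apply, Functor.map_comp, ← Category.assoc, yonedaEquiv_comp]

lemma indHomEquiv_map {X X' : C} (g : X' ⟶ X) {P : Ind C} (a : Ind.yoneda.obj X ⟶ P) :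
    indHomEquiv X' P (Ind.yoneda.map g ≫ a) =
      ((Ind.inclusion C).obj P).map g.op (indHomEquiv X P a) := by
  have h := (Ind.yonedaCompInclusion (C := C)).inv.naturality g
  rw [indHomEquiv_apply, indHomEquiv_apply, yonedaEquiv_naturality, Functor.map_comp,
    ← Category.assoc, ← Category.assoc]
  exact congrArg (fun t => yonedaEquiv (t ≫ (Ind.inclusion C).map a)) h.symm

/-- `indHomEquiv` as an isomorphism of functors of the ind-object. -/
def indYonedaCoyonedaIso (X : C) : coyoneda.obj (op (Ind.yoneda.obj X)) ≅
    Ind.inclusion C ⋙ (evaluation _ _).obj (op X) :=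
  NatIso.ofComponents (fun P => (indHomEquiv X P).toIso)
    (fun {P Q} f => by ext a; exact indHomEquiv_comp a f)

instance [IsFiltered I] (X : C) :
    PreservesColimitsOfShape I (coyoneda.obj (op (Ind.yoneda.obj X))) :=
  preservesColimitsOfShape_of_natIso (indYonedaCoyonedaIso X).symm

section

variable [IsFiltered I] {F : I ⥤ Ind C} {c : Cocone F} (hc : IsColimit c) {X : C}
include hc

lemma exists_ind_fac (a : Ind.yoneda.obj X ⟶ c.pt) :
    ∃ (i : I) (b : Ind.yoneda.obj X ⟶ F.obj i), b ≫ c.ι.app i = a :=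
  Types.jointly_surjective_of_isColimit
    (isColimitOfPreserves (coyoneda.obj (op (Ind.yoneda.obj X))) hc) a

lemma exists_ind_eq {i : I} (b b' : Ind.yoneda.obj X ⟶ F.obj i)
    (h : b ≫ c.ι.app i = b' ≫ c.ι.app i) : ∃ (k : I) (f : i ⟶ k), b ≫ F.map f = b' ≫ F.map f :=
  (Types.FilteredColimit.isColimit_eq_iff'
    (isColimitOfPreserves (coyoneda.obj (op (Ind.yoneda.obj X))) hc) b b').1 h

end

variable [IsCofiltered I] {F : I ⥤ Pro C} {c : Cone F} (hc : IsLimit c) {X : C}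
include hc

/-- A morphism from a cofiltered limit of pro-objects to a constant one factors through one of the
terms. -/
lemma exists_fac (a : c.pt ⟶ (const C).obj X) :
    ∃ (i : I) (b : F.obj i ⟶ (const C).obj X), c.π.app i ≫ b = a := by
  obtain ⟨i, b, h⟩ := exists_ind_fac (isColimitCoconeLeftOpOfCone _ hc) a.unop
  exact ⟨i.unop, b.op, Quiver.Hom.unop_inj h⟩

/-- Two morphisms from a term of a cofiltered limit of pro-objects to a constant pro-object that
become equal on the limit are already equal on another term. -/
lemma exists_eq {i : I} (b b' : F.obj i ⟶ (const C).obj X)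
    (h : c.π.app i ≫ b = c.π.app i ≫ b') : ∃ (k : I) (f : k ⟶ i), F.map f ≫ b = F.map f ≫ b' := by
  obtain ⟨k, f, h⟩ := exists_ind_eq (isColimitCoconeLeftOpOfCone _ hc) (i := op i) b.unop b'.unop
    (congrArg Quiver.Hom.unop h)
  exact ⟨k.unop, f.unop, Quiver.Hom.unop_inj h⟩

end

section

variable {C : Type v} [SmallCategory C]

/-- The constant pro-objects cogenerate. -/
lemma hom_ext {P Q : Pro C} {f g : P ⟶ Q}
    (h : ∀ (X : C) (a : Q ⟶ (const C).obj X), f ≫ a = g ≫ a) : f = g := by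
  refine Quiver.Hom.unop_inj ((Ind.inclusion _).map_injective ?_)
  ext X x
  obtain ⟨y, rfl⟩ := (indHomEquiv X.unop Q.unop).surjective x
  refine (indHomEquiv_comp y f.unop).symm.trans (Eq.trans ?_ (indHomEquiv_comp y g.unop))
  exact congrArg (indHomEquiv X.unop P.unop) (congrArg Quiver.Hom.unop (h X.unop.unop y.op))

variable {D : Type v} [SmallCategory D] [HasFiniteLimits D] (F : C ⥤ D)

instance (P : Pro C) : IsFiltered (CostructuredArrow (Ind.yoneda (C := Cᵒᵖ)) P.unop) :=
  RepresentablyCoflat.filtered _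

/-- Consider the morphism `F(P) ⟶ X` given by `p : P ⟶ Z` and `u : F(Z) ⟶ X`. Two such morphisms for
the same `p` are equal only if they become equal after replacing `Z` by another factor of `p`. -/
lemma exists_eq_of_map {P : Pro C} {Z : C} {X : D} (p : P ⟶ (const C).obj Z) (u u' : F.obj Z ⟶ X)
    (h : (map F).map p ≫ (mapConstIso F).hom.app Z ≫ (const D).map u =
      (map F).map p ≫ (mapConstIso F).hom.app Z ≫ (const D).map u') :
    ∃ (Z' : C) (p' : P ⟶ (const C).obj Z') (g : Z' ⟶ Z), p' ≫ (const C).map g = p ∧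
      F.map g ≫ u = F.map g ≫ u' := by
  let L := Ind.yoneda (C := Cᵒᵖ)
  let G := F.op ⋙ Ind.yoneda (C := Dᵒᵖ)
  let hc := Functor.isPointwiseLeftKanExtensionLeftKanExtensionUnit L G P.unop
  let i : CostructuredArrow L P.unop := CostructuredArrow.mk (Y := op Z) p.unop
  have key (w : F.obj Z ⟶ X) :
      Ind.yoneda.map w.op ≫ ((Functor.LeftExtension.mk _
        (L.leftKanExtensionUnit G)).coconeAt P.unop).ι.app i =
      ((map F).map p ≫ (mapConstIso F).hom.app Z ≫ (const D).map w).unop := by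
    exact (Category.assoc _ _ _).symm
  obtain ⟨k, f, hf⟩ := exists_ind_eq hc (i := i) (Ind.yoneda.map u.op) (Ind.yoneda.map u'.op)
    ((key u).trans ((congrArg Quiver.Hom.unop h).trans (key u').symm))
  refine ⟨k.left.unop, k.hom.op, f.left.unop, Quiver.Hom.unop_inj (CostructuredArrow.w f), ?_⟩
  refine Quiver.Hom.op_inj (Ind.yoneda.map_injective ?_)
  refine (Ind.yoneda.map_comp _ _).trans (hf.trans (Ind.yoneda.map_comp _ _).symm)

end

section

variable {C : Type v} [SmallCategory C]

/-- A natural action on morphisms from constant ind-objects comes from a morphism of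
ind-objects. -/
lemma exists_ind_hom {P Q : Ind C} (e : ∀ X : C, (Ind.yoneda.obj X ⟶ P) → (Ind.yoneda.obj X ⟶ Q))
    (he : ∀ {X X' : C} (a : Ind.yoneda.obj X ⟶ P) (g : X' ⟶ X),
      e X' (Ind.yoneda.map g ≫ a) = Ind.yoneda.map g ≫ e X a) :
    ∃ f : P ⟶ Q, ∀ (X : C) (a : Ind.yoneda.obj X ⟶ P), a ≫ f = e X a := by
  let φ : (Ind.inclusion C).obj P ⟶ (Ind.inclusion C).obj Q :=
    { app X := ↾fun x => indHomEquiv X.unop Q (e X.unop ((indHomEquiv X.unop P).symm x))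
      naturality X X' g := by
        ext x
        obtain ⟨a, rfl⟩ := (indHomEquiv X.unop P).surjective x
        have h₁ := indHomEquiv_map g.unop a
        have h₂ := indHomEquiv_map g.unop (e X.unop a)
        refine Eq.trans (b := indHomEquiv X'.unop Q (Ind.yoneda.map g.unop ≫ e X.unop a)) ?_
          (h₂.trans ?_)
        · exact congrArg (indHomEquiv X'.unop Q) (Eq.trans (congrArg (e X'.unop)
            ((Equiv.symm_apply_eq _).2 h₁.symm)) (he a g.unop))
        · exact congrArg (fun t => ((Ind.inclusion C).obj Q).map g (indHomEquiv X.unop Q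
            (e X.unop t))) (Equiv.symm_apply_apply _ _).symm }
  obtain ⟨f, hf⟩ := (Ind.inclusion _).map_surjective φ
  refine ⟨f, fun X a => (indHomEquiv X Q).injective ?_⟩
  rw [indHomEquiv_comp, hf]
  exact congrArg (fun t => indHomEquiv X Q (e X t)) (Equiv.symm_apply_apply _ _)

/-- A natural action on morphisms to constant pro-objects comes from a morphism of pro-objects. -/
lemma exists_hom {P Q : Pro C} (e : ∀ X : C, (Q ⟶ (const C).obj X) → (P ⟶ (const C).obj X))
    (he : ∀ {X X' : C} (a : Q ⟶ (const C).obj X) (g : X ⟶ X'),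
      e X' (a ≫ (const C).map g) = e X a ≫ (const C).map g) :
    ∃ f : P ⟶ Q, ∀ (X : C) (a : Q ⟶ (const C).obj X), f ≫ a = e X a := by
  obtain ⟨f, hf⟩ := exists_ind_hom (P := Q.unop) (Q := P.unop)
    (fun X a => (e X.unop a.op).unop) (fun a g => congrArg Quiver.Hom.unop (he a.op g.unop))
  exact ⟨f.op, fun X a => Quiver.Hom.unop_inj (hf (op X) a.unop)⟩

end

/-! ### The presheaves `Hom(F(-), Y)` -/

section

variable {A : Type v} [SmallCategory A] {C : Type v} [SmallCategory C]

/-- The presheaf `X ↦ Hom(F(X), Y)`. -/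
def homFunctor (F : A ⥤ Pro C) (Y : C) : Aᵒᵖ ⥤ Type v := F.op ⋙ yoneda.obj ((const C).obj Y)

/-- The morphism `Hom(G(-), Y) ⟶ Hom(F(-), Y)` induced by `F ⟶ G`. -/
def homFunctorMap {F G : A ⥤ Pro C} (τ : F ⟶ G) (Y : C) : homFunctor G Y ⟶ homFunctor F Y :=
  Functor.whiskerRight (NatTrans.op τ) (yoneda.obj ((const C).obj Y))

/-- The presheaf `X ↦ Hom(F(X), Y)` in terms of the underlying presheaves of the ind-objects. -/
def homFunctorIso (F : A ⥤ Pro C) (Y : C) :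
    homFunctor F Y ≅ (F.leftOp ⋙ Ind.inclusion _).flip.obj (op (op Y)) :=
  NatIso.ofComponents (fun X => ((opEquiv (F.obj X.unop) ((const C).obj Y)).trans
    (indHomEquiv (op Y) (F.obj X.unop).unop)).toIso) (fun {X X'} f => by
      ext a
      exact indHomEquiv_comp (X := op Y) (P := (F.obj X.unop).unop) (Q := (F.obj X'.unop).unop)
        a.unop (F.map f.unop).unop)

lemma homFunctorIso_naturality {F G : A ⥤ Pro C} (τ : F ⟶ G) (Y : C) :
    homFunctorMap τ Y ≫ (homFunctorIso F Y).hom = (homFunctorIso G Y).hom ≫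
      ((flipFunctor _ _ _).map (Functor.whiskerRight (NatTrans.leftOp τ)
        (Ind.inclusion Cᵒᵖ))).app (op (op Y)) := by
  ext X a
  exact indHomEquiv_comp (X := op Y) (P := (G.obj X.unop).unop) (Q := (F.obj X.unop).unop)
    a.unop (τ.app X.unop).unop

end

end ProObj

namespace Devissage

open ProObj

variable {A : Type v} [SmallCategory A] [Abelian A] {B : ObjectProperty A} [IsTwoStep B]

lemma isSheaf_homFunctor_jTilde (Y : B.FullSubcategory) :
    Presheaf.IsSheaf (singleEpiTopology A) (homFunctor (jTilde B) Y) := by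
  let e : homFunctor (jTilde B) Y ≅ (jTildeHom B).obj (op (op Y)) :=
    homFunctorIso (jTilde B) Y ≪≫
      ((flipFunctor _ _ _).mapIso (jTildeInclusionIso B)).app (op (op Y))
  rw [Presheaf.isSheaf_of_iso_iff e]
  exact ((presheafToSheaf (singleEpiTopology A) (Type v)).obj ((jHom B).obj (op (op Y)))).property

/-- The presheaf `Hom(j̃(-), Y)` is the sheafification of `Hom(j(-), Y)`. -/
lemma W_homFunctorMap (Y : B.FullSubcategory) :
    (singleEpiTopology A).W (homFunctorMap (jTildeToJ B) Y) := by
  have h := homFunctorIso_naturality (jTildeToJ B) Y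
  have h' : Functor.whiskerRight (NatTrans.leftOp (jTildeToJ B)) (Ind.inclusion _) =
      (flipFunctor _ _ _).map (jHomToJTildeHom B) ≫ (jTildeInclusionIso B).inv :=
    ((Ind.inclusion.fullyFaithful (C := B.FullSubcategoryᵒᵖ)).whiskeringRight Aᵒᵖ).map_preimage _
  have h'' := h.trans (congrArg (fun t => (homFunctorIso (j B) Y).hom ≫
    ((flipFunctor _ _ _).map t).app (op (op Y))) h')
  have e : ((flipFunctor _ _ _).map ((flipFunctor _ _ _).map (jHomToJTildeHom B) ≫
      (jTildeInclusionIso B).inv)).app (op (op Y)) = (jHomToJTildeHom B).app (op (op Y)) ≫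
      ((flipFunctor _ _ _).map (jTildeInclusionIso B).inv).app (op (op Y)) := rfl
  refine (MorphismProperty.cancel_right_of_respectsIso _ _ (homFunctorIso (jTilde B) Y).hom).1 ?_
  refine (congrArg (fun t => (singleEpiTopology A).W t) h'').mpr ?_
  refine (MorphismProperty.cancel_left_of_respectsIso _ (homFunctorIso (j B) Y).hom _).2 ?_
  refine (congrArg (fun t => (singleEpiTopology A).W t) e).mpr ?_
  refine (MorphismProperty.cancel_right_of_respectsIso _ _ _).2 ?_
  exact (singleEpiTopology A).W_toSheafify ((jHom B).obj (op (op Y)))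

/-! ### Sheaves for the single epi topology -/

section

/-- It suffices to test the sheaf condition on single epimorphisms, as these are stable under
pullback. -/
lemma isSheaf_singleEpiTopology_iff (P : Aᵒᵖ ⥤ Type v) :
    Presheaf.IsSheaf (singleEpiTopology A) P ↔
      ∀ {W X : A} (p : W ⟶ X), Epi p → Presieve.IsSheafFor P (Presieve.singleton p) := by
  rw [isSheaf_iff_isSheaf_of_type]
  constructor
  · intro h W X p hp
    rw [Presieve.isSheafFor_iff_generate]
    exact h _ ⟨W, p, hp, _, 𝟙 _, p, Presieve.singleton_self p, Category.id_comp _⟩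
  · rintro h X S ⟨W, p, hp, hS⟩
    refine Presieve.isSheafFor_subsieve_aux P (S := Sieve.generate (Presieve.singleton p)) ?_ ?_ ?_
    · refine (Sieve.generate_le_iff _ _).2 ?_
      rintro _ _ ⟨⟩
      exact hS
    · rw [← Presieve.isSheafFor_iff_generate]
      exact h p hp
    · intro T f hf x t₁ t₂ h₁ h₂
      refine ((h (pullback.snd p f) inferInstance).isSeparatedFor
        (Presieve.FamilyOfElements.restrict ?_ x) t₁ t₂ ?_ ?_)
      · rintro _ _ ⟨⟩
        exact ⟨_, pullback.fst p f, p, Presieve.singleton_self p, pullback.condition⟩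
      · exact fun _ _ _ => h₁ _ _
      · exact fun _ _ _ => h₂ _ _

variable {C : Type v} [SmallCategory C] (F : A ⥤ Pro C) (Y : C)

/-- Descent along epimorphisms for `Hom(F(-), Y)`. -/
lemma isSheaf_homFunctor_iff : Presheaf.IsSheaf (singleEpiTopology A) (homFunctor F Y) ↔
    ∀ {W X : A} (p : W ⟶ X), Epi p → ∀ b : F.obj W ⟶ (const C).obj Y,
      (∀ {T : A} (r s : T ⟶ W), r ≫ p = s ≫ p → F.map r ≫ b = F.map s ≫ b) →
        ∃! a : F.obj X ⟶ (const C).obj Y, F.map p ≫ a = b := by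
  rw [isSheaf_singleEpiTopology_iff]
  simp_rw [Presieve.isSheafFor_singleton]
  exact Iff.rfl

/-- A right exact functor turns an epimorphism into the coequalizer of its kernel pair. -/
lemma isSheaf_homFunctor [PreservesFiniteColimits F] :
    Presheaf.IsSheaf (singleEpiTopology A) (homFunctor F Y) := by
  rw [isSheaf_homFunctor_iff]
  intro W X p hp b hb
  have : IsRegularEpi p := IsRegularEpiCategory.regularEpiOfEpi p
  have hk : IsKernelPair p (pullback.fst p p) (pullback.snd p p) := IsPullback.of_hasPullback p p
  have hc := isColimitCoforkMapOfIsColimit F hk.w hk.toCoequalizer'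
  have hb' := hb _ _ hk.w
  refine ⟨Cofork.IsColimit.desc hc b hb', Cofork.IsColimit.π_desc' hc b hb', fun a ha => ?_⟩
  exact Cofork.IsColimit.hom_ext hc (ha.trans (Cofork.IsColimit.π_desc' hc b hb').symm)

end

/-! ### Local description of morphisms out of `j̃` -/

lemma epi_of_hom_const {C : Type v} [SmallCategory C] {P Q : Pro C} (f : P ⟶ Q)
    (h : ∀ (X : C) (a a' : Q ⟶ (const C).obj X), f ≫ a = f ≫ a' → a = a') : Epi f where
  left_cancellation a a' haa' := ProObj.hom_ext fun X b => h X _ _ (by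
    rw [← Category.assoc, haa', Category.assoc])

instance jTilde_map_epi {W X : A} (p : W ⟶ X) [Epi p] : Epi ((jTilde B).map p) := by
  refine epi_of_hom_const _ fun Y a a' haa' => ?_
  have h := (isSheaf_homFunctor_iff _ _).1 (isSheaf_homFunctor_jTilde Y) p inferInstance
    ((jTilde B).map p ≫ a) (fun r s hrs => by
      rw [← Category.assoc, ← Category.assoc, ← Functor.map_comp, hrs, Functor.map_comp])
  exact h.unique rfl haa'.symm

lemma exists_jTilde_desc {W X : A} (p : W ⟶ X) [Epi p] {Y : B.FullSubcategory}
    (b : (jTilde B).obj W ⟶ (const _).obj Y)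
    (hb : ∀ {T : A} (r s : T ⟶ W), r ≫ p = s ≫ p → (jTilde B).map r ≫ b = (jTilde B).map s ≫ b) :
    ∃ a : (jTilde B).obj X ⟶ (const _).obj Y, (jTilde B).map p ≫ a = b :=
  ((isSheaf_homFunctor_iff _ _).1 (isSheaf_homFunctor_jTilde Y) p inferInstance b hb).exists

/-- A morphism `j̃(X) ⟶ Y` is, locally on `X`, given by a morphism `j(X) ⟶ Y`. -/
lemma exists_jTilde_local {X : A} {Y : B.FullSubcategory}
    (a : (jTilde B).obj X ⟶ (const _).obj Y) :
    ∃ (W : A) (p : W ⟶ X) (_ : Epi p) (b : (j B).obj W ⟶ (const _).obj Y),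
      (jTildeToJ B).app W ≫ b = (jTilde B).map p ≫ a := by
  have := (W_homFunctorMap (B := B) Y).isLocallySurjective
  obtain ⟨W, p, hp, b, hb⟩ := Presheaf.imageSieve_mem (singleEpiTopology A)
    (homFunctorMap (jTildeToJ B) Y) (U := op X) a
  exact ⟨W, p, hp, b, hb⟩

/-- Two morphisms `j(X) ⟶ Y` that agree on `j̃(X)` agree locally on `X`. -/
lemma exists_j_local {X : A} {Y : B.FullSubcategory} (a a' : (j B).obj X ⟶ (const _).obj Y)
    (h : (jTildeToJ B).app X ≫ a = (jTildeToJ B).app X ≫ a') :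
    ∃ (W : A) (p : W ⟶ X), Epi p ∧ (j B).map p ≫ a = (j B).map p ≫ a' := by
  have := (W_homFunctorMap (B := B) Y).isLocallyInjective
  obtain ⟨W, p, hp, hpa⟩ := Presheaf.equalizerSieve_mem (singleEpiTopology A)
    (homFunctorMap (jTildeToJ B) Y) (X := op X) a a' h
  exact ⟨W, p, hp, hpa⟩

instance (X : A) : IsCodirectedOrder (Good B X) where
  directed Z Z' := by
    obtain ⟨Z'', h, h'⟩ := exists_good_le Z (𝟙 X) Z'
    exact ⟨Z'', h, Subobject.le_of_factors (by simpa using h')⟩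

/-- A morphism `j(X) ⟶ Y` factors through some `Z ⊆ X`. -/
lemma exists_jProj_fac {X : A} {Y : B.FullSubcategory} (a : (j B).obj X ⟶ (const _).obj Y) :
    ∃ (Z : Good B X) (w : Z.toB ⟶ Y), jProj Z ≫ (const _).map w = a := by
  obtain ⟨Z, b, h⟩ := exists_fac (limit.isLimit (goodDiagram B X ⋙ const B.FullSubcategory)) a
  exact ⟨Z, (const _).preimage (X := Z.toB) b,
    (congrArg (jProj Z ≫ ·) ((const _).map_preimage (X := Z.toB) b)).trans h⟩

/-- The inclusion `Z ⟶ W` of two elements of `Good B X`. -/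
abbrev Good.ofLE {X : A} {Z W : Good B X} (h : Z ≤ W) : Z.toB ⟶ W.toB :=
  B.homMk (Subobject.ofLE Z.1 W.1 h)

lemma exists_jProj_eq {X : A} {Y : B.FullSubcategory} {Z : Good B X} (w w' : Z.toB ⟶ Y)
    (h : jProj Z ≫ (const _).map w = jProj Z ≫ (const _).map w') :
    ∃ (Z' : Good B X) (hZ : Z' ≤ Z), Good.ofLE hZ ≫ w = Good.ofLE hZ ≫ w' := by
  obtain ⟨Z', f, h⟩ := exists_eq (limit.isLimit (goodDiagram B X ⋙ const B.FullSubcategory))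
    (i := Z) ((const _).map w) ((const _).map w') h
  refine ⟨Z', leOfHom f, (const _).map_injective ?_⟩
  rw [Functor.map_comp, Functor.map_comp]
  exact h

lemma exists_jProj_fac₂ {X : A} {Y : B.FullSubcategory} (a a' : (j B).obj X ⟶ (const _).obj Y) :
    ∃ (Z : Good B X) (w w' : Z.toB ⟶ Y), jProj Z ≫ (const _).map w = a ∧
      jProj Z ≫ (const _).map w' = a' := by
  obtain ⟨Z, w, rfl⟩ := exists_jProj_fac a
  obtain ⟨Z', w', rfl⟩ := exists_jProj_fac a'
  obtain ⟨Z'', h, h'⟩ := exists_le_le Z Z'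
  refine ⟨Z'', Good.ofLE h ≫ w, Good.ofLE h' ≫ w', ?_, ?_⟩
  · rw [Functor.map_comp, ← Category.assoc, jProj_w]
  · rw [Functor.map_comp, ← Category.assoc, jProj_w]

/-- The functor `j` preserves epimorphisms, because the image of a `Z ∈ Good B W` under an
epimorphism `W ⟶ X` is in `Good B X`. -/
instance j_map_epi {W X : A} (p : W ⟶ X) [Epi p] : Epi ((j B).map p) := by
  refine epi_of_hom_const _ fun Y a a' h => ?_
  obtain ⟨Z, w, w', rfl, rfl⟩ := exists_jProj_fac₂ a a'
  obtain ⟨V, hV⟩ := exists_good_map p Z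
  rw [← Category.assoc, ← Category.assoc, j_map_jProj p V Z hV, Category.assoc, Category.assoc,
    ← Functor.map_comp, ← Functor.map_comp] at h
  obtain ⟨V', hV', h⟩ := exists_jProj_eq _ _ h
  have hle : EAB.mapGood p V' ≤ Z := by
    refine Subobject.le_of_factors ?_
    have := EAB.factors_mapGood_comp p V' (𝟙 X) Z.1 (by
      rw [Category.comp_id, ← Subobject.ofLE_arrow hV', Category.assoc]
      exact Subobject.factors_of_factors_right _ hV)
    rwa [Category.comp_id] at this
  have e : EAB.toMapGood p V' ≫ Subobject.ofLE _ _ hle =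
      Subobject.ofLE _ _ hV' ≫ (V.restrict Z p hV).hom := by
    rw [← cancel_mono Z.1.arrow, Category.assoc, Category.assoc, Good.restrict_hom_arrow,
      Subobject.ofLE_arrow, EAB.toMapGood_arrow, ← Category.assoc, Subobject.ofLE_arrow]
  have key : Good.ofLE hle ≫ w = Good.ofLE hle ≫ w' := by
    refine B.hom_ext ((cancel_epi (EAB.toMapGood p V')).1 ?_)
    have h' := congrArg (fun t => t.hom) h
    refine (Category.assoc _ _ _).symm.trans ((congrArg (· ≫ w.hom) e).trans ?_)
    refine Eq.trans ?_ ((congrArg (· ≫ w'.hom) e).symm.trans (Category.assoc _ _ _))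
    exact (Category.assoc _ _ _).trans (h'.trans (Category.assoc _ _ _).symm)
  rw [← jProj_w hle, Category.assoc, Category.assoc, ← Functor.map_comp, ← Functor.map_comp, key]

/-- The morphism `j̃(X) ⟶ j(X)` is an epimorphism: the presheaves `Hom(j(-), Y)` are separated. -/
instance epi_jTildeToJ_app (X : A) : Epi ((jTildeToJ B).app X) := by
  refine epi_of_hom_const _ fun Y a a' h => ?_
  obtain ⟨W, p, hp, hpa⟩ := exists_j_local a a' h
  exact (cancel_epi ((j B).map p)).1 hpa

/-! ### The functor `j̃` is right exact -/

instance : (const B.FullSubcategory).Additive :=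
  have : (Ind.yoneda (C := B.FullSubcategoryᵒᵖ)).Additive :=
    Functor.additive_of_preserves_binary_products _
  inferInstanceAs (Ind.yoneda (C := B.FullSubcategoryᵒᵖ)).rightOp.Additive

instance : (j B).Additive where
  map_add {X X' f g} := by
    refine jObj_hom_ext fun (W : Good B X') => ?_
    obtain ⟨Z₁, h₁⟩ := exists_good_map f W
    obtain ⟨Z, hZ, hg⟩ := exists_good_le Z₁ g W
    have hf : W.1.Factors (Z.1.arrow ≫ f) := by
      rw [← Subobject.ofLE_arrow hZ, Category.assoc]
      exact Subobject.factors_of_factors_right _ h₁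
    have hfg : W.1.Factors (Z.1.arrow ≫ (f + g)) := by
      rw [Preadditive.comp_add]
      exact Subobject.factors_add _ _ hf hg
    have e : Z.restrict W (f + g) hfg = Z.restrict W f hf + Z.restrict W g hg :=
      Good.hom_ext (by
        refine (Good.restrict_hom_arrow _ _ _ _).trans ?_
        refine Eq.trans ?_ (Preadditive.add_comp _ _ _ (Z.restrict W f hf).hom
          (Z.restrict W g hg).hom _).symm
        rw [Good.restrict_hom_arrow, Good.restrict_hom_arrow, Preadditive.comp_add])
    refine (j_map_jProj (f + g) Z W hfg).trans ?_
    rw [e, Functor.map_add, Preadditive.comp_add, ← j_map_jProj, ← j_map_jProj]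
    exact (Preadditive.add_comp _ _ _ _ _ _).symm

instance : (jTilde B).Additive where
  map_add {X X' f g} := by
    refine ProObj.hom_ext fun Y a => ?_
    obtain ⟨W, p, hp, b, hb⟩ := exists_jTilde_local a
    obtain ⟨T₁, q₁, _, f', hf'⟩ := surjective_up_to_refinements_of_epi p f
    obtain ⟨T, q₂, _, g', hg'⟩ := surjective_up_to_refinements_of_epi p (q₁ ≫ g)
    have H (k : X ⟶ X') (k' : T ⟶ W) (hk : (q₂ ≫ q₁) ≫ k = k' ≫ p) :
        (jTilde B).map (q₂ ≫ q₁) ≫ (jTilde B).map k ≫ a =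
          (jTildeToJ B).app T ≫ (j B).map k' ≫ b := by
      rw [← Functor.map_comp_assoc, hk, Functor.map_comp_assoc, ← hb,
        ← NatTrans.naturality_assoc]
    rw [← cancel_epi ((jTilde B).map (q₂ ≫ q₁)),
      H (f + g) (q₂ ≫ f' + g') (by
        rw [Preadditive.comp_add, Preadditive.add_comp, Category.assoc, Category.assoc, hf', hg',
          Category.assoc]),
      Functor.map_add, Preadditive.add_comp, Preadditive.comp_add, Preadditive.add_comp,
      Preadditive.comp_add, H f (q₂ ≫ f') (by rw [Category.assoc, Category.assoc, hf']),
      H g g' (by rw [Category.assoc, hg'])]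

/-- If `r, s : T ⟶ X'` become equal in `C = coker f`, then `r - s` lifts locally to `X`; so a
morphism on `j̃(X')` that vanishes on `j̃(X)` satisfies descent along `X' ⟶ C`. -/
lemma exists_jTilde_desc_of_exact {X X' C : A} (f : X ⟶ X') (p : X' ⟶ C) (w : f ≫ p = 0)
    (hp : IsColimit (CokernelCofork.ofπ p w)) {Y : B.FullSubcategory}
    (b : (jTilde B).obj X' ⟶ (const _).obj Y) (hb : (jTilde B).map f ≫ b = 0) :
    ∃ a : (jTilde B).obj C ⟶ (const _).obj Y, (jTilde B).map p ≫ a = b := by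
  have : Epi p := epi_of_isColimit_cofork hp
  refine exists_jTilde_desc p b fun {T} r s hrs => ?_
  have hex : (ShortComplex.mk f p w).Exact := ShortComplex.exact_of_g_is_cokernel _ hp
  obtain ⟨T', q, _, k, hk⟩ := hex.exact_up_to_refinements (r - s) (by
    rw [Preadditive.sub_comp, sub_eq_zero]
    exact hrs)
  rw [← cancel_epi ((jTilde B).map q), ← sub_eq_zero, ← Preadditive.comp_sub,
    ← Preadditive.sub_comp, ← Functor.map_sub, ← Functor.map_comp_assoc, hk]
  change (jTilde B).map (k ≫ f) ≫ b = 0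
  rw [Functor.map_comp_assoc, hb, comp_zero]

instance (X X' : A) (f : X ⟶ X') : PreservesColimit (parallelPair f 0) (jTilde B) := by
  refine preservesColimit_of_preserves_colimit_cocone (cokernelIsCokernel f)
    ((CokernelCofork.isColimitMapCoconeEquiv _ _).symm ?_)
  have : Epi ((jTilde B).map (cokernel.π f)) := inferInstance
  have key {T : Pro B.FullSubcategory} (t : (jTilde B).obj X' ⟶ T)
      (ht : (jTilde B).map f ≫ t = 0) :
      ∃ g : (jTilde B).obj (cokernel f) ⟶ T, (jTilde B).map (cokernel.π f) ≫ g = t := by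
    choose e he using fun (Y : B.FullSubcategory) (a : T ⟶ (const _).obj Y) =>
      exists_jTilde_desc_of_exact f (cokernel.π f) (cokernel.condition f) (cokernelIsCokernel f)
        (t ≫ a) (by rw [reassoc_of% ht, zero_comp])
    obtain ⟨g, hg⟩ := ProObj.exists_hom e (fun {Y Y'} a g => by
      rw [← cancel_epi ((jTilde B).map (cokernel.π f)), he, ← Category.assoc, ← Category.assoc, he])
    refine ⟨g, ProObj.hom_ext fun Y a => ?_⟩
    rw [Category.assoc, hg, he]
  choose d hd using @key
  exact CokernelCofork.IsColimit.ofπ _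
    (by rw [← Functor.map_comp, CokernelCofork.condition, Functor.map_zero])
    (fun t ht => d t ht) (fun t ht => hd t ht)
    (fun t ht m hm => (cancel_epi ((jTilde B).map (cokernel.π f))).1 (hm.trans (hd t ht).symm))

instance preservesFiniteColimits_jTilde : PreservesFiniteColimits (jTilde B) :=
  Functor.preservesFiniteColimits_of_preservesCokernels _

/-! ### The universal property of `j̃` -/

section

variable (F : A ⥤ Pro B.FullSubcategory) [PreservesFiniteColimits F]

/-- A natural transformation `F ⟶ j` induces a map from morphisms `j̃(X) ⟶ Y` to morphisms
`F(X) ⟶ Y`, by the universal property of the sheafification. -/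
lemma exists_sheafification_desc (θ : F ⟶ j B) (Y : B.FullSubcategory) :
    ∃ e : ∀ X : A, ((jTilde B).obj X ⟶ (const _).obj Y) → (F.obj X ⟶ (const _).obj Y),
      (∀ X b, e X ((jTildeToJ B).app X ≫ b) = θ.app X ≫ b) ∧
        ∀ {X X' : A} (f : X ⟶ X') a, e X ((jTilde B).map f ≫ a) = F.map f ≫ e X' a := by
  obtain ⟨e, he⟩ := (W_homFunctorMap Y _ (isSheaf_homFunctor F Y)).2 (homFunctorMap θ Y)
  exact ⟨fun X => ConcreteCategory.hom (e.app (op X)),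
    fun X => ConcreteCategory.congr_hom (X := (homFunctor (j B) Y).obj (op X))
      (congrArg (fun t : homFunctor (j B) Y ⟶ homFunctor F Y => t.app (op X)) he),
    fun {X X'} f => ConcreteCategory.congr_hom (X := (homFunctor (jTilde B) Y).obj (op X'))
      (e.naturality f.op)⟩

lemma existsUnique_jTilde_lift (θ : F ⟶ j B) : ∃! θ' : F ⟶ jTilde B, θ' ≫ jTildeToJ B = θ := by
  have hF {W X : A} (p : W ⟶ X) [Epi p] : Epi (F.map p) := inferInstance
  choose e he₁ he₂ using exists_sheafification_desc F θ
  have he₃ {X : A} {Y Y' : B.FullSubcategory} (a : (jTilde B).obj X ⟶ (const _).obj Y)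
      (g : Y ⟶ Y') : e Y' X (a ≫ (const _).map g) = e Y X a ≫ (const _).map g := by
    obtain ⟨W, p, hp, b, hb⟩ := exists_jTilde_local a
    rw [← cancel_epi (F.map p), ← he₂, ← Category.assoc, ← hb, Category.assoc, he₁,
      ← Category.assoc, ← he₁ Y, hb, he₂, Category.assoc]
  choose θ' hθ' using fun X : A => ProObj.exists_hom (P := F.obj X) (Q := (jTilde B).obj X)
    (fun Y => e Y X) he₃
  refine ⟨{ app := θ', naturality := fun X X' f => ProObj.hom_ext fun Y a => ?_ }, ?_, ?_⟩
  · rw [Category.assoc, Category.assoc, hθ', hθ', he₂]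
  · ext X : 2
    refine ProObj.hom_ext fun Y b => ?_
    refine (Category.assoc _ _ _).trans ((hθ' X Y _).trans (he₁ Y X b))
  · intro τ hτ
    ext X : 2
    refine ProObj.hom_ext fun Y a => ?_
    obtain ⟨W, p, hp, b, hb⟩ := exists_jTilde_local a
    rw [← cancel_epi (F.map p)]
    refine Eq.trans ?_ (congrArg (F.map p ≫ ·) (hθ' X Y a).symm)
    rw [← he₂, ← hb, he₁, ← hτ, NatTrans.naturality_assoc, ← hb, NatTrans.comp_app, Category.assoc]

end

/-! ### Morphisms `i(P) ⟶ X` of pro-objects -/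

instance {C : Type v} [SmallCategory C] : PreservesFiniteLimits (const C) :=
  preservesFiniteLimits_rightOp (Ind.yoneda (C := Cᵒᵖ))

instance : (const A).Additive :=
  have : (Ind.yoneda (C := Aᵒᵖ)).Additive := Functor.additive_of_preserves_binary_products _
  inferInstanceAs (Ind.yoneda (C := Aᵒᵖ)).rightOp.Additive

instance : B.ι.PreservesEpimorphisms := B.preservesEpimorphisms_ι_of_isNormalMonoCategory

instance : B.ι.PreservesMonomorphisms := B.preservesMonomorphisms_ι_of_isNormalEpiCategory

instance {X Y : B.FullSubcategory} (f : X ⟶ Y) [Epi f] : Epi f.hom :=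
  inferInstanceAs (Epi (B.ι.map f))

instance {X Y : B.FullSubcategory} (f : X ⟶ Y) [Mono f] : Mono f.hom :=
  inferInstanceAs (Mono (B.ι.map f))

lemma proExtend_comp {P : Pro B.FullSubcategory} {Z : B.FullSubcategory} {X X' : A}
    (p : P ⟶ (const _).obj Z) (u : Z.obj ⟶ X) (f : X ⟶ X') :
    proExtend p u ≫ (const A).map f = proExtend p (u ≫ f) := by
  simp [proExtend]

/-- If `i(P) ⟶ i(Z) ⟶ X` is the same for `u` and `u'`, then `P ⟶ Z` factors through an object on
which `u` and `u'` agree. -/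
lemma exists_eq_of_proExtend_eq {P : Pro B.FullSubcategory} {Z : B.FullSubcategory} {X : A}
    (p : P ⟶ (const _).obj Z) (u u' : Z.obj ⟶ X) (h : proExtend p u = proExtend p u') :
    ∃ (Z' : B.FullSubcategory) (p' : P ⟶ (const _).obj Z') (g : Z' ⟶ Z),
      p' ≫ (const _).map g = p ∧ g.hom ≫ u = g.hom ≫ u' :=
  exists_eq_of_map B.ι p u u' h

/-- Morphisms `i(Q) ⟶ X` that factor through constant pro-objects of `B` can be compared after
composing with `i(e)` for an epimorphism `e : P ⟶ Q`. -/
lemma proExtend_eq_of_epi {P Q : Pro B.FullSubcategory} (e : P ⟶ Q) [Epi e]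
    {Z Z' : B.FullSubcategory} {X : A} (p : Q ⟶ (const _).obj Z) (u : Z.obj ⟶ X)
    (p' : Q ⟶ (const _).obj Z') (u' : Z'.obj ⟶ X)
    (h : (proι B).map e ≫ proExtend p u = (proι B).map e ≫ proExtend p' u') :
    proExtend p u = proExtend p' u' := by
  -- the case where `p` and `p'` are equal
  have key {Z : B.FullSubcategory} (p : Q ⟶ (const _).obj Z) (u u' : Z.obj ⟶ X)
      (h : proExtend (e ≫ p) u = proExtend (e ≫ p) u') : proExtend p u = proExtend p u' := by
    obtain ⟨Z', q, g, hq, hg⟩ := exists_eq_of_proExtend_eq _ _ _ h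
    have hp : p ≫ (const _).map (cokernel.π g) = 0 := by
      rw [← cancel_epi e, ← Category.assoc, ← hq, Category.assoc, ← Functor.map_comp,
        cokernel.condition, Functor.map_zero, comp_zero, comp_zero]
    have hl := isLimitForkMapOfIsLimit' (const B.FullSubcategory) (kernel.condition _)
      (kernelIsKernel (cokernel.π g))
    obtain ⟨p₁, hp₁⟩ := KernelFork.IsLimit.lift' hl p hp
    have hm : (kernel.ι (cokernel.π g)).hom ≫ u = (kernel.ι (cokernel.π g)).hom ≫ u' := by
      have e₁ : (Abelian.factorThruImage g).hom ≫ (kernel.ι (cokernel.π g)).hom = g.hom :=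
        congrArg (fun t => t.hom) (Abelian.image.fac g)
      rw [← cancel_epi (Abelian.factorThruImage g).hom, ← Category.assoc, ← Category.assoc, e₁, hg]
    rw [← hp₁]
    refine (proExtend_map _ _ _).trans ((congrArg _ hm).trans (proExtend_map _ _ _).symm)
  obtain ⟨q, hq⟩ : ∃ q : Q ⟶ (const _).obj (Z ⊞ Z'),
    q = p ≫ (const _).map biprod.inl + p' ≫ (const _).map biprod.inr := ⟨_, rfl⟩
  have h₁ : p = q ≫ (const _).map (biprod.fst : Z ⊞ Z' ⟶ Z) := by
    rw [hq, Preadditive.add_comp, Category.assoc, Category.assoc, ← Functor.map_comp,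
      ← Functor.map_comp, biprod.inl_fst, biprod.inr_fst, CategoryTheory.Functor.map_id,
      Functor.map_zero, comp_zero, add_zero, Category.comp_id]
  have h₂ : p' = q ≫ (const _).map (biprod.snd : Z ⊞ Z' ⟶ Z') := by
    rw [hq, Preadditive.add_comp, Category.assoc, Category.assoc, ← Functor.map_comp,
      ← Functor.map_comp, biprod.inl_snd, biprod.inr_snd, CategoryTheory.Functor.map_id,
      Functor.map_zero, comp_zero, zero_add, Category.comp_id]
  rw [h₁, h₂, proExtend_map, proExtend_map] at h ⊢
  refine key _ _ _ ?_
  rwa [map_proExtend, map_proExtend] at h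

lemma jToSelf_naturality {X X' : A} (f : X ⟶ X') :
    (proι B).map ((j B).map f) ≫ jToSelf B X' = jToSelf B X ≫ (const A).map f := by
  obtain ⟨Z, hZ⟩ := exists_good_map f (Classical.arbitrary (Good B X'))
  rw [jToSelf_eq Z, jToSelf_eq (Classical.arbitrary (Good B X')), map_proExtend,
    j_map_jProj f Z _ hZ, proExtend_map, Good.restrict_hom_arrow, proExtend_comp]

variable (B) in
/-- The canonical morphism `i(j̃(X)) ⟶ i(j(X)) ⟶ X`. -/
def jTildeToSelf (X : A) : (proι B).obj ((jTilde B).obj X) ⟶ (const A).obj X :=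
  (proι B).map ((jTildeToJ B).app X) ≫ jToSelf B X

lemma jTildeToSelf_eq {X : A} (Z : Good B X) :
    jTildeToSelf B X = proExtend ((jTildeToJ B).app X ≫ jProj Z) Z.1.arrow := by
  rw [jTildeToSelf, jToSelf_eq Z, map_proExtend]

lemma jTildeToSelf_naturality {X X' : A} (f : X ⟶ X') :
    (proι B).map ((jTilde B).map f) ≫ jTildeToSelf B X' = jTildeToSelf B X ≫ (const A).map f := by
  rw [jTildeToSelf, jTildeToSelf, Category.assoc, ← jToSelf_naturality, ← Functor.map_comp_assoc,
    ← Functor.map_comp_assoc, NatTrans.naturality]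

/-! ### The category `C_{A,B}` is abelian -/

namespace CAB

lemma comm' (K : CAB B) : proExtend K.v K.u = jTildeToSelf B K.X := K.comm

lemma proExtend_comp_map {X X' : A} {Y Y' : B.FullSubcategory} {u : Y.obj ⟶ X}
    {v : (jTilde B).obj X ⟶ (const _).obj Y} {u' : Y'.obj ⟶ X'}
    {v' : (jTilde B).obj X' ⟶ (const _).obj Y'} (f : X ⟶ X') (g : Y ⟶ Y')
    (hu : g.hom ≫ u' = u ≫ f) (hv : v ≫ (const _).map g = (jTilde B).map f ≫ v') :
    proExtend v u ≫ (const A).map f = (proι B).map ((jTilde B).map f) ≫ proExtend v' u' := by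
  rw [proExtend_comp, ← hu, ← proExtend_map, hv, map_proExtend]

instance (K L : CAB B) : Zero (K ⟶ L) := ⟨⟨0, 0, by
  rw [comp_zero]
  exact zero_comp, by
  rw [Functor.map_zero, Functor.map_zero, comp_zero, zero_comp]⟩⟩
instance (K L : CAB B) : Add (K ⟶ L) := ⟨fun a b => ⟨a.f + b.f, a.g + b.g, by
  rw [Preadditive.comp_add, ← a.comm_u, ← b.comm_u]
  exact Preadditive.add_comp _ _ _ _ _ _, by
  rw [Functor.map_add, Functor.map_add, Preadditive.comp_add, Preadditive.add_comp, a.comm_v,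
    b.comm_v]⟩⟩
instance (K L : CAB B) : Neg (K ⟶ L) := ⟨fun a => ⟨-a.f, -a.g, by
  rw [Preadditive.comp_neg, ← a.comm_u]
  exact Preadditive.neg_comp _ _, by
  rw [Functor.map_neg, Functor.map_neg, Preadditive.comp_neg, Preadditive.neg_comp, a.comm_v]⟩⟩

lemma hom_ext {K L : CAB B} {a b : K ⟶ L} (h₁ : a.f = b.f) (h₂ : a.g = b.g) : a = b :=
  Hom.ext h₁ h₂

/-- This instance is scoped, so that elsewhere the additive structure of `CAB B` is the one of a
given abelian structure. -/
scoped instance : Preadditive (CAB B) where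
  homGroup K L :=
    { add_assoc a b c := hom_ext (add_assoc _ _ _) (add_assoc _ _ _)
      zero_add a := hom_ext (zero_add _) (zero_add _)
      add_zero a := hom_ext (add_zero _) (add_zero _)
      add_comm a b := hom_ext (add_comm _ _) (add_comm _ _)
      neg_add_cancel a := hom_ext (neg_add_cancel _) (neg_add_cancel _)
      nsmul := nsmulRec
      zsmul := zsmulRec }
  add_comp _ _ _ a b c := hom_ext (Preadditive.add_comp _ _ _ _ _ _)
    (Preadditive.add_comp _ _ _ _ _ _)
  comp_add _ _ _ a b c := hom_ext (Preadditive.comp_add _ _ _ _ _ _)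
    (Preadditive.comp_add _ _ _ _ _ _)

variable (B) in
/-- The functor `(X, Y, u, v) ↦ X`. -/
abbrev forgetX : CAB B ⥤ A where
  obj K := K.X
  map a := a.f

variable (B) in
/-- The functor `(X, Y, u, v) ↦ Y`. -/
abbrev forgetY : CAB B ⥤ B.FullSubcategory where
  obj K := K.Y
  map a := a.g

instance : (forgetX B).Additive where
instance : (forgetY B).Additive where

lemma isIso_of_isIso {K L : CAB B} (a : K ⟶ L) (h₁ : IsIso ((forgetX B).map a))
    (h₂ : IsIso ((forgetY B).map a)) : IsIso a := by
  have h₁ : IsIso a.f := h₁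
  have h₂ : IsIso a.g := h₂
  have h₃ : IsIso a.g.hom := inferInstanceAs (IsIso (B.ι.map a.g))
  refine ⟨⟨⟨inv a.f, inv a.g, ?_, ?_⟩, hom_ext (IsIso.hom_inv_id _) (IsIso.hom_inv_id _),
    hom_ext (IsIso.inv_hom_id _) (IsIso.inv_hom_id _)⟩⟩
  · have e : a.g.hom ≫ (inv a.g).hom = 𝟙 _ := congrArg (fun t => t.hom) (IsIso.hom_inv_id a.g)
    rw [← cancel_epi a.g.hom, reassoc_of% e, ← Category.assoc, a.comm_u, Category.assoc,
      IsIso.hom_inv_id, Category.comp_id]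
  · rw [← cancel_epi ((jTilde B).map a.f), ← Category.assoc, ← a.comm_v, Category.assoc,
      ← Functor.map_comp, IsIso.hom_inv_id, CategoryTheory.Functor.map_id, Category.comp_id,
      ← Functor.map_comp_assoc, IsIso.hom_inv_id, CategoryTheory.Functor.map_id, Category.id_comp]

instance : HasZeroObject (CAB B) := by
  obtain ⟨O, hO⟩ := HasZeroObject.zero (C := A)
  obtain ⟨O', hO'⟩ := HasZeroObject.zero (C := B.FullSubcategory)
  refine ⟨⟨O, O', 0, 0, comp_zero, ?_⟩, ?_⟩
  · have : IsZero ((const A).obj O) := (const A).map_isZero hO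
    exact this.eq_of_tgt _ _
  · rw [IsZero.iff_id_eq_zero]
    exact hom_ext (hO.eq_of_src _ _) (hO'.eq_of_src _ _)

lemma const_biprod_hom_ext {C : Type v} [SmallCategory C] [Preadditive C] [HasBinaryBiproducts C]
    {D : Type*} [Category D] [Preadditive D] (F : C ⥤ D) [F.Additive] {T : D} {X X' : C}
    {a b : T ⟶ F.obj (X ⊞ X')} (h₁ : a ≫ F.map biprod.fst = b ≫ F.map biprod.fst)
    (h₂ : a ≫ F.map biprod.snd = b ≫ F.map biprod.snd) : a = b := by
  have h (t : T ⟶ F.obj (X ⊞ X')) : t = (t ≫ F.map biprod.fst) ≫ F.map biprod.inl +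
      (t ≫ F.map biprod.snd) ≫ F.map biprod.inr := by
    rw [Category.assoc, Category.assoc, ← Functor.map_comp, ← Functor.map_comp,
      ← Preadditive.comp_add, ← Functor.map_add, biprod.total, CategoryTheory.Functor.map_id,
      Category.comp_id]
  rw [h a, h b, h₁, h₂]

section

variable (K L : CAB B)

/-- The morphism `u` of the direct sum of two quadruples. -/
def biprodU : (K.Y ⊞ L.Y).obj ⟶ K.X ⊞ L.X :=
  biprod.lift ((biprod.fst : K.Y ⊞ L.Y ⟶ _).hom ≫ K.u) ((biprod.snd : K.Y ⊞ L.Y ⟶ _).hom ≫ L.u)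

/-- The morphism `v` of the direct sum of two quadruples. -/
def biprodV : (jTilde B).obj (K.X ⊞ L.X) ⟶ (const B.FullSubcategory).obj (K.Y ⊞ L.Y) :=
  (jTilde B).map biprod.fst ≫ K.v ≫ (const _).map biprod.inl +
    (jTilde B).map biprod.snd ≫ L.v ≫ (const _).map biprod.inr

lemma biprodV_fst : biprodV K L ≫ (const _).map biprod.fst = (jTilde B).map biprod.fst ≫ K.v := by
  rw [biprodV, Preadditive.add_comp, Category.assoc, Category.assoc, Category.assoc, Category.assoc,
    ← Functor.map_comp, ← Functor.map_comp, biprod.inl_fst, biprod.inr_fst,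
    CategoryTheory.Functor.map_id, Functor.map_zero, comp_zero, comp_zero, add_zero,
    Category.comp_id]

lemma biprodV_snd : biprodV K L ≫ (const _).map biprod.snd = (jTilde B).map biprod.snd ≫ L.v := by
  rw [biprodV, Preadditive.add_comp, Category.assoc, Category.assoc, Category.assoc, Category.assoc,
    ← Functor.map_comp, ← Functor.map_comp, biprod.inl_snd, biprod.inr_snd,
    CategoryTheory.Functor.map_id, Functor.map_zero, comp_zero, comp_zero, zero_add,
    Category.comp_id]

/-- The direct sum of two quadruples. -/
abbrev biprodObj : CAB B where
  X := K.X ⊞ L.X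
  Y := K.Y ⊞ L.Y
  u := biprodU K L
  v := biprodV K L
  zero := by
    apply const_biprod_hom_ext
    · rw [Category.assoc, biprodV_fst, zero_comp, ← Functor.map_comp_assoc, biprodU,
        biprod.lift_fst, Functor.map_comp_assoc, K.zero, comp_zero]
    · rw [Category.assoc, biprodV_snd, zero_comp, ← Functor.map_comp_assoc, biprodU,
        biprod.lift_snd, Functor.map_comp_assoc, L.zero, comp_zero]
  comm := by
    apply const_biprod_hom_ext
    · refine (proExtend_comp_map biprod.fst biprod.fst (biprod.lift_fst _ _).symm
        (biprodV_fst K L)).trans ?_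
      rw [K.comm']
      exact jTildeToSelf_naturality _
    · refine (proExtend_comp_map biprod.snd biprod.snd (biprod.lift_snd _ _).symm
        (biprodV_snd K L)).trans ?_
      rw [L.comm']
      exact jTildeToSelf_naturality _

/-- The bicone of the direct sum of two quadruples. -/
def biprodBicone : BinaryBicone K L where
  pt := biprodObj K L
  fst := ⟨biprod.fst, biprod.fst, (biprod.lift_fst _ _).symm, biprodV_fst K L⟩
  snd := ⟨biprod.snd, biprod.snd, (biprod.lift_snd _ _).symm, biprodV_snd K L⟩
  inl := ⟨biprod.inl, biprod.inl, by
    have h₁ : (biprod.inl : K.Y ⟶ K.Y ⊞ L.Y).hom ≫ (biprod.fst : K.Y ⊞ L.Y ⟶ _).hom = 𝟙 _ :=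
      congrArg B.ι.map (biprod.inl_fst (X := K.Y) (Y := L.Y))
    have h₂ : (biprod.inl : K.Y ⟶ K.Y ⊞ L.Y).hom ≫ (biprod.snd : K.Y ⊞ L.Y ⟶ _).hom = 0 :=
      congrArg B.ι.map (biprod.inl_snd (X := K.Y) (Y := L.Y))
    apply biprod.hom_ext
    · simp [biprodU, reassoc_of% h₁]
    · simp [biprodU, reassoc_of% h₂], by
    apply const_biprod_hom_ext
    · rw [Category.assoc, Category.assoc, biprodV_fst, ← Functor.map_comp,
        ← Functor.map_comp_assoc, biprod.inl_fst, biprod.inl_fst, CategoryTheory.Functor.map_id,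
        CategoryTheory.Functor.map_id, Category.comp_id, Category.id_comp]
    · rw [Category.assoc, Category.assoc, biprodV_snd, ← Functor.map_comp,
        ← Functor.map_comp_assoc, biprod.inl_snd, biprod.inl_snd, Functor.map_zero,
        Functor.map_zero, comp_zero, zero_comp]⟩
  inr := ⟨biprod.inr, biprod.inr, by
    have h₁ : (biprod.inr : L.Y ⟶ K.Y ⊞ L.Y).hom ≫ (biprod.fst : K.Y ⊞ L.Y ⟶ _).hom = 0 :=
      congrArg B.ι.map (biprod.inr_fst (X := K.Y) (Y := L.Y))
    have h₂ : (biprod.inr : L.Y ⟶ K.Y ⊞ L.Y).hom ≫ (biprod.snd : K.Y ⊞ L.Y ⟶ _).hom = 𝟙 _ :=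
      congrArg B.ι.map (biprod.inr_snd (X := K.Y) (Y := L.Y))
    apply biprod.hom_ext
    · simp [biprodU, reassoc_of% h₁]
    · simp [biprodU, reassoc_of% h₂], by
    apply const_biprod_hom_ext
    · rw [Category.assoc, Category.assoc, biprodV_fst, ← Functor.map_comp,
        ← Functor.map_comp_assoc, biprod.inr_fst, biprod.inr_fst, Functor.map_zero,
        Functor.map_zero, comp_zero, zero_comp]
    · rw [Category.assoc, Category.assoc, biprodV_snd, ← Functor.map_comp,
        ← Functor.map_comp_assoc, biprod.inr_snd, biprod.inr_snd, CategoryTheory.Functor.map_id,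
        CategoryTheory.Functor.map_id, Category.comp_id, Category.id_comp]⟩
  inl_fst := hom_ext biprod.inl_fst biprod.inl_fst
  inl_snd := hom_ext biprod.inl_snd biprod.inl_snd
  inr_fst := hom_ext biprod.inr_fst biprod.inr_fst
  inr_snd := hom_ext biprod.inr_snd biprod.inr_snd

end

instance : HasBinaryBiproducts (CAB B) where
  has_binary_biproduct K L := hasBinaryBiproduct_of_total (biprodBicone K L)
    (hom_ext biprod.total biprod.total)

instance : HasFiniteProducts (CAB B) := hasFiniteProducts_of_has_binary_and_terminal

section

variable {K L : CAB B} (a : K ⟶ L)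

/-- The morphism `u` of the kernel of a morphism of quadruples. -/
def kernelU : (kernel a.g).obj ⟶ kernel a.f :=
  kernel.lift a.f ((kernel.ι a.g).hom ≫ K.u) (by
    have h : (kernel.ι a.g).hom ≫ a.g.hom = 0 := congrArg (fun t => t.hom) (kernel.condition a.g)
    rw [Category.assoc, ← a.comm_u, reassoc_of% h, zero_comp])

lemma kernelU_ι : kernelU a ≫ kernel.ι a.f = (kernel.ι a.g).hom ≫ K.u := kernel.lift_ι _ _ _

lemma exists_kernelV : ∃ v : (jTilde B).obj (kernel a.f) ⟶ (const _).obj (kernel a.g),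
    v ≫ (const _).map (kernel.ι a.g) = (jTilde B).map (kernel.ι a.f) ≫ K.v := by
  have hl := isLimitForkMapOfIsLimit' (const B.FullSubcategory) (kernel.condition _)
    (kernelIsKernel a.g)
  obtain ⟨v, hv⟩ := KernelFork.IsLimit.lift' hl ((jTilde B).map (kernel.ι a.f) ≫ K.v) (by
    rw [Category.assoc, a.comm_v, ← Functor.map_comp_assoc, kernel.condition, Functor.map_zero,
      zero_comp])
  exact ⟨v, hv⟩

/-- The morphism `v` of the kernel of a morphism of quadruples. -/
def kernelV : (jTilde B).obj (kernel a.f) ⟶ (const _).obj (kernel a.g) := (exists_kernelV a).choose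

lemma kernelV_ι : kernelV a ≫ (const _).map (kernel.ι a.g) = (jTilde B).map (kernel.ι a.f) ≫ K.v :=
  (exists_kernelV a).choose_spec

/-- The kernel of a morphism of quadruples. -/
abbrev kernelObj : CAB B where
  X := kernel a.f
  Y := kernel a.g
  u := kernelU a
  v := kernelV a
  zero := by
    rw [← cancel_mono ((const _).map (kernel.ι a.g)), Category.assoc, kernelV_ι,
      ← Functor.map_comp_assoc, kernelU_ι, Functor.map_comp_assoc, K.zero, comp_zero, zero_comp]
  comm := by
    refine (cancel_mono ((const A).map (kernel.ι a.f))).1 ?_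
    refine (proExtend_comp_map (kernel.ι a.f) (kernel.ι a.g) (kernelU_ι a).symm
        (kernelV_ι a)).trans ?_
    rw [K.comm']
    exact jTildeToSelf_naturality _

/-- The inclusion of the kernel. -/
abbrev kernelι : kernelObj a ⟶ K :=
  Hom.mk (K := kernelObj a) (kernel.ι a.f) (kernel.ι a.g) (kernelU_ι a).symm (kernelV_ι a)

lemma kernelι_comp : kernelι a ≫ a = 0 :=
  hom_ext (kernel.condition (a.f : K.X ⟶ L.X)) (kernel.condition (a.g : K.Y ⟶ L.Y))

/-- The factorization through the kernel. -/
def kernelLift {T : CAB B} (t : T ⟶ K) (h₁ : t.f ≫ a.f = 0) (h₂ : t.g ≫ a.g = 0) :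
    T ⟶ kernelObj a :=
  Hom.mk (L := kernelObj a) (kernel.lift a.f t.f h₁) (kernel.lift a.g t.g h₂)
    (by
      have h : (kernel.lift a.g t.g h₂).hom ≫ (kernel.ι a.g).hom = t.g.hom :=
        congrArg (fun t => t.hom) (kernel.lift_ι a.g t.g h₂)
      rw [← cancel_mono (kernel.ι a.f), Category.assoc, Category.assoc, kernelU_ι,
        kernel.lift_ι, reassoc_of% h, t.comm_u])
    (by
      rw [← cancel_mono ((const _).map (kernel.ι a.g)), Category.assoc, Category.assoc, kernelV_ι,
        ← Functor.map_comp, ← Functor.map_comp_assoc, kernel.lift_ι, kernel.lift_ι, t.comm_v])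

/-- `kernelι a` is a kernel of `a`. -/
def kernelIsLimit : IsLimit (KernelFork.ofι (kernelι a) (kernelι_comp a)) :=
  KernelFork.IsLimit.ofι _ _
    (fun t ht => kernelLift a t (congrArg Hom.f ht) (congrArg Hom.g ht))
    (fun _ _ => hom_ext (kernel.lift_ι _ _ _) (kernel.lift_ι _ _ _))
    (fun _ _ _ hm => hom_ext
      ((cancel_mono (kernel.ι a.f)).1 ((congrArg Hom.f hm).trans (kernel.lift_ι _ _ _).symm))
      ((cancel_mono (kernel.ι a.g)).1 ((congrArg Hom.g hm).trans (kernel.lift_ι _ _ _).symm)))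

lemma exists_cokernelU : ∃ u : (cokernel a.g).obj ⟶ cokernel a.f,
    (cokernel.π a.g).hom ≫ u = L.u ≫ cokernel.π a.f := by
  have := B.preservesCokernels_ι
  have hc := isColimitCoforkMapOfIsColimit' B.ι (cokernel.condition _) (cokernelIsCokernel a.g)
  obtain ⟨u, hu⟩ := CokernelCofork.IsColimit.desc' hc (L.u ≫ cokernel.π a.f) (by
    refine (Category.assoc _ _ _).symm.trans ((congrArg (· ≫ _) a.comm_u).trans ?_)
    rw [Category.assoc, cokernel.condition, comp_zero])
  exact ⟨u, hu⟩

/-- The morphism `u` of the cokernel of a morphism of quadruples. -/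
def cokernelU : (cokernel a.g).obj ⟶ cokernel a.f := (exists_cokernelU a).choose

lemma π_cokernelU : (cokernel.π a.g).hom ≫ cokernelU a = L.u ≫ cokernel.π a.f :=
  (exists_cokernelU a).choose_spec

lemma exists_cokernelV : ∃ v : (jTilde B).obj (cokernel a.f) ⟶ (const _).obj (cokernel a.g),
    (jTilde B).map (cokernel.π a.f) ≫ v = L.v ≫ (const _).map (cokernel.π a.g) := by
  exact exists_jTilde_desc_of_exact a.f (cokernel.π a.f) (cokernel.condition _)
    (cokernelIsCokernel _) _ (by
      rw [← Category.assoc, ← a.comm_v, Category.assoc, ← Functor.map_comp, cokernel.condition,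
        Functor.map_zero, comp_zero])

/-- The morphism `v` of the cokernel of a morphism of quadruples. -/
def cokernelV : (jTilde B).obj (cokernel a.f) ⟶ (const _).obj (cokernel a.g) :=
  (exists_cokernelV a).choose

lemma π_cokernelV :
    (jTilde B).map (cokernel.π a.f) ≫ cokernelV a = L.v ≫ (const _).map (cokernel.π a.g) :=
  (exists_cokernelV a).choose_spec

/-- The cokernel of a morphism of quadruples. -/
abbrev cokernelObj : CAB B where
  X := cokernel a.f
  Y := cokernel a.g
  u := cokernelU a
  v := cokernelV a
  zero := by
    rw [← cancel_epi ((jTilde B).map (cokernel.π a.g).hom), ← Functor.map_comp_assoc, π_cokernelU,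
      Functor.map_comp_assoc, π_cokernelV, reassoc_of% L.zero, zero_comp, comp_zero]
  comm := by
    change _ = jTildeToSelf B _
    rw [jTildeToSelf_eq (Classical.arbitrary (Good B (cokernel a.f)))]
    refine proExtend_eq_of_epi ((jTilde B).map (cokernel.π a.f)) _ _ _ _ ?_
    rw [← jTildeToSelf_eq]
    refine (proExtend_comp_map (cokernel.π a.f) (cokernel.π a.g) (π_cokernelU a)
      (π_cokernelV a).symm).symm.trans ?_
    rw [L.comm']
    exact (jTildeToSelf_naturality _).symm

/-- The projection to the cokernel. -/
abbrev cokernelπ : L ⟶ cokernelObj a :=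
  Hom.mk (L := cokernelObj a) (cokernel.π a.f) (cokernel.π a.g) (π_cokernelU a) (π_cokernelV a).symm

lemma comp_cokernelπ : a ≫ cokernelπ a = 0 :=
  hom_ext (cokernel.condition (a.f : K.X ⟶ L.X)) (cokernel.condition (a.g : K.Y ⟶ L.Y))

/-- The factorization through the cokernel. -/
def cokernelDesc {T : CAB B} (t : L ⟶ T) (h₁ : a.f ≫ t.f = 0) (h₂ : a.g ≫ t.g = 0) :
    cokernelObj a ⟶ T :=
  Hom.mk (K := cokernelObj a) (cokernel.desc a.f t.f h₁) (cokernel.desc a.g t.g h₂)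
    (by
      have h : (cokernel.π a.g).hom ≫ (cokernel.desc a.g t.g h₂).hom = t.g.hom :=
        congrArg (fun t => t.hom) (cokernel.π_desc a.g t.g h₂)
      rw [← cancel_epi (cokernel.π a.g).hom, reassoc_of% h, ← Category.assoc, π_cokernelU,
        Category.assoc, cokernel.π_desc, t.comm_u])
    (by
      rw [← cancel_epi ((jTilde B).map (cokernel.π a.f)), ← Category.assoc, π_cokernelV,
        Category.assoc, ← Functor.map_comp, ← Functor.map_comp_assoc, cokernel.π_desc,
        cokernel.π_desc, t.comm_v])

/-- `cokernelπ a` is a cokernel of `a`. -/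
def cokernelIsColimit : IsColimit (CokernelCofork.ofπ (cokernelπ a) (comp_cokernelπ a)) :=
  CokernelCofork.IsColimit.ofπ _ _
    (fun t ht => cokernelDesc a t (congrArg Hom.f ht) (congrArg Hom.g ht))
    (fun _ _ => hom_ext (cokernel.π_desc _ _ _) (cokernel.π_desc _ _ _))
    (fun _ _ _ hm => hom_ext
      ((cancel_epi (cokernel.π a.f)).1 ((congrArg Hom.f hm).trans (cokernel.π_desc _ _ _).symm))
      ((cancel_epi (cokernel.π a.g)).1 ((congrArg Hom.g hm).trans (cokernel.π_desc _ _ _).symm)))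

instance : PreservesLimit (parallelPair a 0) (forgetX B) :=
  preservesLimit_of_preserves_limit_cone (kernelIsLimit a)
    ((KernelFork.isLimitMapConeEquiv _ _).symm (kernelIsKernel (a.f : K.X ⟶ L.X)))

instance : PreservesLimit (parallelPair a 0) (forgetY B) :=
  preservesLimit_of_preserves_limit_cone (kernelIsLimit a)
    ((KernelFork.isLimitMapConeEquiv _ _).symm (kernelIsKernel (a.g : K.Y ⟶ L.Y)))

instance : PreservesColimit (parallelPair a 0) (forgetX B) :=
  preservesColimit_of_preserves_colimit_cocone (cokernelIsColimit a)
    ((CokernelCofork.isColimitMapCoconeEquiv _ _).symm (cokernelIsCokernel (a.f : K.X ⟶ L.X)))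

instance : PreservesColimit (parallelPair a 0) (forgetY B) :=
  preservesColimit_of_preserves_colimit_cocone (cokernelIsColimit a)
    ((CokernelCofork.isColimitMapCoconeEquiv _ _).symm (cokernelIsCokernel (a.g : K.Y ⟶ L.Y)))

end

instance : HasKernels (CAB B) where
  has_limit a := ⟨_, kernelIsLimit a⟩

instance : HasCokernels (CAB B) where
  has_colimit a := ⟨_, cokernelIsColimit a⟩

instance {K L : CAB B} (a : K ⟶ L) : IsIso (Abelian.coimageImageComparison a) := by
  apply isIso_of_isIso
  · have := Arrow.isIso_iff_isIso_of_isIso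
      (Abelian.PreservesCoimageImageComparison.iso (forgetX B) a).hom
    rw [this]
    infer_instance
  · have := Arrow.isIso_iff_isIso_of_isIso
      (Abelian.PreservesCoimageImageComparison.iso (forgetY B) a).hom
    rw [this]
    infer_instance

instance : Abelian (CAB B) := .ofCoimageImageComparisonIsIso

end CAB

open scoped CAB

/-! ### The functor `α` and its essential image -/

/-- A morphism to `α(X, Y)` is determined by its component in `A`, as `Y ⟶ X` is a monomorphism. -/
lemma α_hom_ext {T : CAB B} {K : EAB B} {a b : T ⟶ (α B).obj K} (h : a.f = b.f) : a = b := by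
  refine CAB.hom_ext h (Good.hom_ext ?_)
  refine a.comm_u.trans (Eq.trans ?_ b.comm_u.symm)
  rw [h]

instance : (α B).Additive where
  map_add := α_hom_ext rfl

instance : (α B).Faithful where
  map_injective h := EAB.hom_ext (congrArg CAB.Hom.f h)

/-- As `u` is the inclusion `Y ⊆ X`, compatibility with `u` says that `Y` is mapped to `Y'`. -/
instance : (α B).Full where
  map_surjective {K L} a := by
    refine ⟨⟨a.f, ?_⟩, α_hom_ext rfl⟩
    have h : K.Y.1.arrow ≫ a.f = a.g.hom ≫ L.Y.1.arrow := a.comm_u.symm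
    exact Eq.mpr (congrArg (fun t => L.Y.1.Factors t) h) (Subobject.factors_comp_arrow _)

/-- Locally on `X`, the morphism `v : j̃(X) ⟶ Y` of a quadruple is given by a morphism `w : Z ⟶ Y`
that is compatible with `u : Y ⟶ X`. -/
lemma CAB.exists_local_v (K : CAB B) : ∃ (W : A) (p : W ⟶ K.X) (_ : Epi p) (Z : Good B W)
    (w : Z.toB ⟶ K.Y), ((jTildeToJ B).app W ≫ jProj Z) ≫ (const _).map w = (jTilde B).map p ≫ K.v ∧
      w.hom ≫ K.u = Z.1.arrow ≫ p := by
  obtain ⟨W, p, hp, b, hb⟩ := exists_jTilde_local K.v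
  obtain ⟨Z, w, rfl⟩ := exists_jProj_fac b
  -- the two sides of the compatibility agree as morphisms `i(j(W)) ⟶ X`
  have h₁ : proExtend (jProj Z) (w.hom ≫ K.u) = proExtend (jProj Z) (Z.1.arrow ≫ p) := by
    refine proExtend_eq_of_epi ((jTildeToJ B).app W) _ _ _ _ ?_
    have k : proExtend ((jTildeToJ B).app W ≫ jProj Z) (Z.1.arrow ≫ p) =
        (proι B).map ((jTilde B).map p) ≫ jTildeToSelf B K.X := by
      rw [jTildeToSelf_naturality, jTildeToSelf_eq Z]
      exact (proExtend_comp (Z := Z.toB) _ _ _).symm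
    rw [map_proExtend, map_proExtend, k, ← K.comm', map_proExtend, ← hb, ← proExtend_map,
      Category.assoc]
  obtain ⟨Z', p', g, hp', hg⟩ := exists_eq_of_proExtend_eq _ _ _ h₁
  -- hence they agree on a smaller element of `Good B W`
  obtain ⟨Z₁, t, rfl⟩ := exists_jProj_fac p'
  obtain ⟨Z₂, h₂, h₂'⟩ := exists_le_le Z Z₁
  obtain ⟨Z₃, h₃, e⟩ := exists_jProj_eq (Good.ofLE h₂' ≫ t ≫ g) (Good.ofLE h₂) (by
    rw [jProj_w, Functor.map_comp, ← Category.assoc, jProj_w, Functor.map_comp, ← Category.assoc,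
      hp'])
  have e' : Good.ofLE (h₃.trans h₂) = Good.ofLE h₃ ≫ Good.ofLE h₂' ≫ t ≫ g := by
    rw [e]
    exact Good.hom_ext (by simp [ObjectProperty.homMk])
  refine ⟨W, p, hp, Z₃, Good.ofLE (h₃.trans h₂) ≫ w, ?_, ?_⟩
  · rw [Functor.map_comp, ← hb, Category.assoc, ← Category.assoc (jProj Z₃), jProj_w]
  · have h₄ : Z₃.1.arrow = (Good.ofLE (h₃.trans h₂)).hom ≫ Z.1.arrow :=
      (Subobject.ofLE_arrow _).symm
    have h₅ : (Good.ofLE (h₃.trans h₂) ≫ w).hom ≫ K.u =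
        (Good.ofLE (h₃.trans h₂)).hom ≫ w.hom ≫ K.u := Category.assoc _ _ _
    have h₆ : (Good.ofLE (h₃.trans h₂)).hom =
        ((Good.ofLE h₃).hom ≫ (Good.ofLE h₂').hom ≫ t.hom) ≫ g.hom := by
      rw [e']
      simp
    rw [h₅, h₄, Category.assoc, h₆, Category.assoc, hg]
    simp only [Category.assoc]

/-- A morphism `P ⟶ Y` is determined by `i(P) ⟶ i(Y) ⟶ X` if `Y ⟶ X` is a monomorphism. -/
lemma eq_of_proExtend_eq {P : Pro B.FullSubcategory} {Y : B.FullSubcategory} {X : A}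
    {p p' : P ⟶ (const _).obj Y} (u : Y.obj ⟶ X) [Mono u] (h : proExtend p u = proExtend p' u) :
    p = p' := by
  obtain ⟨q, h₁, h₂⟩ : ∃ q : P ⟶ (const _).obj (Y ⊞ Y), q ≫ (const _).map biprod.fst = p ∧
      q ≫ (const _).map biprod.snd = p' := by
    refine ⟨p ≫ (const _).map biprod.inl + p' ≫ (const _).map biprod.inr, ?_, ?_⟩ <;>
    simp [Preadditive.add_comp, Category.assoc, ← Functor.map_comp]
  rw [← h₁, ← h₂, proExtend_map, proExtend_map] at h
  obtain ⟨Y', q', g, hq, hg⟩ := exists_eq_of_proExtend_eq _ _ _ h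
  have hg' : g ≫ biprod.fst = g ≫ biprod.snd := by
    refine B.hom_ext ((cancel_mono u).1 ?_)
    exact (Category.assoc _ _ _).trans (hg.trans (Category.assoc _ _ _).symm)
  rw [← h₁, ← h₂, ← hq, Category.assoc, Category.assoc, ← Functor.map_comp, ← Functor.map_comp, hg']

/-- If `u : Y ⟶ X` is a monomorphism, then `X/Y` is in `B`, since it is a quotient of some `W/Z`. -/
lemma CAB.prop_cokernel_of_mono (K : CAB B) [Mono K.u] : B (cokernel (Subobject.mk K.u).arrow) := by
  obtain ⟨W, p, _, Z, w, -, hw⟩ := K.exists_local_v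
  have h : Z.1.arrow ≫ p ≫ cokernel.π (Subobject.mk K.u).arrow = 0 := by
    rw [← Category.assoc, ← hw, Category.assoc]
    have : (Subobject.mk K.u).Factors K.u := Subobject.mk_factors_self _
    rw [(EAB.factors_iff _ _).1 this, comp_zero]
  have : Epi (cokernel.desc _ _ h) := epi_of_epi_fac (cokernel.π_desc _ _ h)
  exact B.prop_of_epi (cokernel.desc _ _ h) Z.2.2

/-- The morphism `v` is determined by condition (ii) if `u` is a monomorphism. -/
lemma CAB.essImage_of_mono (K : CAB B) [Mono K.u] : (α B).essImage K := by
  let E : EAB B := ⟨K.X, ⟨Subobject.mk K.u,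
    B.prop_of_iso (Subobject.underlyingIso K.u).symm K.Y.property, K.prop_cokernel_of_mono⟩⟩
  let g : E.Y.toB ⟶ K.Y := B.homMk (Subobject.underlyingIso K.u).hom
  have hg : IsIso g := by
    have : IsIso (B.ι.map g) := inferInstanceAs (IsIso (Subobject.underlyingIso K.u).hom)
    exact isIso_of_reflects_iso g B.ι
  have hu : g.hom ≫ K.u = E.Y.1.arrow := Subobject.underlyingIso_hom_comp_eq_mk K.u
  let a : (α B).obj E ⟶ K :=
    { f := 𝟙 K.X
      g := g
      comm_u := hu.trans (Category.comp_id _).symm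
      comm_v := by
        have hv : (jTilde B).map (𝟙 K.X) ≫ K.v = K.v := by
          rw [CategoryTheory.Functor.map_id, Category.id_comp]
        refine Eq.trans ?_ hv.symm
        refine eq_of_proExtend_eq K.u ?_
        refine (proExtend_map _ _ _).trans ((congrArg _ hu).trans ?_)
        exact ((α B).obj E).comm'.trans K.comm'.symm }
  have : IsIso a := CAB.isIso_of_isIso a (inferInstanceAs (IsIso (𝟙 K.X))) hg
  exact ⟨E, ⟨asIso a⟩⟩

lemma CAB.mono_g {K L : CAB B} (a : K ⟶ L) [Mono a] : Mono a.g := by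
  refine Preadditive.mono_of_kernel_zero ?_
  have : kernelι a = 0 := (cancel_mono a).1 ((kernelι_comp a).trans zero_comp.symm)
  exact congrArg Hom.g this

/-- The essential image of `α` is closed under subobjects: it consists of the quadruples for which
`u` is a monomorphism. -/
lemma α_essImage_of_mono ⦃K : EAB B⦄ ⦃c : CAB B⦄ (i : c ⟶ (α B).obj K) [Mono i] :
    (α B).essImage c := by
  have := CAB.mono_g i
  have : Mono ((α B).obj K).u := inferInstanceAs (Mono K.Y.1.arrow)
  have h : Mono (c.u ≫ i.f) := by
    rw [← i.comm_u]
    exact mono_comp i.g.hom ((α B).obj K).u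
  have : Mono c.u := mono_of_mono c.u i.f
  exact c.essImage_of_mono

/-- The pair `(Y, Y)` for `Y ∈ B`. -/
def EAB.diag (Y : B.FullSubcategory) : EAB B where
  X := Y.obj
  Y := ⟨⊤, B.prop_of_mono (⊤ : Subobject Y.obj).arrow Y.property, B.prop_of_epi
    (cokernel.π (⊤ : Subobject Y.obj).arrow) Y.property⟩

/-- Here `u` is an isomorphism, so condition (i) says that `v` is zero. -/
lemma v_α_diag (Y : B.FullSubcategory) : ((α B).obj (EAB.diag Y)).v = 0 := by
  have h := ((α B).obj (EAB.diag Y)).zero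
  have : Epi ((α B).obj (EAB.diag Y)).u :=
    inferInstanceAs (Epi (⊤ : Subobject Y.obj).arrow)
  exact (cancel_epi ((jTilde B).map ((α B).obj (EAB.diag Y)).u)).1 (h.trans comp_zero.symm)

/-- Every quadruple `(X, Y, u, v)` is a quotient of an object in the image of `α`: if `w : Z ⟶ Y`
represents `v` on a cover `W` of `X`, then `(W, Z) ⊕ (Y, Y)` maps onto it by `(p, w)` and
`(u, id)`. -/
lemma exists_epi_α (c : CAB B) : ∃ (K : EAB B) (p : (α B).obj K ⟶ c), Epi p := by
  obtain ⟨W, p, _, Z, w, hv, hu⟩ := c.exists_local_v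
  let m₁ : (α B).obj ⟨W, Z⟩ ⟶ c := { f := p, g := w, comm_u := hu, comm_v := hv }
  let m₂ : (α B).obj (EAB.diag c.Y) ⟶ c :=
    { f := c.u
      g := B.homMk (⊤ : Subobject c.Y.obj).arrow
      comm_u := rfl
      comm_v := by
        rw [v_α_diag, zero_comp]
        exact c.zero.symm }
  refine ⟨⟨W, Z⟩ ⊞ EAB.diag c.Y, (α B).map biprod.fst ≫ m₁ + (α B).map biprod.snd ≫ m₂, ?_⟩
  refine Preadditive.epi_of_cancel_zero _ fun {T} t ht => ?_
  have h₁ : m₁ ≫ t = 0 := by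
    have := (α B).map biprod.inl ≫= ht
    simpa [← Functor.map_comp_assoc, Preadditive.comp_add, Preadditive.add_comp] using this
  have h₂ : m₂ ≫ t = 0 := by
    have := (α B).map biprod.inr ≫= ht
    simpa [← Functor.map_comp_assoc, Preadditive.comp_add, Preadditive.add_comp] using this
  refine CAB.hom_ext ((cancel_epi p).1 ((congrArg CAB.Hom.f h₁).trans comp_zero.symm)) ?_
  have h₃ : (⊤ : Subobject c.Y.obj).arrow ≫ t.g.hom = 0 :=
    congrArg (fun a => (CAB.Hom.g a).hom) h₂
  exact B.hom_ext ((cancel_epi (⊤ : Subobject c.Y.obj).arrow).1 (h₃.trans comp_zero.symm))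

end Devissage

end

theorem proposition3p7 {A : Type v} [SmallCategory A] [Abelian A] (B : ObjectProperty A)
    [Devissage.IsTwoStep B] :
    -- `j̃` is the universal right exact functor over `j`
    (PreservesFiniteColimits (Devissage.jTilde B) ∧
      ∀ F : A ⥤ ProObj.Pro B.FullSubcategory, PreservesFiniteColimits F →
        ∀ θ : F ⟶ Devissage.j B, ∃! θ' : F ⟶ Devissage.jTilde B,
          θ' ≫ Devissage.jTildeToJ B = θ) ∧
    -- `E_{A,B}` is quasi-abelian
    QuasiAb.IsQuasiAbelian (Devissage.EAB B) ∧
    -- `C_{A,B}` is abelian and `α` is exact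
    (∃ (_ : Abelian (Devissage.CAB B)) (_ : (Devissage.α B).Additive),
      ∀ S : ShortComplex (Devissage.EAB B), QuasiAb.IsAdmissible S →
        (S.map (Devissage.α B)).ShortExact) ∧
    -- `α` is fully faithful
    (Devissage.α B).Full ∧ (Devissage.α B).Faithful ∧
    -- `α` extends to an equivalence from the abelian envelope of `E_{A,B}` to `C_{A,B}`
    ∃ (h : ∀ K : Devissage.EAB B,
        QuasiAb.heart (Devissage.EAB B) ((QuasiAb.toDb (Devissage.EAB B)).obj K))
      (e : QuasiAb.LH (Devissage.EAB B) ≌ Devissage.CAB B),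
      Nonempty ((QuasiAb.heart (Devissage.EAB B)).lift (QuasiAb.toDb (Devissage.EAB B)) h ⋙
        e.functor ≅ Devissage.α B) := by
  exact ⟨⟨inferInstance, fun F _ θ => Devissage.existsUnique_jTilde_lift F θ⟩,
    Devissage.EAB.isQuasiAbelian,
    ⟨inferInstance, inferInstance, fun S hS =>
      QuasiAb.shortExact_of_isAdmissible Devissage.α_essImage_of_mono S hS⟩,
    inferInstance, inferInstance,
    QuasiAb.exists_LH_equivalence Devissage.α_essImage_of_mono Devissage.exists_epi_α⟩
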